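/- Let $p$ be a prime, let $d^Nx$ be the Haar measure on $\mathbb{Q}_p^N$ with $\mathrm{vol}(\mathbb{Z}_p^N)=1$, let $\chi_p(y)=e^{2\pi i\{y\}_p}$, and write $\mathcal{F}\varphi(\xi)=\int\chi_p(-\xi\cdot x)\varphi(x)\,d^Nx$; for a finite signed measure $\nu$ on $\mathbb{Q}_p^N$, $\mathcal{F}\nu(\xi)=\int\chi_p(-\xi\cdot x)\,\nu(dx)$. Let $\mathcal{D}$ (resp. $\mathcal{D}_{\mathbb{R}}$) be the space of complex-valued (resp. real-valued) locally constant functions with compact support on $\mathbb{Q}_p^N$. **Noise.** Let $\Lambda$ and $\mu$ be regular (non-negative) Borel measures on $\mathbb{Q}_p^N$ such that $\Lambda$ is the Fourier transform of $\mu$, that is, $\int\varphi\,d\Lambda=\int\mathcal{F}\varphi\,d\mu$ for all $\varphi\in\mathcal{D}$ (for example $\Lambda(dx)=f(x)\,d^Nx$ with a non-negative kernel $f$ that is continuous off $0$, or $\Lambda=\delta_0$ for white noise). On a complete probability space $(\Omega,\mathcal{A},P)$ let $W(\varphi)$ be mean zero Gaussian random variables, indexed by the linear combinations $\varphi$ of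 functions $1_I(t)\phi(x)$ with $I\subset\mathbb{R}$ a bounded interval and $\phi\in\mathcal{D}_{\mathbb{R}}$, with covariance $$E\big(W(\varphi)W(\psi)\big)=\int_0^\infty\int_{\mathbb{Q}_p^N}\Big(\int_{\mathbb{Q}_p^N}\varphi(t,x)\psi(t,x-z)\,d^Nx\Big)\Lambda(dz)\,dt .$$ Let $U$ be the completion of $\mathcal{D}_{\mathbb{R}}$ for the semi-inner product $\langle\varphi,\psi\rangle_U=\int\mathcal{F}\varphi\,\overline{\mathcal{F}\psi}\,d\mu$; through $\varphi\mapsto\mathcal{F}\varphi$ it is identified with the closure of $\mathcal{F}(\mathcal{D}_{\mathbb{R}})$ in $L^2(\mu)$, and a finite signed measure $\nu$ is said to belong to $U$ if $\mathcal{F}\nu$ belongs to this closure. For $t\ge 0$, the map $\varphi\mapsto W_t(\varphi):=W(1_{[0,t]}\varphi)$, $\varphi\in\mathcal{D}_{\mathbb{R}}$, has a unique continuous linear extension $W_t:U\to L^2(\Omega)$. Let $\mathcal{F}_t$ be the $\sigma$-field generated by $W_s(h)$, $0\le s\le t$, $h\in U$, and the $P$-null sets. Fix $T>0$; the predictable $\sigma$-field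 on $[0,T]\times\Omega$ is generated by the sets $(s,t]\times A$ with $0\le s<t\le T$, $A\in\mathcal{F}_s$. Set $U_T=L^2([0,T];U)$. For a predictable $g\in L^2(\Omega\times[0,T];U)$, the stochastic integral is $g\cdot W=\sum_j\int_0^T\langle g_s,e_j\rangle_U\,dW_s(e_j)$, a series of Itô integrals that converges in $L^2(\Omega)$, where $(e_j)$ is any complete orthonormal basis of $U$. **Hypothesis A.** $(\Gamma(t,dx))_{t\ge0}$ is a (measurable) family of non-negative Borel measures on $\mathbb{Q}_p^N$ with $$\int_0^T\int_{\mathbb{Q}_p^N}|\mathcal{F}\Gamma(t)(\xi)|^2\,d\mu(\xi)\,dt<\infty,\qquad \sup_{0\le t\le T'}\Gamma(t,\mathbb{Q}_p^N)<\infty\ \text{ for all } T'>0 .$$ **Proposition.** Assume that $\Gamma$ satisfies Hypothesis A. Let $Y=\{Y(t,x),(t,x)\in[0,T]\times\mathbb{Q}_p^N\}$ be a real-valued predictable process (jointly measurable for the product of the predictable $\sigma$-field and the Borel $\sigma$-field of $\mathbb{Q}_p^N$) with $$C_Y:=\sup_{(t,x)\in[0,T]\times\mathbb{Q}_p^N}E\big(|Y(t,x)|^2\big)<\infty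 .$$ Then, for $dt\otimes P$-almost every $(t,\omega)$, $G(t)=Y(t,x)\,\Gamma(t,dx)$ is a finite signed measure that belongs to $U$, and $G$ (set equal to $0$ where this fails) is a predictable $U$-valued process in $L^2(\Omega\times[0,T];U)$. Moreover $$E\big(\|G\|_{U_T}^2\big)=E\Big[\int_0^T\int_{\mathbb{Q}_p^N}|\mathcal{F}(Y(t)\Gamma(t))(\xi)|^2\,d\mu(\xi)\,dt\Big]\le C_Y\int_0^T\int_{\mathbb{Q}_p^N}|\mathcal{F}\Gamma(t)(\xi)|^2\,d\mu(\xi)\,dt,$$ and the stochastic integral $G\cdot W$ exists, is unique in $L^2(\Omega)$, and satisfies $$E\big(|G\cdot W|^2\big)\le\int_0^T\Big(\sup_{x\in\mathbb{Q}_p^N}E\big(|Y(s,x)|^2\big)\Big)\int_{\mathbb{Q}_p^N}|\mathcal{F}\Gamma(s)(\xi)|^2\,d\mu(\xi)\,ds .$$ -/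

import Mathlib

open MeasureTheory ProbabilityTheory Filter Topology
open scoped ENNReal NNReal

noncomputable section

namespace PadicNoise

/-! ### `p`-adic analysis -/

instance instMeasurableSpacePadic (p : ℕ) [Fact p.Prime] : MeasurableSpace ℚ_[p] := borel _

instance instBorelSpacePadic (p : ℕ) [Fact p.Prime] : BorelSpace ℚ_[p] := ⟨rfl⟩

/-- The space `ℚ_p^N`, with the maximum norm and its Borel `σ`-algebra. -/
abbrev Space (p : ℕ) [Fact p.Prime] (N : ℕ) : Type := Fin N → ℚ_[p]

/-- The unit ball `B_0^N = ℤ_p^N` of `ℚ_p^N`. -/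
def unitBall (p : ℕ) [Fact p.Prime] (N : ℕ) :
    TopologicalSpace.PositiveCompacts (Space p N) where
  carrier := Metric.closedBall 0 1
  isCompact' := isCompact_closedBall 0 1
  interior_nonempty' :=
    ⟨0, Metric.ball_subset_interior_closedBall (Metric.mem_ball_self one_pos)⟩

/-- The Haar measure `d^N x` on `ℚ_p^N` with `vol(B_0^N) = 1`. -/
def haar (p : ℕ) [Fact p.Prime] (N : ℕ) : Measure (Space p N) :=
  Measure.addHaarMeasure (unitBall p N)

/-- `p ^ n * y` is a `p`-adic integer for `n = max (-ord y) 0`. -/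
theorem norm_pow_mul_le_one (p : ℕ) [Fact p.Prime] (y : ℚ_[p]) :
    ‖(p : ℚ_[p]) ^ (-y.valuation).toNat * y‖ ≤ 1 := by
  by_cases hy : y = 0
  · simp [hy]
  · have hp : (1 : ℝ) < p := by exact_mod_cast (Fact.out : p.Prime).one_lt
    have hp0 : (p : ℝ) ≠ 0 := by positivity
    rw [norm_mul, norm_pow, Padic.norm_p, Padic.norm_eq_zpow_neg_valuation hy, inv_pow,
      ← zpow_natCast, ← zpow_neg, ← zpow_add₀ hp0]
    apply zpow_le_one_of_nonpos₀ hp.le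
    have := Int.self_le_toNat (-y.valuation)
    omega

/-- The fractional part `{y}_p`: with `n = max (-ord y) 0`, it is `a / p ^ n`, where
`a = ∑_{j < n} a_j p^j` is the truncation of the expansion of the `p`-adic integer `p ^ n y`. -/
def fracPart (p : ℕ) [Fact p.Prime] (y : ℚ_[p]) : ℚ :=
  (PadicInt.appr (⟨(p : ℚ_[p]) ^ (-y.valuation).toNat * y, norm_pow_mul_le_one p y⟩ : ℤ_[p])
    (-y.valuation).toNat : ℚ) / (p : ℚ) ^ (-y.valuation).toNat

/-- The additive character `χ_p(y) = exp(2 π i {y}_p)`. -/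
def chi (p : ℕ) [Fact p.Prime] (y : ℚ_[p]) : ℂ :=
  Complex.exp (2 * Real.pi * Complex.I * (fracPart p y : ℂ))

/-- The Bruhat-Schwartz space of locally constant, compactly supported functions
`ℚ_p^N → 𝕜`, for `𝕜 = ℝ` or `ℂ`. -/
def TestFunction (p : ℕ) [Fact p.Prime] (N : ℕ) (𝕜 : Type) [RCLike 𝕜] :
    Submodule 𝕜 (Space p N → 𝕜) where
  carrier := {φ | IsLocallyConstant φ ∧ HasCompactSupport φ}
  add_mem' := fun ha hb => ⟨ha.1.add hb.1, ha.2.add hb.2⟩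
  zero_mem' := ⟨IsLocallyConstant.const 0, HasCompactSupport.zero⟩
  smul_mem' := fun c _ ha => ⟨ha.1.comp (fun z => c • z), ha.2.comp_left (smul_zero c)⟩

/-- The Fourier transform `(ℱ φ)(ξ) = ∫ χ_p(-ξ · x) φ(x) d^N x`. -/
def fourier {p : ℕ} [Fact p.Prime] {N : ℕ} (φ : Space p N → ℂ) (ξ : Space p N) : ℂ :=
  ∫ x, chi p (-(ξ ⬝ᵥ x)) * φ x ∂(haar p N)

/-- The Fourier transform of the signed measure `y(x) ν(dx)`:
`ξ ↦ ∫ χ_p(-ξ · x) y(x) ν(dx)`. -/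
def fourierMeasure {p : ℕ} [Fact p.Prime] {N : ℕ} (y : Space p N → ℝ)
    (ν : Measure (Space p N)) (ξ : Space p N) : ℂ :=
  ∫ x, chi p (-(ξ ⬝ᵥ x)) * (y x : ℂ) ∂ν

/-- The Fourier transform of the positive distribution given by the measure `ν`. -/
def fourierPos {p : ℕ} [Fact p.Prime] {N : ℕ} (ν : Measure (Space p N)) (ξ : Space p N) : ℂ :=
  fourierMeasure (fun _ => 1) ν ξ

/-! ### The Gaussian noise -/

/-- `ℐ(ℝ)`: linear combinations of indicators of bounded intervals. -/
def StepFunction : Submodule ℝ (ℝ → ℝ) :=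
  Submodule.span ℝ {c | ∃ I : Set ℝ, I.OrdConnected ∧ Bornology.IsBounded I ∧
    c = I.indicator (fun _ => (1 : ℝ))}

/-- `ℐ(ℝ) ⊗_alg 𝒟_ℝ(ℚ_p^N)`, as a space of functions of `(t, x)`. -/
def NoiseTest (p : ℕ) [Fact p.Prime] (N : ℕ) : Submodule ℝ (ℝ → Space p N → ℝ) :=
  Submodule.span ℝ {ψ | ∃ c ∈ StepFunction, ∃ φ ∈ TestFunction p N ℝ, ψ = fun t x => c t * φ x}

/-- The element `(s, x) ↦ 1_{[0,t]}(s) φ(x)`. -/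
def cylTest {p : ℕ} [Fact p.Prime] {N : ℕ} (t : ℝ) (φ : TestFunction p N ℝ) : NoiseTest p N :=
  ⟨fun s x => (Set.Icc (0 : ℝ) t).indicator (fun _ => (1 : ℝ)) s * φ.1 x,
    Submodule.subset_span ⟨_, Submodule.subset_span
      ⟨Set.Icc 0 t, Set.ordConnected_Icc, Metric.isBounded_Icc 0 t, rfl⟩, φ.1, φ.2, rfl⟩⟩

/-- `Λ`, regarded as a distribution, is the Fourier transform of `μ`:
`(Λ, φ) = ∫ ℱ φ dμ` for all test functions. Here `Λ` is the covariance kernel of the noise: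
`Λ(dx) = f(x) d^N x` for a non-negative kernel function `f`, and the Dirac measure at `0`
for white noise. -/
def IsSpectralMeasure {p : ℕ} [Fact p.Prime] {N : ℕ} (Λ μ : Measure (Space p N)) : Prop :=
  ∀ φ : TestFunction p N ℂ, ∫ x, φ.1 x ∂Λ = ∫ ξ, fourier φ.1 ξ ∂μ

/-- `W` is a family of mean zero Gaussian random variables with covariance
`E (W φ W ψ) = ∫_0^∞ ∫ (φ(t) ∗ ψ̃(t))(z) Λ(dz) dt`, where `ψ̃(t)(z) = ψ(t, -z)`. -/
structure IsGaussianNoise {p : ℕ} [Fact p.Prime] {N : ℕ} {Ω : Type*} [MeasurableSpace Ω]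
    (Λ : Measure (Space p N)) (P : Measure Ω) (W : NoiseTest p N → Ω → ℝ) : Prop where
  gaussian : ∀ φ, ∃ v : ℝ≥0, HasLaw (W φ) (gaussianReal 0 v) P
  covariance : ∀ φ ψ : NoiseTest p N, ∫ ω, W φ ω * W ψ ω ∂P =
    ∫ t in Set.Ioi (0 : ℝ), ∫ z, (∫ x, φ.1 t x * ψ.1 t (x - z) ∂(haar p N)) ∂Λ

/-! ### The Hilbert space `U` and the cylindrical Wiener process -/

/-- The completion `U` of `𝒟_ℝ(ℚ_p^N)` for the semi-inner product
`⟨φ, ψ⟩_U = ∫ ℱφ conj(ℱψ) dμ`, realized through `φ ↦ ℱφ` as the closure of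
`{ℱφ | φ ∈ 𝒟_ℝ(ℚ_p^N)}` in the real Hilbert space `L²(μ; ℂ)`. -/
def U {p : ℕ} [Fact p.Prime] {N : ℕ} (μ : Measure (Space p N)) : Submodule ℝ (Lp ℂ 2 μ) :=
  (Submodule.span ℝ {u : Lp ℂ 2 μ | ∃ φ : TestFunction p N ℝ,
    u =ᵐ[μ] fourier (fun x => (φ.1 x : ℂ))}).topologicalClosure

/-- The element of `U` whose Fourier transform is the function `h` (and `0` if there is none). -/
def ofFourier {p : ℕ} [Fact p.Prime] {N : ℕ} (μ : Measure (Space p N)) (h : Space p N → ℂ) :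
    U μ :=
  open Classical in
  if H : ∃ u : U μ, (u : Lp ℂ 2 μ) =ᵐ[μ] h then H.choose else 0

/-- `L` is the extension to `U`, by linearity and continuity, of
`φ ↦ W(1_{[0,t]} φ)`, `φ ∈ 𝒟_ℝ(ℚ_p^N)`. There is at most one, since `𝒟_ℝ(ℚ_p^N)` is dense
in `U`. -/
def IsWienerExtension {p : ℕ} [Fact p.Prime] {N : ℕ} {Ω : Type*} [MeasurableSpace Ω]
    (μ : Measure (Space p N)) (P : Measure Ω) (W : NoiseTest p N → Ω → ℝ) (t : ℝ)
    (L : U μ →L[ℝ] Lp ℝ 2 P) : Prop :=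
  ∀ (φ : TestFunction p N ℝ) (u : U μ),
    (u : Lp ℂ 2 μ) =ᵐ[μ] fourier (fun x => (φ.1 x : ℂ)) → L u =ᵐ[P] W (cylTest t φ)

/-- The cylindrical Wiener process `W_t(h)`, `t ≥ 0`, `h ∈ U`, associated with `W`. -/
def wiener {p : ℕ} [Fact p.Prime] {N : ℕ} {Ω : Type*} [MeasurableSpace Ω]
    (μ : Measure (Space p N)) (P : Measure Ω) (W : NoiseTest p N → Ω → ℝ) (t : ℝ) :
    U μ →L[ℝ] Lp ℝ 2 P :=
  open Classical in
  if H : ∃ L, IsWienerExtension μ P W t L then H.choose else 0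

/-- `ℱ_t`: the `σ`-field generated by `W_s(h)`, `h ∈ U`, `0 ≤ s ≤ t`, and the `P`-null sets. -/
@[reducible]
def sigmaField {p : ℕ} [Fact p.Prime] {N : ℕ} {Ω : Type*} [MeasurableSpace Ω]
    (μ : Measure (Space p N)) (P : Measure Ω) (W : NoiseTest p N → Ω → ℝ) (t : ℝ) :
    MeasurableSpace Ω :=
  (⨆ s ∈ Set.Icc (0 : ℝ) t, ⨆ h : U μ, MeasurableSpace.comap (wiener μ P W s h) (borel ℝ)) ⊔
    MeasurableSpace.generateFrom {A | P A = 0}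

/-- The time interval `[0, T]`. -/
abbrev Time (T : ℝ) : Type := Set.Icc (0 : ℝ) T

/-- The Lebesgue measure `dt` on `[0, T]`. -/
def lebesgue (T : ℝ) : Measure (Time T) := Measure.comap Subtype.val volume

/-- The predictable `σ`-field in `[0, T] × Ω`, generated by the sets `(s, t] × A`,
`A ∈ ℱ_s`, `0 ≤ s < t ≤ T`. -/
@[reducible]
def predictable {p : ℕ} [Fact p.Prime] {N : ℕ} {Ω : Type*} [MeasurableSpace Ω]
    (μ : Measure (Space p N)) (P : Measure Ω) (W : NoiseTest p N → Ω → ℝ) (T : ℝ) :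
    MeasurableSpace (Time T × Ω) :=
  MeasurableSpace.generateFrom {S | ∃ (s t : ℝ) (A : Set Ω), 0 ≤ s ∧ s < t ∧ t ≤ T ∧
    MeasurableSet[sigmaField μ P W s] A ∧ S = {q | s < q.1 ∧ (q.1 : ℝ) ≤ t ∧ q.2 ∈ A}}

/-! ### The stochastic integral -/

/-- A simple process `∑_k X_k 1_{(a_k, b_k]}`, with `0 ≤ a_k < b_k ≤ T` and bounded,
`ℱ_{a_k}`-measurable `X_k`. -/
structure SimpleProcess {p : ℕ} [Fact p.Prime] {N : ℕ} {Ω : Type*} [MeasurableSpace Ω]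
    (μ : Measure (Space p N)) (P : Measure Ω) (W : NoiseTest p N → Ω → ℝ) (T : ℝ) where
  n : ℕ
  a : Fin n → ℝ
  b : Fin n → ℝ
  X : Fin n → Ω → ℝ
  nonneg : ∀ k, 0 ≤ a k
  lt : ∀ k, a k < b k
  le : ∀ k, b k ≤ T
  meas : ∀ k, Measurable[sigmaField μ P W (a k)] (X k)
  bdd : ∀ k, ∃ C : ℝ, ∀ ω, |X k ω| ≤ C

/-- The process `∑_k X_k 1_{(a_k, b_k]}`. -/
def SimpleProcess.eval {p : ℕ} [Fact p.Prime] {N : ℕ} {Ω : Type*} [MeasurableSpace Ω]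
    {μ : Measure (Space p N)} {P : Measure Ω} {W : NoiseTest p N → Ω → ℝ} {T : ℝ}
    (S : SimpleProcess μ P W T) (q : Time T × Ω) : ℝ :=
  ∑ k, (Set.Ioc (S.a k) (S.b k)).indicator (fun _ => S.X k q.2) (q.1 : ℝ)

/-- The Itô integral `∑_k X_k (W_{b_k}(h) - W_{a_k}(h))` of a simple process. -/
def SimpleProcess.integral {p : ℕ} [Fact p.Prime] {N : ℕ} {Ω : Type*} [MeasurableSpace Ω]
    {μ : Measure (Space p N)} {P : Measure Ω} {W : NoiseTest p N → Ω → ℝ} {T : ℝ}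
    (S : SimpleProcess μ P W T) (h : U μ) (ω : Ω) : ℝ :=
  ∑ k, S.X k ω * (wiener μ P W (S.b k) h ω - wiener μ P W (S.a k) h ω)

/-- `I` is the Itô integral `∫_0^T ψ_s dW_s(h)`: the `L²(Ω)` limit of the integrals of simple
processes that converge to `ψ` in `L²([0, T] × Ω)`. -/
def IsItoIntegral {p : ℕ} [Fact p.Prime] {N : ℕ} {Ω : Type*} [MeasurableSpace Ω]
    (μ : Measure (Space p N)) (P : Measure Ω) (W : NoiseTest p N → Ω → ℝ) (T : ℝ)
    (h : U μ) (ψ : Time T × Ω → ℝ) (I : Lp ℝ 2 P) : Prop :=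
  ∃ S : ℕ → SimpleProcess μ P W T,
    Tendsto (fun n => eLpNorm ((S n).eval - ψ) 2 ((lebesgue T).prod P))
      atTop (𝓝 0) ∧
    Tendsto (fun n => eLpNorm ((S n).integral h - ⇑I) 2 P) atTop (𝓝 0)

/-- `I` is the stochastic integral `g · W = ∑_j ∫_0^T ⟨g_s, e_j⟩_U dW_s(e_j)`, the series
converging in `L²(Ω)` to `I` for every complete orthonormal basis `(e_j)` of `U`. -/
def IsStochasticIntegral {p : ℕ} [Fact p.Prime] {N : ℕ} {Ω : Type*} [MeasurableSpace Ω]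
    (μ : Measure (Space p N)) (P : Measure Ω) (W : NoiseTest p N → Ω → ℝ) (T : ℝ)
    (g : Time T × Ω → U μ) (I : Lp ℝ 2 P) : Prop :=
  ∀ (ι : Type) (e : HilbertBasis ι ℝ (U μ)), ∃ J : ι → Lp ℝ 2 P,
    (∀ j, IsItoIntegral μ P W T (e j) (fun q => inner ℝ (g q) (e j)) (J j)) ∧ HasSum J I

/-! ### The integrands -/

/-- Hypothesis A, with time horizon `T`. For `t ≥ 0`, the measure `Γ t` is `Γ(t, d^N x)`, which
stands for the positive distribution `φ ↦ ∫ φ(x) Γ(t, d^N x)`. -/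
structure HypothesisA {p : ℕ} [Fact p.Prime] {N : ℕ} (μ : Measure (Space p N)) (T : ℝ)
    (Γ : ℝ → Measure (Space p N)) : Prop where
  measurable : Measurable (fun t : Set.Ici (0 : ℝ) => Γ t)
  integral_lt_top : (∫⁻ t : Time T, ∫⁻ ξ, ‖fourierPos (Γ t) ξ‖ₑ ^ 2 ∂μ ∂(lebesgue T)) < ⊤
  sup_mass_lt_top : ∀ T' : ℝ, 0 < T' → (⨆ t ∈ Set.Icc (0 : ℝ) T', Γ t Set.univ) < ⊤

/-- A random field `Y(t, x)` is predictable if it is measurable for the product of the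
predictable `σ`-field in `[0, T] × Ω` and the Borel `σ`-field of `ℚ_p^N`. -/
def IsPredictableField {p : ℕ} [Fact p.Prime] {N : ℕ} {Ω : Type*} [MeasurableSpace Ω]
    (μ : Measure (Space p N)) (P : Measure Ω) (W : NoiseTest p N → Ω → ℝ) (T : ℝ)
    (Y : Time T → Space p N → Ω → ℝ) : Prop :=
  Measurable[(predictable μ P W T).prod (MeasurableSpace.pi : MeasurableSpace (Space p N))]
    (fun z : (Time T × Ω) × Space p N => Y z.1.1 z.2 z.1.2)

/-- The `U`-valued process `G(t) = Y(t, x) Γ(t, d^N x)`, identified with an element of `U`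
through its Fourier transform. -/
def integrand {p : ℕ} [Fact p.Prime] {N : ℕ} {Ω : Type*} (μ : Measure (Space p N)) {T : ℝ}
    (Γ : ℝ → Measure (Space p N)) (Y : Time T → Space p N → Ω → ℝ) (q : Time T × Ω) : U μ :=
  ofFourier μ (fourierMeasure (fun x => Y q.1 x q.2) (Γ q.1))

end PadicNoise

end

/-!
For `Y` of bounded support and `B` the dual of a ball `B'`, the average `(Y Γ) ∗ (1_B / vol B)` is a
test function whose Fourier transform is that of `Y Γ` truncated to `B'`. Hence `Y Γ` belongs to `U`
as soon as its Fourier transform is square integrable for `μ`. Moreover the spectral identity turns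
the energy `∫_{B'} |ℱ(Y Γ)|² dμ` into a double integral of `Y(x) Y(x')` against a non-negative
kernel, so Cauchy–Schwarz in `ω` bounds its mean by `sup_x E|Y(x)|²` times the energy of `Γ`; this
positivity is what allows a random density under the Fourier transform. Monotone convergence
removes the truncation.

For the stochastic integral, increments of `W` after time `s` are orthogonal to, hence (being
jointly Gaussian) independent of, the past up to `s`. The Itô isometry therefore polarizes to
`E[J(h) J(h')] = ⟨h, h'⟩ E ∫ ⟨g, h⟩ ⟨g, h'⟩ dt` for the Itô integrals `J(h)` of `⟨g, h⟩` against
`W(h)`. Along an orthonormal basis this makes the terms of the defining series orthogonal, with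
square norms summing to `E ∫ ‖g‖² dt`, and the same identity shows that two bases give the same sum.
-/

noncomputable section

namespace PadicNoise

open scoped ComplexConjugate

section SquareIntegrable

variable {α E : Type*} {m : MeasurableSpace α} {ν : Measure α} [NormedAddCommGroup E]

lemma eLpNorm_two_sq (f : α → E) : eLpNorm f 2 ν ^ 2 = ∫⁻ a, ‖f a‖ₑ ^ 2 ∂ν := by
  have h := eLpNorm_nnreal_pow_eq_lintegral (f := f) (μ := ν) (p := 2) (by simp)
  simpa using! h

lemma memLp_two_iff_lintegral_enorm_sq_lt_top {f : α → E} (hf : AEStronglyMeasurable f ν) :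
    MemLp f 2 ν ↔ ∫⁻ a, ‖f a‖ₑ ^ 2 ∂ν < ⊤ := by
  rw [← eLpNorm_two_sq, MemLp, and_iff_right hf]
  simp

lemma tendsto_eLpNorm_two_zero_iff {f : ℕ → α → E} :
    Tendsto (fun n => eLpNorm (f n) 2 ν) atTop (𝓝 0) ↔
      Tendsto (fun n => ∫⁻ a, ‖f n a‖ₑ ^ 2 ∂ν) atTop (𝓝 0) := by
  simp_rw [← eLpNorm_two_sq]
  refine ⟨fun h => by
    simpa [Function.comp_def] using ((ENNReal.continuous_pow 2).tendsto _).comp h, fun h => ?_⟩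
  simpa [Function.comp_def, ← ENNReal.rpow_natCast_mul] using
    ((ENNReal.continuous_rpow_const (y := (2 : ℝ)⁻¹)).tendsto _).comp h

lemma tendsto_eLpNorm_two_of_dominated {f : ℕ → α → E} {g : α → E} {b : α → ℝ}
    (hf : ∀ n, AEStronglyMeasurable (f n) ν) (hg : AEStronglyMeasurable g ν) (hb : MemLp b 2 ν)
    (hfb : ∀ n a, ‖f n a‖ ≤ b a) (hlim : ∀ a, Tendsto (fun n => f n a) atTop (𝓝 (g a))) :
    Tendsto (fun n => eLpNorm (f n - g) 2 ν) atTop (𝓝 0) := by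
  have hgb : ∀ a, ‖g a‖ ≤ b a := fun a =>
    le_of_tendsto (hlim a).norm (.of_forall fun n => hfb n a)
  have hdom : ∀ n a, ‖(f n - g) a‖ₑ ≤ 2 * ‖b a‖ₑ := fun n a => by
    rw [two_mul]
    exact enorm_sub_le.trans (add_le_add (enorm_le_iff_norm_le.2 ((hfb n a).trans (le_abs_self _)))
      (enorm_le_iff_norm_le.2 ((hgb a).trans (le_abs_self _))))
  have hfin : ∫⁻ a, (2 * ‖b a‖ₑ) ^ 2 ∂ν ≠ ⊤ := by
    simp_rw [mul_pow]
    rw [lintegral_const_mul' _ _ (by simp)]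
    exact ENNReal.mul_ne_top (by simp) ((memLp_two_iff_lintegral_enorm_sq_lt_top hb.1).1 hb).ne
  rw [tendsto_eLpNorm_two_zero_iff, ← lintegral_zero (μ := ν)]
  refine tendsto_lintegral_of_dominated_convergence' _
    (fun n => ((hf n).sub hg).enorm.pow_const 2)
    (fun n => .of_forall fun a => pow_le_pow_left' (hdom n a) 2) hfin (.of_forall fun a => ?_)
  have h : Tendsto (fun n => f n a - g a) atTop (𝓝 0) := by simpa using (hlim a).sub_const (g a)
  simpa [Function.comp_def] using
    ((ENNReal.continuous_pow 2).tendsto _).comp ((continuous_enorm.tendsto _).comp h)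

lemma toLp_mem_of_dominated {S : Set (Lp E 2 ν)} (hS : IsClosed S) {f : ℕ → α → E} {g : α → E}
    {b : α → ℝ} (hf : ∀ n, MemLp (f n) 2 ν) (hg : MemLp g 2 ν) (hb : MemLp b 2 ν)
    (hfb : ∀ n a, ‖f n a‖ ≤ b a) (hlim : ∀ a, Tendsto (fun n => f n a) atTop (𝓝 (g a)))
    (hmem : ∀ n, (hf n).toLp ∈ S) : hg.toLp ∈ S := by
  refine hS.mem_of_tendsto (f := fun n => (hf n).toLp) (b := atTop) ?_ (.of_forall hmem)
  rw [Lp.tendsto_Lp_iff_tendsto_eLpNorm'' f hf g hg]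
  exact tendsto_eLpNorm_two_of_dominated (fun n => (hf n).1) hg.1 hb hfb hlim

lemma inner_toLp_eq_integral_mul {f g : α → ℝ} (hf : MemLp f 2 ν) (hg : MemLp g 2 ν) :
    inner ℝ (hf.toLp f) (hg.toLp g) = ∫ x, f x * g x ∂ν := by
  rw [L2.inner_def]
  refine integral_congr_ae ?_
  filter_upwards [hf.coeFn_toLp, hg.coeFn_toLp] with x hfx hgx
  rw [hfx, hgx]
  exact mul_comm _ _

lemma integral_sum_mul_sum {ι κ : Type*} [Fintype ι] [Fintype κ] {f : ι → α → ℝ} {g : κ → α → ℝ}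
    (hf : ∀ i, MemLp (f i) 2 ν) (hg : ∀ j, MemLp (g j) 2 ν) :
    ∫ x, (∑ i, f i x) * ∑ j, g j x ∂ν = ∑ i, ∑ j, ∫ x, f i x * g j x ∂ν := by
  have hint (i : ι) (j : κ) : Integrable (fun x => f i x * g j x) ν := (hf i).integrable_mul (hg j)
  simp_rw [Finset.sum_mul_sum]
  rw [integral_finsetSum _ fun i _ => integrable_finsetSum _ fun j _ => hint i j]
  exact Finset.sum_congr rfl fun i _ => integral_finsetSum _ fun j _ => hint i j

end SquareIntegrable

section BoundedProducts

variable {Ω : Type*} {m₀ : MeasurableSpace Ω} {P : Measure Ω}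

lemma memLp_bdd_mul {X Y : Ω → ℝ} {q : ℝ≥0∞} (hX : Measurable X) (hb : ∃ C : ℝ, ∀ ω, |X ω| ≤ C)
    (hY : MemLp Y q P) : MemLp (fun ω => X ω * Y ω) q P := by
  obtain ⟨C, hC⟩ := hb
  refine (hY.norm.const_mul C).mono (hX.aestronglyMeasurable.mul hY.1) (.of_forall fun ω => ?_)
  rw [norm_mul]
  exact (mul_le_mul_of_nonneg_right (hC ω) (norm_nonneg _)).trans (le_abs_self _)

lemma bdd_mul {X Y : Ω → ℝ} (hX : ∃ C : ℝ, ∀ ω, |X ω| ≤ C) (hY : ∃ C : ℝ, ∀ ω, |Y ω| ≤ C) :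
    ∃ C : ℝ, ∀ ω, |X ω * Y ω| ≤ C := by
  obtain ⟨C, hC⟩ := hX
  obtain ⟨D, hD⟩ := hY
  refine ⟨C * D, fun ω => ?_⟩
  rw [abs_mul]
  exact mul_le_mul (hC ω) (hD ω) (abs_nonneg _) ((abs_nonneg _).trans (hC ω))

end BoundedProducts

section PiSystem

variable {α : Type*} {m : MeasurableSpace α} {ν : Measure α} {C : Set (Set α)}

/-- The linear combinations of indicators of sets of the class `C`. -/
def indicatorSpan (C : Set (Set α)) : Submodule ℝ (α → ℝ) :=
  Submodule.span ℝ {f | ∃ s ∈ C, f = s.indicator fun _ => (1 : ℝ)}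

lemma stronglyMeasurable_of_mem_indicatorSpan (hC : ∀ s ∈ C, MeasurableSet s) {f : α → ℝ}
    (hf : f ∈ indicatorSpan C) : StronglyMeasurable f := by
  induction hf using Submodule.span_induction with
  | mem f hf =>
    obtain ⟨s, hs, rfl⟩ := hf
    exact stronglyMeasurable_const.indicator (hC s hs)
  | zero => exact stronglyMeasurable_zero
  | add f g _ _ hf hg => exact hf.add hg
  | smul c f _ hf => exact hf.const_smul c

lemma ae_eq_zero_of_forall_piSystem (hm : m = MeasurableSpace.generateFrom C)
    (hpi : IsPiSystem C) {f : α → ℝ} (hf : Integrable f ν) (h0 : ∫ x, f x ∂ν = 0)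
    (h : ∀ s ∈ C, ∫ x in s, f x ∂ν = 0) : f =ᵐ[ν] 0 := by
  suffices hset : ∀ s, MeasurableSet s → ∫ x in s, f x ∂ν = 0 from
    hf.ae_eq_zero_of_forall_setIntegral_eq_zero fun s hs _ => hset s hs
  intro s hs
  induction s, hs using MeasurableSpace.induction_on_inter hm hpi with
  | empty => simp
  | basic s hs => exact h s hs
  | compl s hs ih =>
    have := integral_add_compl hs hf
    simp_all
  | iUnion t hd ht ih =>
    rw [integral_iUnion ht hd hf.integrableOn]
    simp [ih]

/-- The classes in `L²(ν)` of the elements of `indicatorSpan C`. -/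
def indicatorSpanLp (C : Set (Set α)) (ν : Measure α) : Submodule ℝ (Lp ℝ 2 ν) where
  carrier := {u | ∃ g ∈ indicatorSpan C, u =ᵐ[ν] g}
  add_mem' := by
    rintro u v ⟨g, hg, hu⟩ ⟨g', hg', hv⟩
    exact ⟨g + g', add_mem hg hg', (Lp.coeFn_add u v).trans (hu.add hv)⟩
  zero_mem' := ⟨0, zero_mem _, Lp.coeFn_zero _ _ _⟩
  smul_mem' := by
    rintro c u ⟨g, hg, hu⟩
    exact ⟨c • g, Submodule.smul_mem _ c hg, (Lp.coeFn_smul c u).trans (hu.const_smul c)⟩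

lemma topologicalClosure_indicatorSpanLp [IsFiniteMeasure ν]
    (hm : m = MeasurableSpace.generateFrom C) (hpi : IsPiSystem C)
    (hone : ∃ s ∈ C, s =ᵐ[ν] Set.univ) : (indicatorSpanLp C ν).topologicalClosure = ⊤ := by
  have hC : ∀ s ∈ C, MeasurableSet s := fun s hs => by
    rw [hm]; exact MeasurableSpace.measurableSet_generateFrom hs
  rw [Submodule.topologicalClosure_eq_top_iff, Submodule.eq_bot_iff]
  intro u hu
  have hset : ∀ s ∈ C, ∫ x in s, u x ∂ν = 0 := fun s hs => by
    have hmem : indicatorConstLp 2 (hC s hs) (measure_ne_top ν s) (1 : ℝ) ∈ indicatorSpanLp C ν :=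
      ⟨_, Submodule.subset_span ⟨s, hs, rfl⟩, indicatorConstLp_coeFn⟩
    have := (Submodule.mem_orthogonal _ u).1 hu _ hmem
    rwa [L2.inner_indicatorConstLp_one] at this
  obtain ⟨s, hs, hsu⟩ := hone
  have h0 : ∫ x, u x ∂ν = 0 := by
    rw [← hset s hs, setIntegral_congr_set hsu, setIntegral_univ]
  have hui : Integrable u ν := (Lp.memLp u).integrable (by norm_num)
  exact Lp.ext ((ae_eq_zero_of_forall_piSystem hm hpi hui h0 hset).trans
    (Lp.coeFn_zero _ _ _).symm)

lemma exists_mem_indicatorSpan_eLpNorm_sub_lt [IsFiniteMeasure ν]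
    (hm : m = MeasurableSpace.generateFrom C) (hpi : IsPiSystem C)
    (hone : ∃ s ∈ C, s =ᵐ[ν] Set.univ) {f : α → ℝ} (hf : MemLp f 2 ν) {ε : ℝ≥0∞} (hε : 0 < ε) :
    ∃ g ∈ indicatorSpan C, eLpNorm (g - f) 2 ν < ε := by
  have hmem : hf.toLp f ∈ closure (indicatorSpanLp C ν : Set (Lp ℝ 2 ν)) := by
    rw [← Submodule.topologicalClosure_coe, topologicalClosure_indicatorSpanLp hm hpi hone]
    trivial
  obtain ⟨u, ⟨g, hg, hug⟩, hu⟩ := EMetric.mem_closure_iff.1 hmem ε hε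
  refine ⟨g, hg, ?_⟩
  rw [edist_comm, Lp.edist_def] at hu
  exact (eLpNorm_congr_ae (hug.sub hf.coeFn_toLp)).symm.trans_lt hu

end PiSystem

section InnerProduct

variable {E G H : Type*} [NormedAddCommGroup G] [InnerProductSpace ℝ G] [NormedAddCommGroup H]
  [InnerProductSpace ℝ H]

lemma real_inner_smul_smul (a b : ℝ) (u v : H) : inner ℝ (a • u) (b • v) = a * b * inner ℝ u v := by
  rw [real_inner_smul_left, real_inner_smul_right, mul_assoc]

lemma isLinearMap_of_inner_eq_inner [AddCommGroup E] [Module ℝ E] {f : E → G} {A : E → H}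
    (hA : IsLinearMap ℝ A) (h : ∀ x y, inner ℝ (f x) (f y) = inner ℝ (A x) (A y)) :
    IsLinearMap ℝ f where
  map_add x y := by
    rw [← sub_eq_zero, ← inner_self_eq_zero (𝕜 := ℝ)]
    simp only [inner_sub_left, inner_sub_right, inner_add_left, inner_add_right, h, hA.map_add]
    ring
  map_smul c x := by
    rw [← sub_eq_zero, ← inner_self_eq_zero (𝕜 := ℝ)]
    simp only [inner_sub_left, inner_sub_right, real_inner_smul_left, real_inner_smul_right, h,
      hA.map_smul]
    ring

lemma isLinearMap_of_inner_eq_integral [AddCommGroup E] [Module ℝ E] {α : Type*}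
    [MeasurableSpace α] {ν : Measure α} (T : α → E →ₗ[ℝ] H) (hT : ∀ x, MemLp (fun t => T t x) 2 ν)
    {f : E → G} (h : ∀ x y, inner ℝ (f x) (f y) = ∫ t, inner ℝ (T t x) (T t y) ∂ν) :
    IsLinearMap ℝ f := by
  refine isLinearMap_of_inner_eq_inner (A := fun x => (hT x).toLp) ⟨fun x y => ?_, fun c x => ?_⟩
    fun x y => ?_
  · rw [← MemLp.toLp_add]
    congr 1
    ext1 t
    exact map_add (T t) x y
  · rw [← MemLp.toLp_const_smul]
    congr 1
    ext1 t
    exact map_smul (T t) c x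
  · rw [h, L2.inner_def]
    refine integral_congr_ae ?_
    filter_upwards [(hT x).coeFn_toLp, (hT y).coeFn_toLp] with t h1 h2
    rw [h1, h2]

lemma norm_sub_eq_of_inner_eq {c : ℝ} (hc : 0 ≤ c) {x y : G} {x' y' : H}
    (hx : inner ℝ x x = c * inner ℝ x' x') (hy : inner ℝ y y = c * inner ℝ y' y')
    (hxy : inner ℝ x y = c * inner ℝ x' y') : ‖x - y‖ = √c * ‖x' - y'‖ := by
  rw [real_inner_self_eq_norm_sq, real_inner_self_eq_norm_sq] at hx hy
  rw [← sq_eq_sq₀ (norm_nonneg _) (by positivity), mul_pow, Real.sq_sqrt hc, norm_sub_sq_real,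
    norm_sub_sq_real, hx, hy, hxy]
  ring

lemma cauchySeq_of_inner_eq {c : ℝ} (hc : 0 ≤ c) {x : ℕ → G} {x' : ℕ → H}
    (h : ∀ i j, inner ℝ (x i) (x j) = c * inner ℝ (x' i) (x' j)) (hx' : CauchySeq x') :
    CauchySeq x := by
  rw [cauchySeq_iff_tendsto_dist_atTop_0] at hx' ⊢
  simpa [dist_eq_norm, norm_sub_eq_of_inner_eq hc (h _ _) (h _ _) (h _ _)] using
    hx'.const_mul (√c)

end InnerProduct

section OrthogonalSeries

universe u

variable {G L : Type*} {H : Type u} [NormedAddCommGroup G] [InnerProductSpace ℝ G]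
  [NormedAddCommGroup H] [InnerProductSpace ℝ H] [NormedAddCommGroup L] [InnerProductSpace ℝ L]
  {ι κ : Type*}

lemma orthogonalFamily_span_singleton {v : ι → G}
    (hv : Pairwise fun i j => inner ℝ (v i) (v j) = 0) :
    OrthogonalFamily ℝ (fun i => Submodule.span ℝ {v i})
      fun i => (Submodule.span ℝ {v i}).subtypeₗᵢ :=
  OrthogonalFamily.of_pairwise fun _ _ hij =>
    Submodule.isOrtho_span.2 (by simpa using hv hij)

lemma norm_sum_sq_of_pairwise_inner_eq_zero {v : ι → G}
    (hv : Pairwise fun i j => inner ℝ (v i) (v j) = 0) (s : Finset ι) :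
    ‖∑ i ∈ s, v i‖ ^ 2 = ∑ i ∈ s, ‖v i‖ ^ 2 := by
  simpa using (orthogonalFamily_span_singleton hv).norm_sum
    (fun i => ⟨v i, Submodule.mem_span_singleton_self _⟩) s

lemma summable_iff_norm_sq_of_pairwise_inner_eq_zero [CompleteSpace G] {v : ι → G}
    (hv : Pairwise fun i j => inner ℝ (v i) (v j) = 0) :
    Summable v ↔ Summable fun i => ‖v i‖ ^ 2 := by
  simpa using (orthogonalFamily_span_singleton hv).summable_iff_norm_sq_summable
    fun i => ⟨v i, Submodule.mem_span_singleton_self _⟩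

variable {A : H →L[ℝ] L} {J : H → G}

lemma inner_eq_norm_sq_of_hasSum
    (hJ : ∀ h h', inner ℝ (J h) (J h') = inner ℝ h h' * inner ℝ (A h) (A h'))
    (e : HilbertBasis ι ℝ H) {I : G} (hI : HasSum (fun i => J (e i)) I) (h : H) :
    inner ℝ I (J h) = ‖A h‖ ^ 2 := by
  have h1 : HasSum (fun i => inner ℝ (J h) (J (e i))) (inner ℝ (J h) I) :=
    hI.mapL (innerSL ℝ (J h))
  have h2 : HasSum (fun i => inner ℝ (A h) (A (e.repr h i • e i))) (inner ℝ (A h) (A h)) :=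
    ((e.hasSum_repr h).mapL A).mapL (innerSL ℝ (A h))
  rw [real_inner_comm, ← real_inner_self_eq_norm_sq]
  refine h1.unique ?_
  convert h2 using 2 with i
  rw [hJ, map_smul, real_inner_smul_right, HilbertBasis.repr_apply_apply, real_inner_comm]

lemma hasSum_unique_of_hilbertBasis
    (hJ : ∀ h h', inner ℝ (J h) (J h') = inner ℝ h h' * inner ℝ (A h) (A h'))
    (e : HilbertBasis ι ℝ H) (f : HilbertBasis κ ℝ H) {I I' : G}
    (hI : HasSum (fun i => J (e i)) I) (hI' : HasSum (fun i => J (f i)) I') : I = I' := by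
  have hII' : inner ℝ (I - I') I' = 0 := by
    refine ((hI'.mapL (innerSL ℝ (I - I'))).unique ?_)
    simp [inner_eq_norm_sq_of_hasSum hJ e hI, inner_eq_norm_sq_of_hasSum hJ f hI',
      hasSum_zero]
  have hII : inner ℝ (I - I') I = 0 := by
    refine ((hI.mapL (innerSL ℝ (I - I'))).unique ?_)
    simp [inner_eq_norm_sq_of_hasSum hJ e hI, inner_eq_norm_sq_of_hasSum hJ f hI',
      hasSum_zero]
  rw [← sub_eq_zero, ← inner_self_eq_zero (𝕜 := ℝ), inner_sub_right, hII, hII', sub_zero]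

lemma pairwise_inner_eq_zero_of_orthonormal
    (hJ : ∀ h h', inner ℝ (J h) (J h') = inner ℝ h h' * inner ℝ (A h) (A h')) {v : ι → H}
    (hv : Orthonormal ℝ v) : Pairwise fun i j => inner ℝ (J (v i)) (J (v j)) = 0 := by
  intro i j hij
  simp only [hJ, hv.2 hij, zero_mul]

lemma norm_sq_eq_of_orthonormal
    (hJ : ∀ h h', inner ℝ (J h) (J h') = inner ℝ h h' * inner ℝ (A h) (A h')) {v : ι → H}
    (hv : Orthonormal ℝ v) (i : ι) : ‖J (v i)‖ ^ 2 = ‖A (v i)‖ ^ 2 := by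
  rw [← real_inner_self_eq_norm_sq, hJ, real_inner_self_eq_norm_sq, real_inner_self_eq_norm_sq,
    hv.1, one_pow, one_mul]

variable {C : ℝ}

lemma summable_of_sum_norm_sq_le [CompleteSpace G]
    (hJ : ∀ h h', inner ℝ (J h) (J h') = inner ℝ h h' * inner ℝ (A h) (A h')) {v : ι → H}
    (hv : Orthonormal ℝ v) (hC : ∀ s : Finset ι, ∑ i ∈ s, ‖A (v i)‖ ^ 2 ≤ C) :
    Summable fun i => J (v i) := by
  rw [summable_iff_norm_sq_of_pairwise_inner_eq_zero (pairwise_inner_eq_zero_of_orthonormal hJ hv)]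
  simp_rw [norm_sq_eq_of_orthonormal hJ hv]
  exact summable_of_sum_le (fun _ => by positivity) hC

lemma norm_sq_le_of_hasSum_of_sum_norm_sq_le
    (hJ : ∀ h h', inner ℝ (J h) (J h') = inner ℝ h h' * inner ℝ (A h) (A h')) {v : ι → H}
    (hv : Orthonormal ℝ v) (hC : ∀ s : Finset ι, ∑ i ∈ s, ‖A (v i)‖ ^ 2 ≤ C) {I : G}
    (hI : HasSum (fun i => J (v i)) I) : ‖I‖ ^ 2 ≤ C := by
  refine le_of_tendsto ((hI : Tendsto _ _ _).norm.pow 2) (.of_forall fun s => ?_)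
  rw [norm_sum_sq_of_pairwise_inner_eq_zero (pairwise_inner_eq_zero_of_orthonormal hJ hv)]
  simpa only [norm_sq_eq_of_orthonormal hJ hv] using hC s

lemma exists_hasSum_forall_hilbertBasis [CompleteSpace G] [CompleteSpace H]
    (hJ : ∀ h h', inner ℝ (J h) (J h') = inner ℝ h h' * inner ℝ (A h) (A h'))
    (hC : ∀ {ι : Type u} {v : ι → H}, Orthonormal ℝ v →
      ∀ s : Finset ι, ∑ i ∈ s, ‖A (v i)‖ ^ 2 ≤ C) :
    ∃ I : G, ‖I‖ ^ 2 ≤ C ∧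
      ∀ {ι : Type u} (e : HilbertBasis ι ℝ H), HasSum (fun i => J (e i)) I := by
  obtain ⟨w, e₀, -⟩ := exists_hilbertBasis ℝ H
  obtain ⟨I, hI⟩ := summable_of_sum_norm_sq_le hJ e₀.orthonormal (hC e₀.orthonormal)
  refine ⟨I, norm_sq_le_of_hasSum_of_sum_norm_sq_le hJ e₀.orthonormal (hC e₀.orthonormal) hI,
    fun e => ?_⟩
  obtain ⟨I', hI'⟩ := summable_of_sum_norm_sq_le hJ e.orthonormal (hC e.orthonormal)
  rwa [hasSum_unique_of_hilbertBasis hJ e₀ e hI hI']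

end OrthogonalSeries

section Coordinates

variable {α : Type*} {m : MeasurableSpace α} {ν : Measure α}
  {H : Type*} [NormedAddCommGroup H] [InnerProductSpace ℝ H]

lemma norm_sq_eq_integral_norm_sq (g : Lp H 2 ν) : ‖g‖ ^ 2 = ∫ q, ‖g q‖ ^ 2 ∂ν := by
  rw [← real_inner_self_eq_norm_sq, L2.inner_def]
  simp_rw [real_inner_self_eq_norm_sq]

lemma memLp_inner_const {g : α → H} (hg : MemLp g 2 ν) (h : H) :
    MemLp (fun q => inner ℝ (g q) h) 2 ν := by
  refine (hg.norm.mul_const ‖h‖).mono (hg.1.inner aestronglyMeasurable_const)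
    (.of_forall fun q => ?_)
  rw [norm_mul, norm_norm, norm_norm]
  exact norm_inner_le_norm _ _

/-- The operator `h ↦ ⟨g, h⟩` from `H` to `L²(ν)`, for `g ∈ L²(ν; H)`. -/
def coordinateL (g : Lp H 2 ν) : H →L[ℝ] Lp ℝ 2 ν :=
  LinearMap.mkContinuous
    { toFun := fun h => (innerSL ℝ h).compLp g
      map_add' := fun h h' => by rw [map_add, ContinuousLinearMap.add_compLp]
      map_smul' := fun c h => by
        rw [map_smul, RingHom.id_apply]; exact ContinuousLinearMap.smul_compLp _ _ _ }
    ‖g‖ fun h => by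
      rw [mul_comm]
      simpa using (innerSL ℝ h).norm_compLp_le g

lemma coeFn_coordinateL (g : Lp H 2 ν) (h : H) :
    coordinateL g h =ᵐ[ν] fun q => inner ℝ (g q) h := by
  filter_upwards [(innerSL ℝ h).coeFn_compLp g] with q hq
  rw [real_inner_comm]
  exact hq

lemma coordinateL_toLp {g : α → H} (hg : MemLp g 2 ν) (h : H) :
    coordinateL (hg.toLp g) h = (memLp_inner_const hg h).toLp _ := by
  refine Lp.ext ((coeFn_coordinateL _ h).trans ?_)
  filter_upwards [hg.coeFn_toLp, (memLp_inner_const hg h).coeFn_toLp] with q h1 h2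
  rw [h1, h2]

lemma sum_norm_coordinateL_sq_le (g : Lp H 2 ν) {ι : Type*} {v : ι → H} (hv : Orthonormal ℝ v)
    (s : Finset ι) : ∑ i ∈ s, ‖coordinateL g (v i)‖ ^ 2 ≤ ‖g‖ ^ 2 := by
  have hi : ∀ i, Integrable (fun q => ‖coordinateL g (v i) q‖ ^ 2) ν := fun i =>
    (Lp.memLp _).integrable_norm_pow (by norm_num)
  simp_rw [norm_sq_eq_integral_norm_sq]
  rw [← integral_finsetSum _ fun i _ => hi i]
  refine integral_mono_ae (integrable_finsetSum _ fun i _ => hi i)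
    ((Lp.memLp g).integrable_norm_pow (by norm_num)) ?_
  filter_upwards [(Finset.eventually_all s).2 fun i _ => coeFn_coordinateL g (v i)] with q hq
  calc ∑ i ∈ s, ‖coordinateL g (v i) q‖ ^ 2 = ∑ i ∈ s, ‖inner ℝ (v i) (g q)‖ ^ 2 :=
        Finset.sum_congr rfl fun i hi => by rw [hq i hi, real_inner_comm]
    _ ≤ ‖g q‖ ^ 2 := hv.sum_inner_products_le (g q)

end Coordinates

section GaussianSubspace

lemma comap_pi_eq_iSup_comap {Ω S : Type*} (X : S → Ω → ℝ) :
    MeasurableSpace.comap (fun ω s => X s ω) MeasurableSpace.pi =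
      ⨆ s, MeasurableSpace.comap (X s) (borel ℝ) := by
  rw [MeasurableSpace.pi, MeasurableSpace.comap_iSup, ← BorelSpace.measurable_eq (α := ℝ)]
  simp_rw [MeasurableSpace.comap_comp]
  rfl

variable {Ω : Type*} [MeasurableSpace Ω] {P : Measure Ω}

lemma integral_abs_le_norm [IsProbabilityMeasure P] (Z : Lp ℝ 2 P) : ∫ ω, |Z ω| ∂P ≤ ‖Z‖ := by
  have h1 : ∫ ω, |Z ω| ∂P = (eLpNorm Z 1 P).toReal := by
    rw [eLpNorm_one_eq_lintegral_enorm, ← integral_norm_eq_lintegral_enorm Z.1.aestronglyMeasurable]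
    rfl
  rw [h1, Lp.norm_def]
  exact ENNReal.toReal_mono (Lp.eLpNorm_ne_top Z)
    (eLpNorm_le_eLpNorm_of_exponent_le (by simp) Z.1.aestronglyMeasurable)

lemma norm_exp_mul_I_sub_le (x y : ℝ) :
    ‖Complex.exp (x * Complex.I) - Complex.exp (y * Complex.I)‖ ≤ |x - y| := by
  have : Complex.exp (x * Complex.I) - Complex.exp (y * Complex.I) =
      Complex.exp (y * Complex.I) * (Complex.exp (Complex.I * ((x - y : ℝ) : ℂ)) - 1) := by
    rw [mul_sub, ← Complex.exp_add, mul_one]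
    congr 2
    push_cast; ring
  rw [this, norm_mul, Complex.norm_exp_ofReal_mul_I, one_mul]
  exact Real.norm_exp_I_mul_ofReal_sub_one_le

lemma charFun_map_eq_integral {Z : Ω → ℝ} (hZ : AEMeasurable Z P) (u : ℝ) :
    charFun (P.map Z) u = ∫ ω, Complex.exp (((u * Z ω : ℝ) : ℂ) * Complex.I) ∂P := by
  rw [charFun_apply_real, integral_map hZ (by fun_prop)]
  simp

lemma integrable_exp_mul_I [IsFiniteMeasure P] {Z : Ω → ℝ} (hZ : AEStronglyMeasurable Z P) (u : ℝ) :
    Integrable (fun ω => Complex.exp (((u * Z ω : ℝ) : ℂ) * Complex.I)) P :=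
  .of_bound ((by fun_prop : Continuous fun x : ℝ =>
      Complex.exp (((u * x : ℝ) : ℂ) * Complex.I)).comp_aestronglyMeasurable hZ) 1
    (.of_forall fun ω => (Complex.norm_exp_ofReal_mul_I _).le)

lemma continuous_charFun_map [IsProbabilityMeasure P] (u : ℝ) :
    Continuous fun Z : Lp ℝ 2 P => charFun (P.map Z) u := by
  refine LipschitzWith.continuous (K := ‖u‖₊) (LipschitzWith.of_dist_le_mul fun Z Z' => ?_)
  rw [dist_eq_norm, dist_eq_norm, charFun_map_eq_integral Z.1.aemeasurable,
    charFun_map_eq_integral Z'.1.aemeasurable,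
    ← integral_sub (integrable_exp_mul_I Z.1.aestronglyMeasurable u)
      (integrable_exp_mul_I Z'.1.aestronglyMeasurable u)]
  calc _ ≤ ∫ ω, |u| * |(Z - Z' : Lp ℝ 2 P) ω| ∂P := by
        refine norm_integral_le_of_norm_le ?_ ?_
        · exact ((Lp.memLp (Z - Z')).integrable (by norm_num)).abs.const_mul _
        · filter_upwards [Lp.coeFn_sub Z Z'] with ω h
          rw [h, Pi.sub_apply, ← abs_mul, mul_sub]
          exact norm_exp_mul_I_sub_le _ _
    _ ≤ _ := by
        rw [integral_const_mul]
        exact mul_le_mul_of_nonneg_left (integral_abs_le_norm _) (abs_nonneg u)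

lemma isClosed_setOf_hasLaw_gaussianReal [IsProbabilityMeasure P] :
    IsClosed {Z : Lp ℝ 2 P | HasLaw Z (gaussianReal 0 (‖Z‖₊ ^ 2)) P} := by
  have e : {Z : Lp ℝ 2 P | HasLaw Z (gaussianReal 0 (‖Z‖₊ ^ 2)) P} =
      ⋂ u : ℝ, {Z : Lp ℝ 2 P |
        charFun (P.map Z) u = charFun (gaussianReal 0 (‖Z‖₊ ^ 2)) u} := by
    ext Z
    simp only [Set.mem_iInter, Set.mem_ofPred_eq]
    refine ⟨fun h u => by rw [h.map_eq], fun h => ⟨Z.1.aemeasurable, ?_⟩⟩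
    have := Measure.isProbabilityMeasure_map (μ := P) Z.1.aemeasurable
    exact Measure.ext_of_charFun (funext h)
  rw [e]
  refine isClosed_iInter fun u => isClosed_eq (continuous_charFun_map u) ?_
  simp_rw [charFun_gaussianReal]
  fun_prop

lemma coeFn_sum_smul {ι : Type*} [Fintype ι] (c : ι → ℝ) (Z : ι → Lp ℝ 2 P) :
    (∑ i, c i • Z i : Lp ℝ 2 P) =ᵐ[P] fun ω => ∑ i, c i * Z i ω := by
  filter_upwards [Lp.coeFn_finsetSum Finset.univ fun i => c i • Z i,
    ae_all_iff.2 fun i => Lp.coeFn_smul (c i) (Z i)] with ω h1 h2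
  rw [h1, Finset.sum_apply]
  exact Finset.sum_congr rfl fun i _ => h2 i

variable {K : Submodule ℝ (Lp ℝ 2 P)}

lemma isGaussianProcess_of_submodule (hK : ∀ Z ∈ K, HasGaussianLaw Z P) :
    IsGaussianProcess (fun Z : K => ((Z : Lp ℝ 2 P) : Ω → ℝ)) P := by
  classical
  refine ⟨fun I => ⟨?_⟩⟩
  have hm : AEMeasurable (fun ω => I.restrict fun Z : K => (Z : Lp ℝ 2 P) ω) P :=
    aemeasurable_pi_lambda _ fun Z => (Z : K).1.1.aemeasurable
  refine isGaussian_of_isGaussian_map fun L => ?_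
  rw [AEMeasurable.map_map_of_aemeasurable (by fun_prop) hm]
  have e : (∑ i : I, L (Pi.single i 1) • ((i : K) : Lp ℝ 2 P) : Lp ℝ 2 P) =ᵐ[P]
      L ∘ fun ω => I.restrict fun Z : K => (Z : Lp ℝ 2 P) ω := by
    refine (coeFn_sum_smul _ _).trans (.of_forall fun ω => ?_)
    rw [Function.comp_apply, ← Finset.univ_sum_single (I.restrict fun Z : K => (Z : Lp ℝ 2 P) ω),
      map_sum]
    refine Finset.sum_congr rfl fun i _ => ?_
    rw [mul_comm, ← smul_eq_mul, ← map_smul, ← Pi.single_smul', smul_eq_mul, mul_one]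
    rfl
  have hmem : (∑ i : I, L (Pi.single i 1) • ((i : K) : Lp ℝ 2 P) : Lp ℝ 2 P) ∈ K :=
    K.sum_mem fun i _ => K.smul_mem _ (i : K).2
  rw [← Measure.map_congr e]
  exact (hK _ hmem).isGaussian_map

lemma indep_iSup_comap_of_inner_eq_zero [IsProbabilityMeasure P]
    (hK : ∀ Z ∈ K, HasLaw Z (gaussianReal 0 (‖Z‖₊ ^ 2)) P) {S S' : Type*} {x : S → K} {y : S' → K}
    {X : S → Ω → ℝ} {Y : S' → Ω → ℝ} (hX : ∀ s, (x s : Lp ℝ 2 P) =ᵐ[P] X s)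
    (hY : ∀ s, (y s : Lp ℝ 2 P) =ᵐ[P] Y s) (h : ∀ s s', inner ℝ (x s) (y s') = 0) :
    Indep (⨆ s, MeasurableSpace.comap (X s) (borel ℝ)) (⨆ s, MeasurableSpace.comap (Y s) (borel ℝ))
      P := by
  have hmean : ∀ Z : K, ∫ ω, (Z : Lp ℝ 2 P) ω ∂P = 0 := fun Z => by
    rw [(hK Z Z.2).integral_eq, integral_id_gaussianReal]
  have hG : IsGaussianProcess (Sum.elim X Y) P :=
    ((isGaussianProcess_of_submodule fun Z hZ => (hK Z hZ).hasGaussianLaw).comp_right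
      (Sum.elim x y)).congr (Sum.rec hX hY)
  have hI := hG.indepFun_of_covariance_eq_zero
    (fun s => (x s).1.1.aemeasurable.congr (hX s)) (fun s => (y s).1.1.aemeasurable.congr (hY s))
    fun s s' => by
      rw [covariance_eq_sub ((Lp.memLp _).ae_eq (hX s)) ((Lp.memLp _).ae_eq (hY s')),
        ← integral_congr_ae (hX s), hmean, zero_mul, sub_zero]
      rw [← h s s', Submodule.coe_inner, L2.inner_def]
      refine integral_congr_ae ?_
      filter_upwards [hX s, hY s'] with ω e e'
      rw [Pi.mul_apply, ← e, ← e']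
      exact mul_comm _ _
  rw [IndepFun_iff_Indep, comap_pi_eq_iSup_comap, comap_pi_eq_iSup_comap] at hI
  exact hI

lemma indep_sup_null {m m' : MeasurableSpace Ω} (h : Indep m m' P) :
    Indep (m ⊔ MeasurableSpace.generateFrom {A | P A = 0}) m' P := by
  have hle : m ⊔ MeasurableSpace.generateFrom {A | P A = 0} ≤
      eventuallyMeasurableSpace m (ae P) := by
    refine sup_le le_eventuallyMeasurableSpace (MeasurableSpace.generateFrom_le fun A hA => ?_)
    exact ⟨∅, @MeasurableSet.empty _ m, ae_eq_empty.2 hA⟩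
  rw [Indep_iff] at h ⊢
  intro A B hA hB
  obtain ⟨A', hA', e⟩ := hle A hA
  rw [measure_congr e, measure_congr (e.inter (ae_eq_refl B))]
  exact h A' B hA' hB

end GaussianSubspace

section Independence

variable {Ω : Type*} {m m' m₀ : MeasurableSpace Ω} {P : Measure Ω}

lemma integral_mul_eq_of_indep (h : Indep m m' P) (hm : m ≤ m₀) (hm' : m' ≤ m₀) {X Y : Ω → ℝ}
    (hX : Measurable[m] X) (hY : Measurable[m'] Y) :
    ∫ ω, X ω * Y ω ∂P = (∫ ω, X ω ∂P) * ∫ ω, Y ω ∂P := by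
  have hI : IndepFun X Y P := by
    rw [IndepFun_iff_Indep]
    exact indep_of_indep_of_le_left (indep_of_indep_of_le_right h hY.comap_le) hX.comap_le
  exact hI.integral_fun_mul_eq_mul_integral (hX.mono hm le_rfl).aestronglyMeasurable
    (hY.mono hm' le_rfl).aestronglyMeasurable

end Independence

section Ultrametric

variable {E : Type*} [SeminormedAddCommGroup E] [IsUltrametricDist E]

lemma norm_sub_le_max (x y : E) : ‖x - y‖ ≤ max ‖x‖ ‖y‖ := by
  simpa [sub_eq_add_neg] using IsUltrametricDist.norm_add_le_max x (-y)

lemma norm_add_le_iff_of_norm_le {x h : E} {r : ℝ} (hh : ‖h‖ ≤ r) : ‖x + h‖ ≤ r ↔ ‖x‖ ≤ r := by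
  refine ⟨fun hx => ?_, fun hx => (IsUltrametricDist.norm_add_le_max x h).trans (max_le hx hh)⟩
  rw [← add_sub_cancel_right x h]
  exact (norm_sub_le_max _ _).trans (max_le hx hh)

end Ultrametric

section Character

variable {p : ℕ} [Fact p.Prime]

lemma prime_pos_real : (0 : ℝ) < p := by exact_mod_cast (Fact.out : p.Prime).pos

lemma one_lt_prime_real : (1 : ℝ) < p := by exact_mod_cast (Fact.out : p.Prime).one_lt

lemma exists_zpow_neg_lt {ε : ℝ} (hε : 0 < ε) : ∃ n : ℤ, (p : ℝ) ^ (-n) < ε := by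
  obtain ⟨n, hn⟩ := exists_pow_lt_of_lt_one hε (inv_lt_one_of_one_lt₀ (one_lt_prime_real (p := p)))
  exact ⟨n, by simpa [zpow_neg] using hn⟩

lemma fracPart_spec (y : ℚ_[p]) :
    ∃ (a : ℤ) (n : ℕ), fracPart p y = a / (p : ℚ) ^ n ∧ ‖y - (fracPart p y : ℚ_[p])‖ ≤ 1 := by
  refine ⟨_, _, by rw [fracPart, ← Int.cast_natCast], ?_⟩
  set n := (-y.valuation).toNat
  have hp0 : (p : ℚ_[p]) ≠ 0 := by exact_mod_cast (Fact.out : p.Prime).ne_zero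
  set x : ℤ_[p] := ⟨(p : ℚ_[p]) ^ n * y, norm_pow_mul_le_one p y⟩
  have h := PadicInt.appr_spec n x
  rw [← PadicInt.norm_le_pow_iff_mem_span_pow, PadicInt.norm_def] at h
  have e : y - (fracPart p y : ℚ_[p])
      = ((p : ℚ_[p]) ^ n)⁻¹ * ((x - (x.appr n : ℤ_[p]) : ℤ_[p]) : ℚ_[p]) := by
    have hf : fracPart p y = (x.appr n : ℚ) / (p : ℚ) ^ n := rfl
    have hxc : (x : ℚ_[p]) = (p : ℚ_[p]) ^ n * y := rfl
    rw [hf, PadicInt.coe_sub, hxc]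
    push_cast
    field_simp
  rw [e, norm_mul, norm_inv, norm_pow, Padic.norm_p, inv_pow, inv_inv]
  have hp : (0 : ℝ) < p := prime_pos_real
  calc (p : ℝ) ^ n * _ ≤ (p : ℝ) ^ n * (p : ℝ) ^ (-n : ℤ) := by gcongr
    _ = 1 := by rw [zpow_neg, zpow_natCast]; field_simp

lemma exists_int_of_norm_le_one {a : ℤ} {n : ℕ} {q : ℚ} (hq : q = a / (p : ℚ) ^ n)
    (h : ‖(q : ℚ_[p])‖ ≤ 1) : ∃ k : ℤ, q = k := by
  have hp : (0 : ℝ) < p := prime_pos_real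
  have hp0 : (p : ℚ) ≠ 0 := by exact_mod_cast (Fact.out : p.Prime).ne_zero
  have hp0' : (p : ℚ_[p]) ≠ 0 := by exact_mod_cast (Fact.out : p.Prime).ne_zero
  have e : (a : ℚ_[p]) = (p : ℚ_[p]) ^ n * (q : ℚ_[p]) := by
    rw [hq]; push_cast; field_simp
  have : ‖(a : ℚ_[p])‖ ≤ (p : ℝ) ^ (-n : ℤ) := by
    rw [e, norm_mul, norm_pow, Padic.norm_p, inv_pow, zpow_neg, zpow_natCast]
    exact mul_le_of_le_one_right (by positivity) h
  obtain ⟨k, hk⟩ := (Padic.norm_int_le_pow_iff_dvd a n).1 this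
  refine ⟨k, ?_⟩
  rw [hq, hk]
  push_cast
  field_simp

lemma chi_eq_of_norm_sub_le_one {y : ℚ_[p]} {a : ℤ} {n : ℕ} {q : ℚ}
    (hq : q = a / (p : ℚ) ^ n) (h : ‖y - (q : ℚ_[p])‖ ≤ 1) :
    chi p y = Complex.exp (2 * Real.pi * Complex.I * (q : ℂ)) := by
  obtain ⟨b, m, hb, hy⟩ := fracPart_spec y
  have hp0 : (p : ℚ) ≠ 0 := by exact_mod_cast (Fact.out : p.Prime).ne_zero
  have h1 : fracPart p y - q = ((b * p ^ n - a * p ^ m : ℤ) : ℚ) / (p : ℚ) ^ (m + n) := by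
    rw [hb, hq]; push_cast; field_simp; ring
  have h2 : ‖((fracPart p y - q : ℚ) : ℚ_[p])‖ ≤ 1 := by
    have : ((fracPart p y - q : ℚ) : ℚ_[p]) = (y - q) - (y - fracPart p y) := by
      push_cast; ring
    rw [this]
    exact (norm_sub_le_max _ _).trans (max_le h hy)
  obtain ⟨k, hk⟩ := exists_int_of_norm_le_one h1 h2
  have h3 : ((fracPart p y : ℚ) : ℂ) = q + k := by
    have : fracPart p y = q + k := by linarith
    rw [this]; push_cast; ring
  rw [chi, h3, mul_add, Complex.exp_add]
  have : Complex.exp (2 * Real.pi * Complex.I * (k : ℂ)) = 1 := by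
    rw [mul_comm]; exact Complex.exp_int_mul_two_pi_mul_I k
  rw [this, mul_one]

lemma chi_add (x y : ℚ_[p]) : chi p (x + y) = chi p x * chi p y := by
  obtain ⟨a, m, ha, hx⟩ := fracPart_spec x
  obtain ⟨b, n, hb, hy⟩ := fracPart_spec y
  have hp0 : (p : ℚ) ≠ 0 := by exact_mod_cast (Fact.out : p.Prime).ne_zero
  have h1 : fracPart p x + fracPart p y
      = ((a * p ^ n + b * p ^ m : ℤ) : ℚ) / (p : ℚ) ^ (m + n) := by
    rw [ha, hb]; push_cast; field_simp; ring
  rw [chi_eq_of_norm_sub_le_one h1, chi, chi, ← Complex.exp_add]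
  · congr 1; push_cast; ring
  · have : x + y - ((fracPart p x + fracPart p y : ℚ) : ℚ_[p])
        = (x - fracPart p x) + (y - fracPart p y) := by push_cast; ring
    rw [this]
    exact (IsUltrametricDist.norm_add_le_max _ _).trans (max_le hx hy)

lemma chi_of_norm_le_one {y : ℚ_[p]} (h : ‖y‖ ≤ 1) : chi p y = 1 := by
  rw [chi_eq_of_norm_sub_le_one (q := 0) (a := 0) (n := 0) (by simp) (by simpa using h)]
  simp

lemma chi_zero : chi p 0 = 1 := chi_of_norm_le_one (by simp)

lemma norm_chi (y : ℚ_[p]) : ‖chi p y‖ = 1 := by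
  rw [chi, Complex.norm_exp]
  simp

lemma chi_ne_zero (y : ℚ_[p]) : chi p y ≠ 0 := fun h => by
  have := norm_chi y
  simp [h] at this

lemma chi_neg (y : ℚ_[p]) : chi p (-y) = conj (chi p y) := by
  have h : chi p (-y) * chi p y = 1 := by rw [← chi_add]; simp [chi_zero]
  have h' : conj (chi p y) * chi p y = 1 := by
    rw [mul_comm, Complex.mul_conj, Complex.normSq_eq_norm_sq, norm_chi]; simp
  exact mul_right_cancel₀ (chi_ne_zero y) (h.trans h'.symm)

lemma chi_inv_prime_ne_one : chi p ((p : ℚ_[p])⁻¹) ≠ 1 := by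
  rw [chi_eq_of_norm_sub_le_one (q := (p : ℚ)⁻¹) (a := 1) (n := 1) (by simp) (by simp)]
  intro h
  rw [Complex.exp_eq_one_iff] at h
  obtain ⟨n, hn⟩ := h
  have hp1 : 1 < p := (Fact.out : p.Prime).one_lt
  have hp : (p : ℂ) ≠ 0 := by exact_mod_cast (by lia : p ≠ 0)
  have hpi : (2 * Real.pi * Complex.I : ℂ) ≠ 0 := Complex.two_pi_I_ne_zero
  rw [mul_comm (n : ℂ)] at hn
  have h1 := mul_left_cancel₀ hpi hn
  push_cast at h1
  field_simp at h1
  have h2 : (1 : ℤ) = p * n := by exact_mod_cast h1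
  have h3 : (p : ℤ) ∣ 1 := ⟨n, h2⟩
  have := Int.le_of_dvd one_pos h3
  lia

lemma continuous_chi : Continuous (chi p) := by
  refine continuous_iff_continuousAt.2 fun x => ?_
  have h : chi p =ᶠ[𝓝 x] fun _ => chi p x := by
    filter_upwards [Metric.closedBall_mem_nhds x one_pos] with y hy
    rw [mem_closedBall_iff_norm] at hy
    rw [show y = (y - x) + x by ring, chi_add, chi_of_norm_le_one hy, one_mul]
  exact continuousAt_const.congr h.symm

end Character

section Fourier

variable {p : ℕ} [Fact p.Prime] {N : ℕ}

instance instIsAddHaarMeasureHaar : (haar p N).IsAddHaarMeasure := by unfold haar; infer_instance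

lemma norm_dotProduct_le (ξ x : Space p N) : ‖ξ ⬝ᵥ x‖ ≤ ‖ξ‖ * ‖x‖ := by
  refine IsUltrametricDist.norm_sum_le_of_forall_le_of_nonneg (by positivity) fun i _ => ?_
  rw [norm_mul]
  gcongr
  · exact norm_le_pi_norm ξ i
  · exact norm_le_pi_norm x i

/-- The phase `χ_p(-ξ · x)` of the Fourier transform. -/
def phase (ξ x : Space p N) : ℂ := chi p (-(ξ ⬝ᵥ x))

lemma continuous_phase : Continuous fun z : Space p N × Space p N => phase z.1 z.2 :=
  continuous_chi.comp (by unfold dotProduct; fun_prop)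

lemma measurable_phase : Measurable fun z : Space p N × Space p N => phase z.1 z.2 :=
  continuous_phase.measurable

lemma continuous_phase_right (ξ : Space p N) : Continuous (phase ξ) :=
  continuous_chi.comp (by unfold dotProduct; fun_prop)

lemma norm_phase (ξ x : Space p N) : ‖phase ξ x‖ = 1 := norm_chi _

lemma phase_add (ξ x y : Space p N) : phase ξ (x + y) = phase ξ x * phase ξ y := by
  rw [phase, dotProduct_add, neg_add, chi_add]; rfl

lemma phase_neg (ξ x : Space p N) : phase ξ (-x) = conj (phase ξ x) := by
  rw [phase, dotProduct_neg, chi_neg]; rfl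

lemma phase_sub (ξ x y : Space p N) :
    phase ξ (x - y) = phase ξ x * conj (phase ξ y) := by
  rw [sub_eq_add_neg, phase_add, phase_neg]

lemma phase_eq_one {ξ x : Space p N} (h : ‖ξ‖ * ‖x‖ ≤ 1) : phase ξ x = 1 :=
  chi_of_norm_le_one (by rw [norm_neg]; exact (norm_dotProduct_le ξ x).trans h)

lemma exists_phase_ne_one {n : ℤ} {ξ : Space p N} (h : (p : ℝ) ^ n < ‖ξ‖) :
    ∃ x : Space p N, ‖x‖ ≤ (p : ℝ) ^ (-n) ∧ phase ξ x ≠ 1 := by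
  have hp0 : (0 : ℝ) < p := prime_pos_real
  have hp1 : (1 : ℝ) < p := one_lt_prime_real
  have hpn : (0 : ℝ) < (p : ℝ) ^ n := zpow_pos hp0 n
  obtain ⟨i, hi⟩ : ∃ i, (p : ℝ) ^ n < ‖ξ i‖ := by
    by_contra! hc
    exact absurd ((pi_norm_le_iff_of_nonneg hpn.le).2 hc) (not_le.2 h)
  have hi0 : ξ i ≠ 0 := fun h0 => by simp [h0] at hi; linarith
  refine ⟨Pi.single i (-(p : ℚ_[p])⁻¹ * (ξ i)⁻¹), ?_, ?_⟩
  · rw [Pi.norm_single, norm_mul, norm_neg, norm_inv, norm_inv, Padic.norm_p, inv_inv]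
    rw [Padic.norm_eq_zpow_neg_valuation hi0] at hi ⊢
    have := (zpow_lt_zpow_iff_right₀ hp1).1 hi
    rw [← zpow_neg, neg_neg, ← zpow_one_add₀ hp0.ne']
    exact zpow_le_zpow_right₀ hp1.le (by lia)
  · rw [phase, dotProduct_single]
    convert chi_inv_prime_ne_one (p := p) using 2
    field_simp

lemma fourier_eq (φ : Space p N → ℂ) (ξ : Space p N) :
    fourier φ ξ = ∫ x, phase ξ x * φ x ∂(haar p N) := rfl

lemma fourierMeasure_eq (y : Space p N → ℝ) (ν : Measure (Space p N)) (ξ : Space p N) :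
    fourierMeasure y ν ξ = ∫ x, phase ξ x * (y x : ℂ) ∂ν := rfl

lemma fourier_eq_zero {φ : Space p N → ℂ} {n : ℤ}
    (hφ : ∀ x h, ‖h‖ ≤ (p : ℝ) ^ (-n) → φ (x + h) = φ x) {ξ : Space p N}
    (hξ : (p : ℝ) ^ n < ‖ξ‖) : fourier φ ξ = 0 := by
  obtain ⟨h, hh, hne⟩ := exists_phase_ne_one hξ
  have : fourier φ ξ = phase ξ h * fourier φ ξ := by
    conv_lhs => rw [fourier_eq, ← integral_add_right_eq_self _ h]
    rw [fourier_eq, ← integral_const_mul]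
    congr 1 with x
    rw [phase_add, hφ x h hh]; ring
  by_contra h0
  exact hne (mul_right_cancel₀ h0 (by rw [one_mul]; exact this.symm))

attribute [irreducible] phase

/-- The approximate identity `1_{B(0, p^{-n})} / vol B(0, p^{-n})`. -/
def bump (p : ℕ) [Fact p.Prime] (N : ℕ) (n : ℤ) : Space p N → ℝ :=
  (Metric.closedBall 0 ((p : ℝ) ^ (-n))).indicator
    fun _ => ((haar p N).real (Metric.closedBall 0 ((p : ℝ) ^ (-n))))⁻¹

lemma haar_real_closedBall_pos (n : ℤ) :
    0 < (haar p N).real (Metric.closedBall 0 ((p : ℝ) ^ n)) :=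
  ENNReal.toReal_pos (Metric.measure_closedBall_pos _ _ (zpow_pos prime_pos_real n)).ne'
    (isCompact_closedBall _ _).measure_lt_top.ne

lemma bump_nonneg (n : ℤ) (x : Space p N) : 0 ≤ bump p N n x :=
  Set.indicator_nonneg (fun _ _ => by positivity) _

lemma bump_add (n : ℤ) (x : Space p N) {h : Space p N} (hh : ‖h‖ ≤ (p : ℝ) ^ (-n)) :
    bump p N n (x + h) = bump p N n x := by
  classical
  simp only [bump, Set.indicator_apply, mem_closedBall_zero_iff, norm_add_le_iff_of_norm_le hh]

lemma measurable_bump (n : ℤ) : Measurable (bump p N n) :=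
  measurable_const.indicator Metric.isClosed_closedBall.measurableSet

lemma integrable_bump (n : ℤ) : Integrable (bump p N n) (haar p N) :=
  (integrable_indicator_iff Metric.isClosed_closedBall.measurableSet).2
    (integrableOn_const (isCompact_closedBall _ _).measure_lt_top.ne)

lemma bump_eq_zero {n : ℤ} {x : Space p N} (hx : (p : ℝ) ^ (-n) < ‖x‖) : bump p N n x = 0 :=
  Set.indicator_of_notMem (by simpa using hx) _

lemma fourier_bump (n : ℤ) (ξ : Space p N) :
    fourier (fun x => (bump p N n x : ℂ)) ξ =
      (Metric.closedBall 0 ((p : ℝ) ^ n)).indicator (fun _ => 1) ξ := by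
  by_cases hξ : ‖ξ‖ ≤ (p : ℝ) ^ n
  · rw [Set.indicator_of_mem (by simpa using hξ)]
    have h1 : ∀ x, phase ξ x * (bump p N n x : ℂ) = (bump p N n x : ℂ) := by
      intro x
      by_cases hx : ‖x‖ ≤ (p : ℝ) ^ (-n)
      · rw [phase_eq_one, one_mul]
        calc ‖ξ‖ * ‖x‖ ≤ (p : ℝ) ^ n * (p : ℝ) ^ (-n) := by gcongr
          _ = 1 := by rw [← zpow_add₀ prime_pos_real.ne']; simp
      · simp [bump_eq_zero (not_le.1 hx)]
    rw [fourier_eq]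
    simp_rw [h1]
    rw [integral_complex_ofReal, bump, integral_indicator_const _
      Metric.isClosed_closedBall.measurableSet, smul_eq_mul,
      mul_inv_cancel₀ (haar_real_closedBall_pos _).ne', Complex.ofReal_one]
  · rw [Set.indicator_of_notMem (by simpa using hξ)]
    refine fourier_eq_zero (n := n) (fun x h hh => ?_) (not_le.1 hξ)
    rw [bump_add n x hh]

end Fourier

section TestFunction

variable {p : ℕ} [Fact p.Prime] {N : ℕ} {𝕜 : Type} [RCLike 𝕜]

lemma TestFunction.exists_add_eq (φ : TestFunction p N 𝕜) :
    ∃ n : ℤ, ∀ x h, ‖h‖ ≤ (p : ℝ) ^ (-n) → φ.1 (x + h) = φ.1 x := by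
  obtain ⟨φ, hl, hc⟩ := φ
  obtain ⟨δ, hδ, H⟩ := lebesgue_number_lemma_of_metric (c := fun y => φ ⁻¹' {y}) hc
    (fun y => hl {y}) (fun x _ => Set.mem_iUnion.2 ⟨φ x, rfl⟩)
  obtain ⟨n, hn⟩ := exists_zpow_neg_lt (p := p) hδ
  have key : ∀ x ∈ tsupport φ, ∀ h, ‖h‖ ≤ (p : ℝ) ^ (-n) → φ (x + h) = φ x := by
    intro x hx h hh
    obtain ⟨y, hy⟩ := H x hx
    have h1 : φ x = y := hy (Metric.mem_ball_self hδ)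
    have h2 : φ (x + h) = y := hy (by rw [mem_ball_iff_norm]; simpa using hh.trans_lt hn)
    rw [h1, h2]
  refine ⟨n, fun x h hh => ?_⟩
  change φ (x + h) = φ x
  by_cases hx : x ∈ tsupport φ
  · exact key x hx h hh
  · by_cases hx' : x + h ∈ tsupport φ
    · simpa using (key _ hx' (-h) (by simpa using hh)).symm
    · rw [image_eq_zero_of_notMem_tsupport hx, image_eq_zero_of_notMem_tsupport hx']

lemma TestFunction.exists_eq_zero (φ : TestFunction p N 𝕜) :
    ∃ R : ℝ, ∀ x, R < ‖x‖ → φ.1 x = 0 := by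
  obtain ⟨R, hR⟩ := φ.2.2.isBounded.exists_norm_le
  refine ⟨R, fun x hx => ?_⟩
  by_contra h
  exact absurd (hR x (subset_tsupport _ h)) (not_le.2 hx)

lemma mem_testFunction {φ : Space p N → 𝕜} {n : ℤ} {R : ℝ}
    (h1 : ∀ x h, ‖h‖ ≤ (p : ℝ) ^ (-n) → φ (x + h) = φ x) (h2 : ∀ x, R < ‖x‖ → φ x = 0) :
    φ ∈ TestFunction p N 𝕜 := by
  refine ⟨(IsLocallyConstant.iff_eventually_eq _).2 fun x => ?_,
    HasCompactSupport.intro (isCompact_closedBall 0 R) fun x hx => h2 x (by simpa using hx)⟩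
  filter_upwards [Metric.closedBall_mem_nhds x (zpow_pos (prime_pos_real (p := p)) (-n))] with y hy
  rw [mem_closedBall_iff_norm] at hy
  simpa using h1 x (y - x) hy

lemma TestFunction.continuous (φ : TestFunction p N 𝕜) : Continuous φ.1 := φ.2.1.continuous

lemma TestFunction.integrable (φ : TestFunction p N 𝕜) (ν : Measure (Space p N))
    [IsFiniteMeasureOnCompacts ν] : Integrable φ.1 ν :=
  (TestFunction.continuous φ).integrable_of_hasCompactSupport φ.2.2

/-- A real test function, viewed as a complex one. -/
def TestFunction.toComplex (φ : TestFunction p N ℝ) : TestFunction p N ℂ :=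
  ⟨fun x => (φ.1 x : ℂ), φ.2.1.comp Complex.ofReal, φ.2.2.comp_left Complex.ofReal_zero⟩

lemma measurable_fourier (φ : TestFunction p N ℂ) : Measurable (fourier φ.1) := by
  have h : Measurable fun z : Space p N × Space p N => phase z.1 z.2 * φ.1 z.2 :=
    measurable_phase.mul ((TestFunction.continuous φ).measurable.comp measurable_snd)
  simp_rw [funext (fourier_eq φ.1)]
  exact (h.stronglyMeasurable.integral_prod_right (ν := haar p N)).measurable

lemma norm_fourier_le (φ : Space p N → ℂ) (ξ : Space p N) :
    ‖fourier φ ξ‖ ≤ ∫ x, ‖φ x‖ ∂(haar p N) := by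
  rw [fourier_eq]
  refine (norm_integral_le_integral_norm _).trans_eq ?_
  congr 1 with x
  rw [norm_mul, norm_phase, one_mul]

lemma memLp_of_bounded_support {μ : Measure (Space p N)} [IsFiniteMeasureOnCompacts μ]
    {q : ℝ≥0∞} {f : Space p N → ℂ} {R C : ℝ} (hf : AEStronglyMeasurable f μ)
    (hC : ∀ ξ, ‖f ξ‖ ≤ C) (hR : ∀ ξ, R < ‖ξ‖ → f ξ = 0) : MemLp f q μ := by
  have e : f = (Metric.closedBall 0 R).indicator f := by
    ext ξ
    by_cases h : ‖ξ‖ ≤ R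
    · rw [Set.indicator_of_mem (by simpa using h)]
    · rw [Set.indicator_of_notMem (by simpa using h), hR ξ (not_le.1 h)]
  rw [e, memLp_indicator_iff_restrict Metric.isClosed_closedBall.measurableSet]
  have : IsFiniteMeasure (μ.restrict (Metric.closedBall 0 R)) :=
    ⟨by simpa using (isCompact_closedBall _ _).measure_lt_top⟩
  exact MemLp.of_bound hf.restrict C (.of_forall hC)

lemma memLp_fourier (μ : Measure (Space p N)) [IsFiniteMeasureOnCompacts μ]
    (φ : TestFunction p N ℂ) (q : ℝ≥0∞) : MemLp (fourier φ.1) q μ := by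
  obtain ⟨n, hn⟩ := TestFunction.exists_add_eq φ
  exact memLp_of_bounded_support (measurable_fourier φ).aestronglyMeasurable
    (norm_fourier_le φ.1) (fun ξ => fourier_eq_zero hn)

lemma integrable_phase_mul {ν : Measure (Space p N)} {f : Space p N → ℂ} (hf : Integrable f ν)
    (ξ : Space p N) : Integrable (fun x => phase ξ x * f x) ν :=
  hf.bdd_mul (continuous_phase_right ξ).aestronglyMeasurable
    (.of_forall fun x => (norm_phase ξ x).le)

lemma fourier_add (φ ψ : TestFunction p N ℂ) :
    fourier (φ + ψ).1 = fourier φ.1 + fourier ψ.1 := by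
  ext ξ
  rw [Pi.add_apply, fourier_eq, fourier_eq, fourier_eq,
    ← integral_add (integrable_phase_mul (TestFunction.integrable φ _) ξ)
      (integrable_phase_mul (TestFunction.integrable ψ _) ξ)]
  congr 1 with x
  exact mul_add _ _ _

lemma fourier_smul (c : ℝ) (φ : Space p N → ℂ) :
    fourier (fun x => (c : ℂ) * φ x) = c • fourier φ := by
  ext ξ
  rw [Pi.smul_apply, fourier_eq, fourier_eq, Complex.real_smul, ← integral_const_mul]
  congr 1 with x
  ring

variable (μ : Measure (Space p N)) [IsFiniteMeasureOnCompacts μ]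

/-- The map `φ ↦ ℱφ` from the real test functions to `L²(μ)`, whose range is dense in `U`. -/
def fourierLp : TestFunction p N ℝ →ₗ[ℝ] Lp ℂ 2 μ where
  toFun φ := (memLp_fourier μ (TestFunction.toComplex φ) 2).toLp _
  map_add' φ ψ := by
    rw [← MemLp.toLp_add]
    congr 1
    rw [← fourier_add]
    congr 1 with x
    exact Complex.ofReal_add _ _
  map_smul' c φ := by
    rw [RingHom.id_apply, ← MemLp.toLp_const_smul]
    congr 1
    rw [← fourier_smul]
    congr 1 with x
    exact Complex.ofReal_mul _ _

lemma coeFn_fourierLp (φ : TestFunction p N ℝ) :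
    fourierLp μ φ =ᵐ[μ] fourier (fun x => (φ.1 x : ℂ)) :=
  MemLp.coeFn_toLp (memLp_fourier μ (TestFunction.toComplex φ) 2)

lemma fourierLp_mem (φ : TestFunction p N ℝ) : fourierLp μ φ ∈ U μ :=
  Submodule.le_topologicalClosure _ (Submodule.subset_span ⟨φ, coeFn_fourierLp μ φ⟩)

/-- The canonical map from the real test functions to their completion `U`. -/
def toU : TestFunction p N ℝ →ₗ[ℝ] U μ :=
  (fourierLp μ).codRestrict (U μ) (fourierLp_mem μ)

lemma coeFn_toU (φ : TestFunction p N ℝ) :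
    (toU μ φ : Lp ℂ 2 μ) =ᵐ[μ] fourier (fun x => (φ.1 x : ℂ)) := coeFn_fourierLp μ φ

variable {μ} in
lemma eq_toU {φ : TestFunction p N ℝ} {u : U μ}
    (h : (u : Lp ℂ 2 μ) =ᵐ[μ] fourier (fun x => (φ.1 x : ℂ))) : u = toU μ φ :=
  Subtype.ext (Lp.ext (h.trans (coeFn_toU μ φ).symm))

lemma denseRange_toU : DenseRange (toU μ) := by
  have hs : {u : Lp ℂ 2 μ | ∃ φ : TestFunction p N ℝ,
      u =ᵐ[μ] fourier (fun x => (φ.1 x : ℂ))} = LinearMap.range (fourierLp μ) := by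
    ext u
    constructor
    · rintro ⟨φ, h⟩
      exact ⟨φ, Lp.ext ((coeFn_fourierLp μ φ).trans h.symm)⟩
    · rintro ⟨φ, rfl⟩
      exact ⟨φ, coeFn_fourierLp μ φ⟩
  intro u
  rw [closure_subtype, ← Set.range_comp]
  obtain ⟨u, hu⟩ := u
  rw [U, hs, Submodule.span_eq, ← SetLike.mem_coe, Submodule.topologicalClosure_coe] at hu
  exact hu

end TestFunction

section Correlation

variable {p : ℕ} [Fact p.Prime] {N : ℕ}

lemma norm_le_and_norm_le_max_of_mul_ne_zero {𝕜 : Type} [RCLike 𝕜] {φ ψ : Space p N → 𝕜}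
    {R R' : ℝ} (hφ : ∀ x, R < ‖x‖ → φ x = 0) (hψ : ∀ x, R' < ‖x‖ → ψ x = 0) {x z : Space p N}
    (h : φ x * ψ (x - z) ≠ 0) : ‖x‖ ≤ R ∧ ‖z‖ ≤ max R R' := by
  have hx : ‖x‖ ≤ R := not_lt.1 fun hlt => h (by rw [hφ x hlt, zero_mul])
  have hxz : ‖x - z‖ ≤ R' := not_lt.1 fun hlt => h (by rw [hψ _ hlt, mul_zero])
  rw [← sub_sub_cancel x z]
  exact ⟨by simpa using hx, (norm_sub_le_max _ _).trans (max_le_max hx hxz)⟩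

/-- The correlation `φ ∗ ψ̃ : z ↦ ∫ φ(x) ψ(x - z) dx` that occurs in the covariance of the noise. -/
def correlation (φ ψ : TestFunction p N ℂ) : TestFunction p N ℂ :=
  ⟨fun z => ∫ x, φ.1 x * ψ.1 (x - z) ∂(haar p N), by
    obtain ⟨n, hn⟩ := TestFunction.exists_add_eq ψ
    obtain ⟨R, hR⟩ := TestFunction.exists_eq_zero φ
    obtain ⟨R', hR'⟩ := TestFunction.exists_eq_zero ψ
    refine mem_testFunction (n := n) (R := max R R') (fun z h hh => ?_) (fun z hz => ?_)
    · congr 1 with x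
      rw [show x - (z + h) = (x - z) + -h by abel, hn _ _ (by simpa using hh)]
    · refine integral_eq_zero_of_ae (.of_forall fun x => ?_)
      by_contra hx
      exact hz.not_ge (norm_le_and_norm_le_max_of_mul_ne_zero hR hR' hx).2⟩

lemma integrable_phase_mul_mul_sub (φ ψ : TestFunction p N ℂ) (ξ : Space p N) :
    Integrable (Function.uncurry fun z x : Space p N => phase ξ z * (φ.1 x * ψ.1 (x - z)))
      ((haar p N).prod (haar p N)) := by
  obtain ⟨R, hR⟩ := TestFunction.exists_eq_zero φ
  obtain ⟨R', hR'⟩ := TestFunction.exists_eq_zero ψ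
  refine Continuous.integrable_of_hasCompactSupport ?_ (HasCompactSupport.intro
    ((isCompact_closedBall 0 (max R R')).prod (isCompact_closedBall 0 R)) ?_)
  · have hphase := continuous_phase_right ξ
    have hφ := TestFunction.continuous φ
    have hψ := TestFunction.continuous ψ
    unfold Function.uncurry
    fun_prop
  · rintro ⟨z, x⟩ hzx
    by_contra hx
    have := norm_le_and_norm_le_max_of_mul_ne_zero hR hR' (right_ne_zero_of_mul hx)
    exact hzx ⟨by simpa using this.2, by simpa using this.1⟩

lemma fourier_correlation (φ ψ : TestFunction p N ℂ) (ξ : Space p N) :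
    fourier (correlation φ ψ).1 ξ =
      fourier φ.1 ξ * conj (fourier (fun x => conj (ψ.1 x)) ξ) := by
  calc fourier (correlation φ ψ).1 ξ
      = ∫ z, ∫ x, phase ξ z * (φ.1 x * ψ.1 (x - z)) ∂(haar p N) ∂(haar p N) := by
        rw [fourier_eq]
        congr 1 with z
        rw [integral_const_mul]; rfl
    _ = ∫ x, ∫ z, phase ξ z * (φ.1 x * ψ.1 (x - z)) ∂(haar p N) ∂(haar p N) :=
        integral_integral_swap (integrable_phase_mul_mul_sub φ ψ ξ)
    _ = ∫ x, phase ξ x * φ.1 x * conj (fourier (fun x => conj (ψ.1 x)) ξ) ∂(haar p N) := by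
        congr 1 with x
        rw [← integral_sub_left_eq_self _ _ x, fourier_eq, ← integral_conj, ← integral_const_mul]
        congr 1 with w
        rw [phase_sub, map_mul, Complex.conj_conj, sub_sub_cancel]
        ring
    _ = fourier φ.1 ξ * conj (fourier (fun x => conj (ψ.1 x)) ξ) := by
        rw [integral_mul_const, ← fourier_eq]

variable {Λ μ : Measure (Space p N)} [IsFiniteMeasureOnCompacts μ]

lemma integral_correlation (hμ : IsSpectralMeasure Λ μ) (φ ψ : TestFunction p N ℝ) :
    ∫ z, (∫ x, φ.1 x * ψ.1 (x - z) ∂(haar p N)) ∂Λ = inner ℝ (toU μ φ) (toU μ ψ) := by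
  set φ' := TestFunction.toComplex φ
  set ψ' := TestFunction.toComplex ψ
  have hcorr : ∀ z, (correlation φ' ψ').1 z =
      ((∫ x, φ.1 x * ψ.1 (x - z) ∂(haar p N) : ℝ) : ℂ) := by
    intro z
    rw [← integral_complex_ofReal]
    exact integral_congr_ae (.of_forall fun x => (Complex.ofReal_mul _ _).symm)
  have hfourier : ∀ ξ, fourier (correlation φ' ψ').1 ξ =
      fourier φ'.1 ξ * conj (fourier ψ'.1 ξ) := by
    intro ξ
    rw [fourier_correlation]
    congr 4 with x
    exact Complex.conj_ofReal _
  have hint : Integrable (fun ξ => fourier φ'.1 ξ * conj (fourier ψ'.1 ξ)) μ :=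
    (memLp_fourier μ φ' 2).integrable_mul (memLp_fourier μ ψ' 2).star
  have h := congrArg Complex.re (hμ (correlation φ' ψ'))
  simp_rw [hcorr, hfourier] at h
  rw [integral_complex_ofReal, Complex.ofReal_re, ← RCLike.re_eq_complex_re,
    ← integral_re hint] at h
  rw [h, Submodule.coe_inner, L2.inner_def]
  refine integral_congr_ae ?_
  filter_upwards [coeFn_toU μ φ, coeFn_toU μ ψ] with ξ hφ hψ
  rw [hφ, hψ, Complex.inner]
  simp [φ', ψ', TestFunction.toComplex, mul_comm]

end Correlation

section Smoothing

variable {p : ℕ} [Fact p.Prime] {N : ℕ}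

lemma norm_fourierMeasure_le (y : Space p N → ℝ) (ν : Measure (Space p N)) (ξ : Space p N) :
    ‖fourierMeasure y ν ξ‖ ≤ ∫ x, |y x| ∂ν := by
  rw [fourierMeasure_eq]
  refine (norm_integral_le_integral_norm _).trans_eq ?_
  congr 1 with x
  rw [norm_mul, norm_phase, one_mul, Complex.norm_real, Real.norm_eq_abs]

lemma fourierMeasure_of_not_integrable {y : Space p N → ℝ} {ν : Measure (Space p N)}
    (hy : AEStronglyMeasurable y ν) (h : ¬ Integrable y ν) : fourierMeasure y ν = 0 := by
  ext ξ
  rw [fourierMeasure_eq]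
  refine integral_undef fun hi => h ?_
  refine hi.norm.mono' hy (.of_forall fun x => ?_)
  rw [norm_mul, norm_phase, one_mul, Complex.norm_real]

lemma measurable_fourierMeasure {α : Type*} [MeasurableSpace α] (κ : Kernel α (Space p N))
    [IsSFiniteKernel κ] {y : α → Space p N → ℝ} (hy : Measurable (Function.uncurry y)) :
    Measurable fun z : α × Space p N => fourierMeasure (y z.1) (κ z.1) z.2 := by
  have h : Measurable fun w : (α × Space p N) × Space p N =>
      phase w.1.2 w.2 * (y w.1.1 w.2 : ℂ) :=
    (measurable_phase.comp ((measurable_snd.comp measurable_fst).prodMk measurable_snd)).mul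
      (Complex.measurable_ofReal.comp
        (hy.comp ((measurable_fst.comp measurable_fst).prodMk measurable_snd)))
  simp_rw [fourierMeasure_eq]
  exact (h.stronglyMeasurable.integral_kernel_prod_right'
    (κ := κ.comap Prod.fst measurable_fst)).measurable

lemma measurable_fourierMeasure_right (ν : Measure (Space p N)) [SFinite ν] {y : Space p N → ℝ}
    (hy : AEStronglyMeasurable y ν) : Measurable (fourierMeasure y ν) := by
  obtain ⟨z, hz, e⟩ := hy
  have h : Measurable fun w : Space p N × Space p N => phase w.1 w.2 * (z w.2 : ℂ) :=
    measurable_phase.mul (Complex.measurable_ofReal.comp (hz.measurable.comp measurable_snd))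
  have hF : fourierMeasure y ν = fun ξ => ∫ x, phase ξ x * (z x : ℂ) ∂ν := funext fun ξ =>
    integral_congr_ae (e.mono fun x hx => by simp only [hx, phase])
  rw [hF]
  exact (h.stronglyMeasurable.integral_prod_right (ν := ν)).measurable

/-- The convolution of `y ν` with the approximate identity `bump`. -/
def smooth (n : ℤ) (y : Space p N → ℝ) (ν : Measure (Space p N)) (w : Space p N) : ℝ :=
  ∫ x, bump p N n (w - x) * y x ∂ν

lemma smooth_mem {n : ℤ} {y : Space p N → ℝ} {ν : Measure (Space p N)} {R : ℝ}
    (hR : ∀ x, R < ‖x‖ → y x = 0) : smooth n y ν ∈ TestFunction p N ℝ := by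
  refine mem_testFunction (n := n) (R := max R ((p : ℝ) ^ (-n))) (fun w h hh => ?_) fun w hw => ?_
  · unfold smooth
    congr 1 with x
    rw [show w + h - x = (w - x) + h by abel, bump_add n _ hh]
  · refine integral_eq_zero_of_ae (.of_forall fun x => ?_)
    by_contra hx
    have hx1 : ‖x‖ ≤ R := not_lt.1 fun h => hx (by simp [hR x h])
    have hx2 : ‖w - x‖ ≤ (p : ℝ) ^ (-n) := not_lt.1 fun h => hx (by simp [bump_eq_zero h])
    refine absurd hw (not_lt.2 ?_)
    rw [show w = x + (w - x) by abel]
    exact (IsUltrametricDist.norm_add_le_max _ _).trans (max_le_max hx1 hx2)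

lemma fourier_bump_sub (n : ℤ) (x ξ : Space p N) :
    fourier (fun w => (bump p N n (w - x) : ℂ)) ξ =
      phase ξ x * (Metric.closedBall 0 ((p : ℝ) ^ n)).indicator (fun _ => 1) ξ := by
  rw [← fourier_bump, fourier_eq, ← integral_add_right_eq_self _ x, fourier_eq,
    ← integral_const_mul]
  congr 1 with w
  rw [add_sub_cancel_right, phase_add]; ring

lemma integrable_phase_mul_bump_sub_mul (n : ℤ) {y : Space p N → ℝ} {ν : Measure (Space p N)}
    [SFinite ν] (hi : Integrable y ν) (ξ : Space p N) :
    Integrable (Function.uncurry fun x w : Space p N =>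
      phase ξ w * ((bump p N n (w - x) : ℂ) * (y x : ℂ))) (ν.prod (haar p N)) := by
  have hphase : AEStronglyMeasurable (fun z : Space p N × Space p N => phase ξ z.2)
      (ν.prod (haar p N)) :=
    ((continuous_phase_right ξ).comp continuous_snd).aestronglyMeasurable
  have hbump : Measurable fun z : Space p N × Space p N => (bump p N n (z.2 - z.1) : ℂ) :=
    Complex.measurable_ofReal.comp ((measurable_bump n).comp (measurable_snd.sub measurable_fst))
  have hy : AEStronglyMeasurable (fun z : Space p N × Space p N => (y z.1 : ℂ))
      (ν.prod (haar p N)) :=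
    hi.ofReal.1.comp_fst
  have hm : AEStronglyMeasurable (Function.uncurry fun x w : Space p N =>
      phase ξ w * ((bump p N n (w - x) : ℂ) * (y x : ℂ))) (ν.prod (haar p N)) :=
    hphase.mul (hbump.aestronglyMeasurable.mul hy)
  have hx (x : Space p N) :
      Integrable (fun w => phase ξ w * ((bump p N n (w - x) : ℂ) * (y x : ℂ))) (haar p N) :=
    integrable_phase_mul (((integrable_bump n).comp_sub_right x).ofReal.mul_const _) ξ
  have hnorm (x : Space p N) :
      ∫ w, ‖phase ξ w * ((bump p N n (w - x) : ℂ) * (y x : ℂ))‖ ∂(haar p N) =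
        (∫ w, bump p N n w ∂(haar p N)) * |y x| := by
    rw [← integral_sub_right_eq_self (bump p N n) x, ← integral_mul_const]
    congr 1 with w
    rw [norm_mul, norm_phase, one_mul, norm_mul, Complex.norm_real, Complex.norm_real,
      Real.norm_eq_abs, Real.norm_eq_abs, abs_of_nonneg (bump_nonneg _ _)]
  refine (integrable_prod_iff hm).2 ⟨.of_forall hx, ?_⟩
  exact (hi.abs.const_mul _).congr (.of_forall fun x => (hnorm x).symm)

lemma fourier_smooth (n : ℤ) {y : Space p N → ℝ} {ν : Measure (Space p N)} [SFinite ν]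
    (hi : Integrable y ν) :
    fourier (fun w => (smooth n y ν w : ℂ)) =
      (Metric.closedBall 0 ((p : ℝ) ^ n)).indicator (fourierMeasure y ν) := by
  classical
  ext ξ
  calc fourier (fun w => (smooth n y ν w : ℂ)) ξ
      = ∫ w, ∫ x, phase ξ w * ((bump p N n (w - x) : ℂ) * (y x : ℂ)) ∂ν ∂(haar p N) := by
        rw [fourier_eq]
        congr 1 with w
        rw [integral_const_mul, smooth, ← integral_complex_ofReal]
        push_cast; rfl
    _ = ∫ x, ∫ w, phase ξ w * ((bump p N n (w - x) : ℂ) * (y x : ℂ)) ∂(haar p N) ∂ν :=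
        (integral_integral_swap (integrable_phase_mul_bump_sub_mul n hi ξ)).symm
    _ = ∫ x, phase ξ x * (y x : ℂ) *
          (Metric.closedBall 0 ((p : ℝ) ^ n)).indicator (fun _ => 1) ξ ∂ν := by
        congr 1 with x
        rw [mul_right_comm, ← fourier_bump_sub, fourier_eq, ← integral_mul_const]
        congr 1 with w
        ring
    _ = (Metric.closedBall 0 ((p : ℝ) ^ n)).indicator (fourierMeasure y ν) ξ := by
        rw [integral_mul_const, ← fourierMeasure_eq, Set.indicator_apply, Set.indicator_apply,
          mul_ite, mul_one, mul_zero]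

lemma exists_nat_norm_le (ξ : Space p N) : ∃ n : ℕ, ‖ξ‖ ≤ (p : ℝ) ^ (n : ℤ) := by
  obtain ⟨n, hn⟩ := pow_unbounded_of_one_lt ‖ξ‖ (one_lt_prime_real (p := p))
  exact ⟨n, by simpa using hn.le⟩

lemma closedBall_zpow_mono {E : Type*} [SeminormedAddCommGroup E] :
    Monotone fun n : ℕ => Metric.closedBall (0 : E) ((p : ℝ) ^ (n : ℤ)) := fun m n h =>
  Metric.closedBall_subset_closedBall (zpow_le_zpow_right₀
    one_lt_prime_real.le (by exact_mod_cast h))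

lemma eventually_mem_closedBall (ξ : Space p N) :
    ∀ᶠ n : ℕ in atTop, ξ ∈ Metric.closedBall (0 : Space p N) ((p : ℝ) ^ (n : ℤ)) := by
  obtain ⟨n, hn⟩ := exists_nat_norm_le ξ
  filter_upwards [eventually_ge_atTop n] with k hk
  exact closedBall_zpow_mono hk (by simpa using hn)

lemma indicator_closedBall_eq_zero {F : Type*} [Zero F] (f : Space p N → F) {r : ℝ}
    {x : Space p N} (hx : r < ‖x‖) : (Metric.closedBall 0 r).indicator f x = 0 :=
  Set.indicator_of_notMem (by simpa using hx) _

lemma tendsto_indicator_closedBall {F : Type*} [Zero F] [TopologicalSpace F] (f : Space p N → F)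
    (x : Space p N) :
    Tendsto (fun n : ℕ => (Metric.closedBall 0 ((p : ℝ) ^ (n : ℤ))).indicator f x) atTop
      (𝓝 (f x)) := by
  refine tendsto_const_nhds.congr' ?_
  filter_upwards [eventually_mem_closedBall x] with n hn
  exact (Set.indicator_of_mem hn _).symm

lemma tendsto_fourierMeasure_indicator {y : Space p N → ℝ} {ν : Measure (Space p N)}
    (hi : Integrable y ν) (ξ : Space p N) :
    Tendsto (fun n : ℕ =>
      fourierMeasure ((Metric.closedBall 0 ((p : ℝ) ^ (n : ℤ))).indicator y) ν ξ) atTop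
      (𝓝 (fourierMeasure y ν ξ)) := by
  simp_rw [fourierMeasure_eq]
  refine tendsto_integral_of_dominated_convergence (fun x => |y x|) (fun n => ?_) hi.abs
    (fun n => .of_forall fun x => ?_) (.of_forall fun x => ?_)
  · exact (integrable_phase_mul
      (hi.indicator Metric.isClosed_closedBall.measurableSet).ofReal ξ).1
  · rw [norm_mul, norm_phase, one_mul, Complex.norm_real]
    exact norm_indicator_le_norm_self _ _
  · exact ((Complex.continuous_ofReal.tendsto _).comp
      (tendsto_indicator_closedBall y x)).const_mul _

variable {μ : Measure (Space p N)} [IsFiniteMeasureOnCompacts μ] {y : Space p N → ℝ}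
  {ν : Measure (Space p N)} [IsFiniteMeasure ν]

lemma memLp_indicator_closedBall_fourierMeasure (hi : Integrable y ν) (r : ℝ) (q : ℝ≥0∞) :
    MemLp ((Metric.closedBall 0 r).indicator (fourierMeasure y ν)) q μ :=
  memLp_of_bounded_support
    ((measurable_fourierMeasure_right ν hi.1).indicator
      Metric.isClosed_closedBall.measurableSet).aestronglyMeasurable
    (fun ξ => (norm_indicator_le_norm_self _ _).trans (norm_fourierMeasure_le y ν ξ))
    fun _ => indicator_closedBall_eq_zero _

lemma toLp_indicator_fourierMeasure_mem_of_bounded_support (hi : Integrable y ν) {R : ℝ}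
    (hR : ∀ x, R < ‖x‖ → y x = 0) (n : ℤ) :
    (memLp_indicator_closedBall_fourierMeasure (μ := μ) hi ((p : ℝ) ^ n) 2).toLp ∈ U μ := by
  convert fourierLp_mem μ (⟨_, smooth_mem (n := n) (ν := ν) hR⟩ : TestFunction p N ℝ) using 1
  refine Lp.ext ((MemLp.coeFn_toLp _).trans ?_)
  rw [← fourier_smooth n hi]
  exact (coeFn_fourierLp μ ⟨_, smooth_mem hR⟩).symm

lemma toLp_indicator_fourierMeasure_mem (hi : Integrable y ν) (n : ℤ) :
    (memLp_indicator_closedBall_fourierMeasure (μ := μ) hi ((p : ℝ) ^ n) 2).toLp ∈ U μ := by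
  classical
  have hi' (m : ℕ) : Integrable ((Metric.closedBall 0 ((p : ℝ) ^ (m : ℤ))).indicator y) ν :=
    hi.indicator Metric.isClosed_closedBall.measurableSet
  refine toLp_mem_of_dominated (Submodule.isClosed_topologicalClosure _)
    (f := fun m : ℕ => (Metric.closedBall 0 ((p : ℝ) ^ n)).indicator
      (fourierMeasure ((Metric.closedBall 0 ((p : ℝ) ^ (m : ℤ))).indicator y) ν))
    (b := (Metric.closedBall 0 ((p : ℝ) ^ n)).indicator fun _ => ∫ x, |y x| ∂ν)
    (fun m => memLp_indicator_closedBall_fourierMeasure (hi' m) _ 2) _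
    (memLp_indicator_const _ Metric.isClosed_closedBall.measurableSet _
      (.inr (isCompact_closedBall _ _).measure_lt_top.ne)) (fun m ξ => ?_) (fun ξ => ?_) fun m => ?_
  · rw [norm_indicator_eq_indicator_norm]
    refine Set.indicator_le_indicator ((norm_fourierMeasure_le _ _ _).trans ?_)
    exact integral_mono (hi' m).norm hi.norm fun x => norm_indicator_le_norm_self y x
  · simp only [Set.indicator_apply]
    split_ifs
    exacts [tendsto_fourierMeasure_indicator hi ξ, tendsto_const_nhds]
  · exact toLp_indicator_fourierMeasure_mem_of_bounded_support (hi' m)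
      (fun _ => indicator_closedBall_eq_zero y) n

/-- The two cutoffs, in space and in frequency, are removed one after the other because only the
truncated Fourier transforms are dominated uniformly in the spatial cutoff. -/
lemma toLp_fourierMeasure_mem (hi : Integrable y ν) (hF : MemLp (fourierMeasure y ν) 2 μ) :
    hF.toLp ∈ U μ :=
  toLp_mem_of_dominated (Submodule.isClosed_topologicalClosure _)
    (fun n : ℕ => memLp_indicator_closedBall_fourierMeasure hi ((p : ℝ) ^ (n : ℤ)) 2) hF hF.norm
    (fun _ _ => norm_indicator_le_norm_self _ _) (tendsto_indicator_closedBall _)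
    fun n => toLp_indicator_fourierMeasure_mem hi n

end Smoothing

section Positivity

lemma lintegral_enorm_mul_enorm_le {Ω E F : Type*} [MeasurableSpace Ω] {P : Measure Ω}
    [NormedAddCommGroup E] [NormedAddCommGroup F] {X : Ω → E} {Y : Ω → F} {S : ℝ≥0∞}
    (hX : AEStronglyMeasurable X P) (hY : AEStronglyMeasurable Y P)
    (hXS : ∫⁻ ω, ‖X ω‖ₑ ^ 2 ∂P ≤ S) (hYS : ∫⁻ ω, ‖Y ω‖ₑ ^ 2 ∂P ≤ S) :
    ∫⁻ ω, ‖X ω‖ₑ * ‖Y ω‖ₑ ∂P ≤ S := by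
  calc ∫⁻ ω, ‖X ω‖ₑ * ‖Y ω‖ₑ ∂P
      ≤ (∫⁻ ω, ‖X ω‖ₑ ^ (2 : ℝ) ∂P) ^ (1 / 2 : ℝ) *
          (∫⁻ ω, ‖Y ω‖ₑ ^ (2 : ℝ) ∂P) ^ (1 / 2 : ℝ) :=
        ENNReal.lintegral_mul_le_Lp_mul_Lq P .two_two hX.enorm hY.enorm
    _ ≤ S ^ (1 / 2 : ℝ) * S ^ (1 / 2 : ℝ) := by
        simp only [ENNReal.rpow_two]
        gcongr
    _ = S := by
        rw [← ENNReal.rpow_add_of_nonneg _ _ (by norm_num) (by norm_num), add_halves,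
          ENNReal.rpow_one]

variable {p : ℕ} [Fact p.Prime] {N : ℕ} {Λ μ : Measure (Space p N)}

/-- The covariance kernel `Λ` smoothed at scale `p ^ (-n)`; its spectral measure is `μ` restricted
to the ball of radius `p ^ n`. -/
def smoothKernel (Λ : Measure (Space p N)) (n : ℤ) (z : Space p N) : ℝ :=
  ∫ w, bump p N n (w - z) ∂Λ

lemma smoothKernel_nonneg (n : ℤ) (z : Space p N) : 0 ≤ smoothKernel Λ n z :=
  integral_nonneg fun _ => bump_nonneg _ _

lemma measurable_smoothKernel (n : ℤ) : Measurable (smoothKernel Λ n) := by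
  refine Continuous.measurable (IsLocallyConstant.continuous ?_)
  refine (IsLocallyConstant.iff_eventually_eq _).2 fun z => ?_
  filter_upwards [Metric.closedBall_mem_nhds z (zpow_pos (prime_pos_real (p := p)) (-n))] with z' hz
  rw [mem_closedBall_iff_norm'] at hz
  unfold smoothKernel
  congr 1 with w
  rw [show w - z' = (w - z) + (z - z') by abel, bump_add n _ hz]

lemma bump_sub_mem (n : ℤ) (z : Space p N) :
    (fun w => (bump p N n (w - z) : ℂ)) ∈ TestFunction p N ℂ := by
  refine mem_testFunction (n := n) (R := max ‖z‖ ((p : ℝ) ^ (-n))) (fun w h hh => ?_)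
    fun w hw => ?_
  · rw [show w + h - z = (w - z) + h by abel, bump_add n _ hh]
  · by_contra hx
    have hwz : ‖w - z‖ ≤ (p : ℝ) ^ (-n) := not_lt.1 fun h => hx (by simp [bump_eq_zero h])
    refine absurd hw (not_lt.2 ?_)
    nth_rewrite 1 [show w = z + (w - z) by abel]
    exact (IsUltrametricDist.norm_add_le_max _ _).trans (max_le_max le_rfl hwz)

lemma setIntegral_phase (hμ : IsSpectralMeasure Λ μ) (n : ℤ) (z : Space p N) :
    ∫ ξ in Metric.closedBall 0 ((p : ℝ) ^ n), phase ξ z ∂μ = (smoothKernel Λ n z : ℂ) := by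
  classical
  have h := hμ ⟨_, bump_sub_mem n z⟩
  simp_rw [fourier_bump_sub] at h
  rw [smoothKernel, ← integral_complex_ofReal, h,
    ← integral_indicator Metric.isClosed_closedBall.measurableSet]
  congr 1 with ξ
  rw [Set.indicator_apply, Set.indicator_apply, mul_ite, mul_one, mul_zero]

lemma ofReal_norm_fourierMeasure_sq (y : Space p N → ℝ) (ν : Measure (Space p N)) [SFinite ν]
    (ξ : Space p N) :
    ((‖fourierMeasure y ν ξ‖ ^ 2 : ℝ) : ℂ) =
      ∫ z, phase ξ (z.1 - z.2) * ((y z.1 : ℂ) * (y z.2 : ℂ)) ∂(ν.prod ν) := by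
  rw [← Complex.normSq_eq_norm_sq, ← Complex.mul_conj, fourierMeasure_eq, ← integral_conj,
    ← integral_prod_mul]
  congr 1 with z
  rw [phase_sub, map_mul, Complex.conj_ofReal]
  ring

lemma integrable_phase_sub_mul_mul (ρ : Measure (Space p N)) [IsFiniteMeasure ρ]
    {ν : Measure (Space p N)} [SFinite ν] {y : Space p N → ℝ} (hi : Integrable y ν) :
    Integrable (Function.uncurry fun (ξ : Space p N) (z : Space p N × Space p N) =>
      phase ξ (z.1 - z.2) * ((y z.1 : ℂ) * (y z.2 : ℂ))) (ρ.prod (ν.prod ν)) := by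
  have hphase : Measurable fun w : Space p N × (Space p N × Space p N) =>
      phase w.1 (w.2.1 - w.2.2) :=
    measurable_phase.comp (measurable_fst.prodMk
      ((measurable_fst.comp measurable_snd).sub (measurable_snd.comp measurable_snd)))
  have hyy : Integrable (fun w : Space p N × (Space p N × Space p N) =>
      (y w.2.1 : ℂ) * (y w.2.2 : ℂ)) (ρ.prod (ν.prod ν)) :=
    Integrable.comp_snd (f := fun z : Space p N × Space p N => (y z.1 : ℂ) * (y z.2 : ℂ))
      (hi.ofReal.mul_prod hi.ofReal) ρ
  exact hyy.bdd_mul hphase.aestronglyMeasurable (c := 1) (.of_forall fun w => (norm_phase _ _).le)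

lemma setIntegral_phase_sub_mul_mul (hμ : IsSpectralMeasure Λ μ) (n : ℤ) (y : Space p N → ℝ)
    (z : Space p N × Space p N) :
    ∫ ξ in Metric.closedBall 0 ((p : ℝ) ^ n),
        phase ξ (z.1 - z.2) * ((y z.1 : ℂ) * (y z.2 : ℂ)) ∂μ =
      ((y z.1 * y z.2 * smoothKernel Λ n (z.1 - z.2) : ℝ) : ℂ) := by
  rw [integral_mul_const, setIntegral_phase hμ]
  push_cast
  ring

lemma lintegral_eq_iSup_closedBall (f : Space p N → ℝ≥0∞) :
    ∫⁻ ξ, f ξ ∂μ = ⨆ n : ℕ, ∫⁻ ξ in Metric.closedBall 0 ((p : ℝ) ^ (n : ℤ)), f ξ ∂μ := by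
  have hball : (⋃ n : ℕ, Metric.closedBall (0 : Space p N) ((p : ℝ) ^ (n : ℤ))) = Set.univ :=
    Set.eq_univ_of_forall fun ξ => Set.mem_iUnion.2 (by simpa using exists_nat_norm_le ξ)
  rw [← setLIntegral_iUnion_of_directed f closedBall_zpow_mono.directed_le, hball,
    setLIntegral_univ]

variable [IsFiniteMeasureOnCompacts μ]

instance instIsFiniteMeasureRestrictClosedBall (r : ℝ) :
    IsFiniteMeasure (μ.restrict (Metric.closedBall 0 r)) :=
  ⟨by simpa using (isCompact_closedBall _ _).measure_lt_top⟩

lemma integrable_mul_mul_smoothKernel (hμ : IsSpectralMeasure Λ μ) (n : ℤ)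
    {ν : Measure (Space p N)} [SFinite ν] {y : Space p N → ℝ} (hi : Integrable y ν) :
    Integrable (fun z : Space p N × Space p N =>
      y z.1 * y z.2 * smoothKernel Λ n (z.1 - z.2)) (ν.prod ν) := by
  have h := (integrable_phase_sub_mul_mul
    (μ.restrict (Metric.closedBall 0 ((p : ℝ) ^ n))) hi).integral_prod_right
  simp only [Function.uncurry_apply_pair, setIntegral_phase_sub_mul_mul hμ] at h
  simpa using h.re

lemma setIntegral_norm_fourierMeasure_sq (hμ : IsSpectralMeasure Λ μ) (n : ℤ)
    {ν : Measure (Space p N)} [SFinite ν] {y : Space p N → ℝ} (hi : Integrable y ν) :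
    ∫ ξ in Metric.closedBall 0 ((p : ℝ) ^ n), ‖fourierMeasure y ν ξ‖ ^ 2 ∂μ =
      ∫ z, y z.1 * y z.2 * smoothKernel Λ n (z.1 - z.2) ∂(ν.prod ν) := by
  apply Complex.ofReal_injective
  rw [← integral_complex_ofReal, ← integral_complex_ofReal]
  simp_rw [ofReal_norm_fourierMeasure_sq]
  rw [integral_integral_swap (integrable_phase_sub_mul_mul _ hi)]
  simp_rw [setIntegral_phase_sub_mul_mul hμ]

lemma setLIntegral_enorm_fourierMeasure_sq (n : ℤ) {ν : Measure (Space p N)} [SFinite ν]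
    {y : Space p N → ℝ} (hy : AEStronglyMeasurable y ν) :
    ∫⁻ ξ in Metric.closedBall 0 ((p : ℝ) ^ n), ‖fourierMeasure y ν ξ‖ₑ ^ 2 ∂μ =
      ENNReal.ofReal
        (∫ ξ in Metric.closedBall 0 ((p : ℝ) ^ n), ‖fourierMeasure y ν ξ‖ ^ 2 ∂μ) := by
  rw [ofReal_integral_eq_lintegral_ofReal]
  · congr 1 with ξ
    rw [ENNReal.ofReal_pow (norm_nonneg _), ofReal_norm]
  · refine Integrable.of_bound
      ((measurable_fourierMeasure_right ν hy).norm.pow_const 2).aestronglyMeasurable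
      ((∫ x, |y x| ∂ν) ^ 2) (.of_forall fun ξ => ?_)
    rw [Real.norm_eq_abs, abs_of_nonneg (by positivity)]
    gcongr
    exact norm_fourierMeasure_le y ν ξ
  · exact .of_forall fun ξ => by positivity

lemma setLIntegral_fourierMeasure_le (hμ : IsSpectralMeasure Λ μ) (n : ℤ)
    {ν : Measure (Space p N)} [SFinite ν] {y : Space p N → ℝ} (hy : AEStronglyMeasurable y ν) :
    ∫⁻ ξ in Metric.closedBall 0 ((p : ℝ) ^ n), ‖fourierMeasure y ν ξ‖ₑ ^ 2 ∂μ ≤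
      ∫⁻ z, ‖y z.1‖ₑ * ‖y z.2‖ₑ * ENNReal.ofReal (smoothKernel Λ n (z.1 - z.2)) ∂(ν.prod ν) := by
  by_cases hi : Integrable y ν
  · rw [setLIntegral_enorm_fourierMeasure_sq n hy, setIntegral_norm_fourierMeasure_sq hμ n hi]
    refine (Real.ofReal_le_enorm _).trans ((enorm_integral_le_lintegral_enorm _).trans_eq ?_)
    congr 1 with z
    rw [enorm_mul, enorm_mul, Real.enorm_eq_ofReal (smoothKernel_nonneg _ _)]
  · simp [fourierMeasure_of_not_integrable hy hi]

lemma setLIntegral_fourierPos (hμ : IsSpectralMeasure Λ μ) (n : ℤ)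
    {ν : Measure (Space p N)} [IsFiniteMeasure ν] :
    ∫⁻ ξ in Metric.closedBall 0 ((p : ℝ) ^ n), ‖fourierPos ν ξ‖ₑ ^ 2 ∂μ =
      ∫⁻ z, ENNReal.ofReal (smoothKernel Λ n (z.1 - z.2)) ∂(ν.prod ν) := by
  have hone : Integrable (fun _ => (1 : ℝ)) ν := integrable_const 1
  have hint := integrable_mul_mul_smoothKernel hμ n hone
  have heq := setIntegral_norm_fourierMeasure_sq hμ n hone
  simp_rw [one_mul] at hint heq
  unfold fourierPos
  rw [setLIntegral_enorm_fourierMeasure_sq n hone.1, heq,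
    ofReal_integral_eq_lintegral_ofReal hint (.of_forall fun z => smoothKernel_nonneg _ _)]

/-- Since the smoothed kernel is non-negative, `Y x * Y x'` may be replaced by the bound
`⨆ x, E |Y x| ^ 2` inside the energy integral. -/
lemma setLIntegral_lintegral_fourierMeasure_le {Ω : Type*} [MeasurableSpace Ω] (P : Measure Ω)
    [SFinite P] (hμ : IsSpectralMeasure Λ μ) (n : ℤ) {ν : Measure (Space p N)} [IsFiniteMeasure ν]
    {Y : Ω → Space p N → ℝ} (hY : Measurable (Function.uncurry Y)) :
    ∫⁻ ω, ∫⁻ ξ in Metric.closedBall 0 ((p : ℝ) ^ n), ‖fourierMeasure (Y ω) ν ξ‖ₑ ^ 2 ∂μ ∂P ≤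
      (⨆ x, ∫⁻ ω, ‖Y ω x‖ₑ ^ 2 ∂P) *
        ∫⁻ ξ in Metric.closedBall 0 ((p : ℝ) ^ n), ‖fourierPos ν ξ‖ₑ ^ 2 ∂μ := by
  set S := ⨆ x, ∫⁻ ω, ‖Y ω x‖ₑ ^ 2 ∂P
  have hYx (x : Space p N) : AEStronglyMeasurable (fun ω => Y ω x) P :=
    (hY.comp (measurable_id.prodMk measurable_const)).aestronglyMeasurable
  have hS (x : Space p N) : ∫⁻ ω, ‖Y ω x‖ₑ ^ 2 ∂P ≤ S := le_iSup (fun x => ∫⁻ ω, ‖Y ω x‖ₑ ^ 2 ∂P) x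
  have hk : Measurable fun z : Space p N × Space p N =>
      ENNReal.ofReal (smoothKernel Λ n (z.1 - z.2)) :=
    ((measurable_smoothKernel n).comp (measurable_fst.sub measurable_snd)).ennreal_ofReal
  have hm : Measurable fun w : Ω × (Space p N × Space p N) => ‖Y w.1 w.2.1‖ₑ * ‖Y w.1 w.2.2‖ₑ *
      ENNReal.ofReal (smoothKernel Λ n (w.2.1 - w.2.2)) :=
    ((hY.comp (measurable_fst.prodMk (measurable_fst.comp measurable_snd))).enorm.mul
      (hY.comp (measurable_fst.prodMk (measurable_snd.comp measurable_snd))).enorm).mul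
      (hk.comp measurable_snd)
  calc ∫⁻ ω, ∫⁻ ξ in Metric.closedBall 0 ((p : ℝ) ^ n), ‖fourierMeasure (Y ω) ν ξ‖ₑ ^ 2 ∂μ ∂P
      ≤ ∫⁻ ω, ∫⁻ z, ‖Y ω z.1‖ₑ * ‖Y ω z.2‖ₑ *
          ENNReal.ofReal (smoothKernel Λ n (z.1 - z.2)) ∂(ν.prod ν) ∂P :=
        lintegral_mono fun ω => setLIntegral_fourierMeasure_le hμ n
          (hY.comp (measurable_const.prodMk measurable_id)).aestronglyMeasurable
    _ = ∫⁻ z, ∫⁻ ω, ‖Y ω z.1‖ₑ * ‖Y ω z.2‖ₑ *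
          ENNReal.ofReal (smoothKernel Λ n (z.1 - z.2)) ∂P ∂(ν.prod ν) :=
        lintegral_lintegral_swap hm.aemeasurable
    _ ≤ ∫⁻ z, S * ENNReal.ofReal (smoothKernel Λ n (z.1 - z.2)) ∂(ν.prod ν) := by
        refine lintegral_mono fun z => ?_
        rw [lintegral_mul_const' _ _ (by simp)]
        gcongr
        exact lintegral_enorm_mul_enorm_le (hYx _) (hYx _) (hS _) (hS _)
    _ = S * ∫⁻ ξ in Metric.closedBall 0 ((p : ℝ) ^ n), ‖fourierPos ν ξ‖ₑ ^ 2 ∂μ := by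
        rw [lintegral_const_mul _ hk, setLIntegral_fourierPos hμ]

lemma lintegral_fourierMeasure_le {Ω : Type*} [MeasurableSpace Ω] (P : Measure Ω) [SFinite P]
    (hμ : IsSpectralMeasure Λ μ) {ν : Measure (Space p N)} [IsFiniteMeasure ν]
    {Y : Ω → Space p N → ℝ} (hY : Measurable (Function.uncurry Y)) :
    ∫⁻ ω, ∫⁻ ξ, ‖fourierMeasure (Y ω) ν ξ‖ₑ ^ 2 ∂μ ∂P ≤
      (⨆ x, ∫⁻ ω, ‖Y ω x‖ₑ ^ 2 ∂P) * ∫⁻ ξ, ‖fourierPos ν ξ‖ₑ ^ 2 ∂μ := by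
  have hm : Measurable fun z : Ω × Space p N => ‖fourierMeasure (Y z.1) ν z.2‖ₑ ^ 2 :=
    (measurable_fourierMeasure (Kernel.const Ω ν) hY).enorm.pow_const 2
  simp_rw [lintegral_eq_iSup_closedBall (μ := μ) fun ξ => ‖fourierMeasure _ ν ξ‖ₑ ^ 2]
  rw [lintegral_iSup (fun n => hm.lintegral_prod_right')
    fun m n h ω => lintegral_mono_set (closedBall_zpow_mono h)]
  refine iSup_le fun n => (setLIntegral_lintegral_fourierMeasure_le P hμ n hY).trans ?_
  gcongr
  exact Measure.restrict_le_self

end Positivity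

section OfFourier

variable {p : ℕ} [Fact p.Prime] {N : ℕ} {μ : Measure (Space p N)}

lemma measurable_of_edist {α X : Type*} [MeasurableSpace α] [PseudoEMetricSpace X]
    [SecondCountableTopology X] [MeasurableSpace X] [BorelSpace X] {f : α → X}
    (hf : ∀ x, Measurable fun a => edist (f a) x) : Measurable f := by
  refine measurable_of_isOpen fun s hs => ?_
  obtain ⟨T, hT, hTs⟩ := TopologicalSpace.isOpen_iUnion_countable
    (fun b : {b : X × ℝ≥0∞ // Metric.eball b.1 b.2 ⊆ s} => Metric.eball b.1.1 b.1.2)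
    (fun _ => Metric.isOpen_eball)
  have hsT : s = ⋃ i ∈ T, Metric.eball i.1.1 i.1.2 := by
    rw [hTs]
    refine subset_antisymm (fun x hx => ?_) (Set.iUnion_subset fun b => b.2)
    obtain ⟨ε, hε, h⟩ := EMetric.isOpen_iff.1 hs x hx
    exact Set.mem_iUnion.2 ⟨⟨(x, ε), h⟩, Metric.mem_eball_self hε⟩
  rw [hsT, Set.preimage_iUnion₂]
  exact MeasurableSet.biUnion hT fun i _ => measurableSet_lt (hf _) measurable_const

open Classical in
/-- The class of `h` in `L²(μ)`, with value `0` when `h` is not square integrable. -/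
def l2Class {α : Type*} [MeasurableSpace α] (μ : Measure α) (h : α → ℂ) : Lp ℂ 2 μ :=
  if H : MemLp h 2 μ then H.toLp else 0

lemma coeFn_l2Class {α : Type*} [MeasurableSpace α] {μ : Measure α} {h : α → ℂ}
    (H : MemLp h 2 μ) : l2Class μ h =ᵐ[μ] h := by
  rw [l2Class, dif_pos H]
  exact H.coeFn_toLp

lemma edist_l2Class {α : Type*} [MeasurableSpace α] {μ : Measure α} {h : α → ℂ}
    (H : MemLp h 2 μ) (g : Lp ℂ 2 μ) :
    edist (l2Class μ h) g = (∫⁻ ξ, ‖h ξ - g ξ‖ₑ ^ 2 ∂μ) ^ (1 / 2 : ℝ) := by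
  rw [Lp.edist_def, eLpNorm_congr_ae ((coeFn_l2Class H).sub (ae_eq_refl _)),
    eLpNorm_eq_lintegral_rpow_enorm_toReal (by simp) (by simp)]
  simp

lemma measurableSet_setOf_memLp_two {α β : Type*} [MeasurableSpace α] [MeasurableSpace β]
    {μ : Measure β} [SFinite μ] {h : α → β → ℂ} (hh : Measurable (Function.uncurry h)) :
    MeasurableSet {a | MemLp (h a) 2 μ} := by
  have hset : {a | MemLp (h a) 2 μ} = {a | ∫⁻ ξ, ‖h a ξ‖ₑ ^ 2 ∂μ < ⊤} := by
    ext a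
    exact memLp_two_iff_lintegral_enorm_sq_lt_top
      (hh.comp (measurable_const.prodMk measurable_id)).aestronglyMeasurable
  rw [hset]
  exact measurableSet_lt (hh.enorm.pow_const 2).lintegral_prod_right' measurable_const

lemma measurable_l2Class [SFinite μ] [MeasurableSpace (Lp ℂ 2 μ)] [BorelSpace (Lp ℂ 2 μ)]
    {α : Type*} [MeasurableSpace α] {h : α → Space p N → ℂ}
    (hh : Measurable (Function.uncurry h)) : Measurable fun a => l2Class μ (h a) := by
  classical
  have : Fact ((2 : ℝ≥0∞) ≠ ⊤) := ⟨by simp⟩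
  refine measurable_of_edist fun g => ?_
  have hedist : (fun a => edist (l2Class μ (h a)) g) = fun a => if MemLp (h a) 2 μ then
      (∫⁻ ξ, ‖h a ξ - g ξ‖ₑ ^ 2 ∂μ) ^ (1 / 2 : ℝ) else edist 0 g := by
    ext a
    split_ifs with H
    · exact edist_l2Class H g
    · rw [l2Class, dif_neg H]
  rw [hedist]
  refine Measurable.ite (measurableSet_setOf_memLp_two hh) (Measurable.pow_const ?_ _)
    measurable_const
  have hg : Measurable fun z : α × Space p N => g z.2 :=
    (Lp.stronglyMeasurable g).measurable.comp measurable_snd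
  exact ((hh.sub hg).enorm.pow_const 2).lintegral_prod_right'

lemma coeFn_ofFourier {h : Space p N → ℂ} (H : ∃ u : U μ, (u : Lp ℂ 2 μ) =ᵐ[μ] h) :
    (ofFourier μ h : Lp ℂ 2 μ) =ᵐ[μ] h := by
  rw [ofFourier, dif_pos H]
  exact H.choose_spec

lemma coe_ofFourier_eq_indicator (h : Space p N → ℂ) :
    (ofFourier μ h : Lp ℂ 2 μ) = (U μ : Set (Lp ℂ 2 μ)).indicator id (l2Class μ h) := by
  by_cases H : ∃ u : U μ, (u : Lp ℂ 2 μ) =ᵐ[μ] h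
  · have hae := coeFn_ofFourier H
    have hL2 : MemLp h 2 μ := (memLp_congr_ae hae).1 (Lp.memLp _)
    have hclass : l2Class μ h = ofFourier μ h := Lp.ext ((coeFn_l2Class hL2).trans hae.symm)
    rw [hclass, Set.indicator_of_mem (ofFourier μ h).2, id]
  · have hzero : l2Class μ h ∈ (U μ : Set (Lp ℂ 2 μ)) → l2Class μ h = 0 := fun hmem =>
      dif_neg fun hL2 => H ⟨⟨_, hmem⟩, coeFn_l2Class hL2⟩
    rw [ofFourier, dif_neg H, Set.indicator_apply_eq_zero.2 hzero, Submodule.coe_zero]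

lemma stronglyMeasurable_ofFourier [SFinite μ] {α : Type*} {mα : MeasurableSpace α}
    {h : α → Space p N → ℂ} (hh : Measurable (Function.uncurry h)) :
    StronglyMeasurable fun a => ofFourier μ (h a) := by
  have : Fact ((2 : ℝ≥0∞) ≠ ⊤) := ⟨by simp⟩
  rw [← Embedding.comp_stronglyMeasurable_iff Topology.IsEmbedding.subtypeVal]
  borelize ↥(Lp ℂ 2 μ)
  have hU : MeasurableSet (U μ : Set (Lp ℂ 2 μ)) :=
    (Submodule.isClosed_topologicalClosure _).measurableSet
  simp only [coe_ofFourier_eq_indicator]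
  exact ((measurable_id.indicator hU).comp (measurable_l2Class hh)).stronglyMeasurable

end OfFourier

section Noise

variable {p : ℕ} [Fact p.Prime] {N : ℕ}

lemma memLp_stepFunction {c : ℝ → ℝ} (hc : c ∈ StepFunction) : MemLp c 2 volume := by
  induction hc using Submodule.span_induction with
  | mem c hc =>
    obtain ⟨I, hI, hb, rfl⟩ := hc
    exact memLp_indicator_const _ hI.measurableSet _ (.inr hb.measure_lt_top.ne)
  | zero => exact MemLp.zero
  | add c d _ _ hc hd => exact hc.add hd
  | smul a c _ hc => exact hc.const_smul a

lemma noiseTest_apply_mem {φ : ℝ → Space p N → ℝ} (hφ : φ ∈ NoiseTest p N) (t : ℝ) :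
    φ t ∈ TestFunction p N ℝ := by
  induction hφ using Submodule.span_induction with
  | mem φ h =>
    obtain ⟨c, -, φ, hφ, rfl⟩ := h
    exact (TestFunction p N ℝ).smul_mem (c t) hφ
  | zero => exact (TestFunction p N ℝ).zero_mem
  | add φ ψ _ _ hφ hψ => exact (TestFunction p N ℝ).add_mem hφ hψ
  | smul a φ _ hφ => exact (TestFunction p N ℝ).smul_mem a hφ

/-- The spatial test function `φ(t, ·)`. -/
def slice (t : ℝ) : NoiseTest p N →ₗ[ℝ] TestFunction p N ℝ where
  toFun φ := ⟨φ.1 t, noiseTest_apply_mem φ.2 t⟩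
  map_add' _ _ := rfl
  map_smul' _ _ := rfl

variable (μ : Measure (Space p N)) [IsFiniteMeasureOnCompacts μ]

lemma memLp_toU_slice (φ : NoiseTest p N) :
    MemLp (fun t => toU μ (slice t φ)) 2 (volume.restrict (Set.Ioi (0 : ℝ))) := by
  obtain ⟨φ, hφ⟩ := φ
  induction hφ using Submodule.span_induction with
  | mem φ h =>
    obtain ⟨c, hc, φ, hφ, rfl⟩ := h
    exact ((ContinuousLinearMap.toSpanSingleton ℝ (toU μ ⟨φ, hφ⟩)).comp_memLp'
      ((memLp_stepFunction hc).restrict _)).ae_eq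
        (.of_forall fun t => (map_smul (toU μ) (c t) ⟨φ, hφ⟩).symm)
  | zero => exact MemLp.zero.ae_eq (.of_forall fun t => (map_zero (toU μ ∘ₗ slice t)).symm)
  | add φ ψ hφ hψ ihφ ihψ =>
    have hadd : (fun t => toU μ (slice t ⟨φ + ψ, (NoiseTest p N).add_mem hφ hψ⟩)) =
        (fun t => toU μ (slice t ⟨φ, hφ⟩)) + fun t => toU μ (slice t ⟨ψ, hψ⟩) := by
      ext1 t
      exact map_add (toU μ ∘ₗ slice t) ⟨φ, hφ⟩ ⟨ψ, hψ⟩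
    rw [hadd]
    exact ihφ.add ihψ
  | smul a φ hφ ih =>
    have hsmul : (fun t => toU μ (slice t ⟨a • φ, (NoiseTest p N).smul_mem a hφ⟩)) =
        a • fun t => toU μ (slice t ⟨φ, hφ⟩) := by
      ext1 t
      exact map_smul (toU μ ∘ₗ slice t) a ⟨φ, hφ⟩
    rw [hsmul]
    exact ih.const_smul a

lemma setIntegral_indicator_Icc_mul_indicator_Icc {s t : ℝ} (hs : 0 ≤ s) (ht : 0 ≤ t) :
    ∫ r in Set.Ioi (0 : ℝ), (Set.Icc (0 : ℝ) s).indicator (fun _ => (1 : ℝ)) r *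
      (Set.Icc (0 : ℝ) t).indicator (fun _ => (1 : ℝ)) r = min s t := by
  have hmul (r : ℝ) : (Set.Icc (0 : ℝ) s).indicator (fun _ => (1 : ℝ)) r *
      (Set.Icc (0 : ℝ) t).indicator (fun _ => (1 : ℝ)) r =
      (Set.Icc (0 : ℝ) (min s t)).indicator (fun _ => (1 : ℝ)) r := by
    rw [← Set.inter_indicator_mul, Set.Icc_inter_Icc, max_self]
    simp only [mul_one]
  have hinter : Set.Icc 0 (min s t) ∩ Set.Ioi 0 = Set.Ioc 0 (min s t) := by
    ext r
    simp only [Set.mem_inter_iff, Set.mem_Icc, Set.mem_Ioi, Set.mem_Ioc]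
    exact ⟨fun h => ⟨h.2, h.1.2⟩, fun h => ⟨⟨h.1.le, h.2⟩, h.1⟩⟩
  simp_rw [hmul]
  rw [integral_indicator_const _ measurableSet_Icc, smul_eq_mul, mul_one, measureReal_def,
    Measure.restrict_apply measurableSet_Icc, hinter, Real.volume_Ioc, sub_zero,
    ENNReal.toReal_ofReal (le_min hs ht)]

lemma integral_inner_cylTest {s t : ℝ} (hs : 0 ≤ s) (ht : 0 ≤ t) (φ ψ : TestFunction p N ℝ) :
    ∫ r in Set.Ioi (0 : ℝ), inner ℝ (toU μ (slice r (cylTest s φ)))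
      (toU μ (slice r (cylTest t ψ))) = min s t * inner ℝ (toU μ φ) (toU μ ψ) := by
  have hslice (s r : ℝ) (φ : TestFunction p N ℝ) : toU μ (slice r (cylTest s φ)) =
      (Set.Icc (0 : ℝ) s).indicator (fun _ => (1 : ℝ)) r • toU μ φ :=
    map_smul (toU μ) _ φ
  rw [← setIntegral_indicator_Icc_mul_indicator_Icc hs ht, ← integral_mul_const]
  congr 1 with r
  rw [hslice, hslice]
  exact real_inner_smul_smul (H := U μ) _ _ _ _

variable {μ} {Ω : Type*} [MeasurableSpace Ω] {P : Measure Ω}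
  {Λ : Measure (Space p N)} {W : NoiseTest p N → Ω → ℝ}

lemma IsGaussianNoise.memLp (hW : IsGaussianNoise Λ P W) (φ : NoiseTest p N) :
    MemLp (W φ) 2 P := by
  obtain ⟨v, hv⟩ := hW.gaussian φ
  exact hv.hasGaussianLaw.memLp_two

lemma IsGaussianNoise.inner_toLp (hW : IsGaussianNoise Λ P W) (hμ : IsSpectralMeasure Λ μ)
    (φ ψ : NoiseTest p N) :
    inner ℝ (hW.memLp φ).toLp (hW.memLp ψ).toLp =
      ∫ t in Set.Ioi (0 : ℝ), inner ℝ (toU μ (slice t φ)) (toU μ (slice t ψ)) := by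
  have hcov : ∫ ω, W φ ω * W ψ ω ∂P = ∫ t in Set.Ioi (0 : ℝ), ∫ z, ∫ x, (slice t φ).1 x *
      (slice t ψ).1 (x - z) ∂(haar p N) ∂Λ := hW.covariance φ ψ
  simp_rw [← integral_correlation hμ]
  rw [inner_toLp_eq_integral_mul, hcov]

/-- The noise as a linear map to `L²(Ω)`. -/
def noiseL2 (hW : IsGaussianNoise Λ P W) (hμ : IsSpectralMeasure Λ μ) :
    NoiseTest p N →ₗ[ℝ] Lp ℝ 2 P :=
  IsLinearMap.mk' (fun φ => (hW.memLp φ).toLp)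
    (isLinearMap_of_inner_eq_integral (H := U μ) (fun t => toU μ ∘ₗ slice t)
      (memLp_toU_slice μ) (hW.inner_toLp hμ))

lemma hasLaw_noiseL2 (hW : IsGaussianNoise Λ P W) (hμ : IsSpectralMeasure Λ μ)
    (φ : NoiseTest p N) : HasLaw (noiseL2 hW hμ φ) (gaussianReal 0 (‖noiseL2 hW hμ φ‖₊ ^ 2)) P := by
  obtain ⟨v, hv⟩ := hW.gaussian φ
  have := hv.hasGaussianLaw.isProbabilityMeasure
  have hlaw := hv.congr (show noiseL2 hW hμ φ =ᵐ[P] W φ from (hW.memLp φ).coeFn_toLp)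
  convert hlaw using 2
  apply NNReal.coe_injective
  rw [← variance_id_gaussianReal (μ := 0) (v := v), ← hlaw.variance_eq,
    variance_eq_sub (Lp.memLp _), hlaw.integral_eq, integral_id_gaussianReal]
  push_cast
  rw [← real_inner_self_eq_norm_sq, L2.inner_def]
  simp [pow_two]

lemma isLinearMap_cylTest (t : ℝ) : IsLinearMap ℝ (cylTest (p := p) (N := N) t) where
  map_add _ _ := Subtype.ext (funext fun _ => funext fun _ => mul_add _ _ _)
  map_smul _ _ := Subtype.ext (funext fun _ => funext fun _ => mul_left_comm _ _ _)

lemma exists_isWienerExtension (hW : IsGaussianNoise Λ P W) (hμ : IsSpectralMeasure Λ μ) {t : ℝ}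
    (ht : 0 ≤ t) : ∃ L, IsWienerExtension μ P W t L := by
  let f : TestFunction p N ℝ →ₗ[ℝ] Lp ℝ 2 P := noiseL2 hW hμ ∘ₗ (isLinearMap_cylTest t).mk'
  have hf (φ : TestFunction p N ℝ) : ‖f φ‖ ≤ √t * ‖toU μ φ‖ := by
    have hinner : inner ℝ (f φ) (f φ) = t * inner ℝ (toU μ φ) (toU μ φ) := by
      have h := integral_inner_cylTest μ ht ht φ φ
      rw [min_self] at h
      exact (hW.inner_toLp hμ _ _).trans h
    refine le_of_eq ?_
    rwa [← sq_eq_sq₀ (norm_nonneg _) (by positivity), mul_pow, Real.sq_sqrt ht,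
      ← real_inner_self_eq_norm_sq, ← real_inner_self_eq_norm_sq]
  refine ⟨f.extendOfNorm (toU μ), fun φ u hu => ?_⟩
  rw [eq_toU hu, LinearMap.extendOfNorm_eq (denseRange_toU μ) ⟨_, hf⟩]
  exact (hW.memLp _).coeFn_toLp

lemma isWienerExtension_wiener (hW : IsGaussianNoise Λ P W) (hμ : IsSpectralMeasure Λ μ) {t : ℝ}
    (ht : 0 ≤ t) : IsWienerExtension μ P W t (wiener μ P W t) := by
  have H := exists_isWienerExtension hW hμ ht
  rw [wiener, dif_pos H]
  exact H.choose_spec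

lemma wiener_toU (hW : IsGaussianNoise Λ P W) (hμ : IsSpectralMeasure Λ μ) {t : ℝ} (ht : 0 ≤ t)
    (φ : TestFunction p N ℝ) : wiener μ P W t (toU μ φ) = noiseL2 hW hμ (cylTest t φ) :=
  Lp.ext ((isWienerExtension_wiener hW hμ ht φ _ (coeFn_toU μ φ)).trans
    (hW.memLp _).coeFn_toLp.symm)

lemma inner_wiener (hW : IsGaussianNoise Λ P W) (hμ : IsSpectralMeasure Λ μ) {s t : ℝ}
    (hs : 0 ≤ s) (ht : 0 ≤ t) (h h' : U μ) :
    inner ℝ (wiener μ P W s h) (wiener μ P W t h') = min s t * inner ℝ h h' := by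
  refine (denseRange_toU μ).induction_on₂ (isClosed_eq (by fun_prop) (by fun_prop))
    (fun φ ψ => ?_) h h'
  rw [wiener_toU hW hμ hs, wiener_toU hW hμ ht, ← integral_inner_cylTest μ hs ht]
  exact hW.inner_toLp hμ _ _

/-- The closed subspace of `L²(Ω)` generated by the noise. -/
def gaussianSpace (hW : IsGaussianNoise Λ P W) (hμ : IsSpectralMeasure Λ μ) :
    Submodule ℝ (Lp ℝ 2 P) := (LinearMap.range (noiseL2 hW hμ)).topologicalClosure

lemma hasLaw_of_mem_gaussianSpace [IsProbabilityMeasure P] (hW : IsGaussianNoise Λ P W)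
    (hμ : IsSpectralMeasure Λ μ) {Z : Lp ℝ 2 P} (hZ : Z ∈ gaussianSpace hW hμ) :
    HasLaw Z (gaussianReal 0 (‖Z‖₊ ^ 2)) P := by
  rw [gaussianSpace, ← SetLike.mem_coe, Submodule.topologicalClosure_coe] at hZ
  refine closure_minimal ?_ isClosed_setOf_hasLaw_gaussianReal hZ
  rintro _ ⟨φ, rfl⟩
  exact hasLaw_noiseL2 hW hμ φ

lemma wiener_mem_gaussianSpace (hW : IsGaussianNoise Λ P W) (hμ : IsSpectralMeasure Λ μ) {t : ℝ}
    (ht : 0 ≤ t) (h : U μ) : wiener μ P W t h ∈ gaussianSpace hW hμ := by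
  refine (denseRange_toU μ).induction_on (p := fun h => wiener μ P W t h ∈ gaussianSpace hW hμ) h
    ((Submodule.isClosed_topologicalClosure _).preimage (wiener μ P W t).continuous) fun φ => ?_
  rw [wiener_toU hW hμ ht]
  exact Submodule.le_topologicalClosure _ ⟨_, rfl⟩

end Noise

section Increments

variable {p : ℕ} [Fact p.Prime] {N : ℕ} {μ : Measure (Space p N)}
  {Ω : Type*} [mΩ : MeasurableSpace Ω] {P : Measure Ω} {W : NoiseTest p N → Ω → ℝ}

lemma sigmaField_mono {s t : ℝ} (h : s ≤ t) : sigmaField μ P W s ≤ sigmaField μ P W t :=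
  sup_le_sup_right (biSup_mono fun _ hr => ⟨hr.1, hr.2.trans h⟩) _

lemma sigmaField_le [P.IsComplete] (t : ℝ) : sigmaField μ P W t ≤ mΩ := by
  refine sup_le (iSup₂_le fun s _ => iSup_le fun h => ?_)
    (MeasurableSpace.generateFrom_le fun A hA => Measure.IsComplete.out' A hA)
  rw [← BorelSpace.measurable_eq (α := ℝ)]
  exact (Lp.stronglyMeasurable _).measurable.comap_le

lemma measurable_wiener {s t : ℝ} (hs : 0 ≤ s) (hst : s ≤ t) (h : U μ) :
    Measurable[sigmaField μ P W t] (wiener μ P W s h) := by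
  rw [measurable_iff_comap_le, BorelSpace.measurable_eq (α := ℝ)]
  exact (le_iSup (fun h : U μ => MeasurableSpace.comap (wiener μ P W s h) (borel ℝ)) h).trans
    ((le_iSup₂ (f := fun s (_ : s ∈ Set.Icc (0 : ℝ) t) =>
      ⨆ h : U μ, MeasurableSpace.comap (wiener μ P W s h) (borel ℝ)) s ⟨hs, hst⟩).trans
      le_sup_left)

variable (μ P W) in
/-- The increment `W_b(h) - W_a(h)`, as a function rather than a class in `L²(Ω)`, so that it is
measurable for the filtration. -/
def increment (a b : ℝ) (h : U μ) (ω : Ω) : ℝ := wiener μ P W b h ω - wiener μ P W a h ω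

lemma increment_add_increment (a b c : ℝ) (h : U μ) (ω : Ω) :
    increment μ P W a b h ω + increment μ P W b c h ω = increment μ P W a c h ω := by
  unfold increment
  ring

lemma coeFn_wiener_sub_wiener (a b : ℝ) (h : U μ) :
    (wiener μ P W b h - wiener μ P W a h : Lp ℝ 2 P) =ᵐ[P] increment μ P W a b h :=
  Lp.coeFn_sub _ _

lemma memLp_increment (a b : ℝ) (h : U μ) : MemLp (increment μ P W a b h) 2 P :=
  (Lp.memLp _).sub (Lp.memLp _)

lemma measurable_increment {a b t : ℝ} (ha : 0 ≤ a) (hab : a ≤ b) (hb : b ≤ t) (h : U μ) :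
    Measurable[sigmaField μ P W t] (increment μ P W a b h) :=
  (measurable_wiener (ha.trans hab) hb h).sub (measurable_wiener ha (hab.trans hb) h)

variable (μ P W) in
/-- The `σ`-field generated by the increments of the Wiener process after time `a`. -/
@[reducible]
def incrementField (a : ℝ) : MeasurableSpace Ω :=
  ⨆ i : Set.Ici a × U μ, MeasurableSpace.comap (increment μ P W a i.1 i.2) (borel ℝ)

lemma incrementField_le (a : ℝ) : incrementField μ P W a ≤ mΩ := by
  refine iSup_le fun i => ?_
  rw [← BorelSpace.measurable_eq (α := ℝ)]
  exact ((Lp.stronglyMeasurable _).measurable.sub (Lp.stronglyMeasurable _).measurable).comap_le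

lemma measurable_incrementField {a b : ℝ} (hab : a ≤ b) (h : U μ) :
    Measurable[incrementField μ P W a] (increment μ P W a b h) := by
  rw [measurable_iff_comap_le, BorelSpace.measurable_eq (α := ℝ)]
  exact le_iSup (fun i : Set.Ici a × U μ =>
    MeasurableSpace.comap (increment μ P W a i.1 i.2) (borel ℝ)) (⟨b, hab⟩, h)

variable [IsFiniteMeasureOnCompacts μ] {Λ : Measure (Space p N)}

lemma integral_increment_mul_increment (hW : IsGaussianNoise Λ P W) (hμ : IsSpectralMeasure Λ μ)
    {a b b' : ℝ} (ha : 0 ≤ a) (hab : a ≤ b) (hab' : a ≤ b') (h h' : U μ) :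
    ∫ ω, increment μ P W a b h ω * increment μ P W a b' h' ω ∂P =
      (min b b' - a) * inner ℝ h h' := by
  have hinner : inner ℝ (wiener μ P W b h - wiener μ P W a h)
      (wiener μ P W b' h' - wiener μ P W a h') = (min b b' - a) * inner ℝ h h' := by
    have hb := ha.trans hab
    have hb' := ha.trans hab'
    rw [inner_sub_left, inner_sub_right, inner_sub_right, inner_wiener hW hμ hb hb',
      inner_wiener hW hμ hb ha, inner_wiener hW hμ ha hb', inner_wiener hW hμ ha ha,
      min_eq_right hab, min_eq_left hab', min_self]
    ring
  rw [← hinner, L2.inner_def]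
  refine integral_congr_ae ?_
  filter_upwards [coeFn_wiener_sub_wiener (P := P) (W := W) a b h,
    coeFn_wiener_sub_wiener (P := P) (W := W) a b' h'] with ω hω hω'
  rw [hω, hω']
  exact mul_comm _ _

variable [IsProbabilityMeasure P]

lemma integral_increment (hW : IsGaussianNoise Λ P W) (hμ : IsSpectralMeasure Λ μ) {a b : ℝ}
    (ha : 0 ≤ a) (hab : a ≤ b) (h : U μ) : ∫ ω, increment μ P W a b h ω ∂P = 0 := by
  have hmem := Submodule.sub_mem _ (wiener_mem_gaussianSpace hW hμ (ha.trans hab) h)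
    (wiener_mem_gaussianSpace hW hμ ha h)
  rw [← integral_congr_ae (coeFn_wiener_sub_wiener a b h),
    (hasLaw_of_mem_gaussianSpace hW hμ hmem).integral_eq, integral_id_gaussianReal]

lemma indep_sigmaField_incrementField (hW : IsGaussianNoise Λ P W) (hμ : IsSpectralMeasure Λ μ)
    {a : ℝ} (ha : 0 ≤ a) : Indep (sigmaField μ P W a) (incrementField μ P W a) P := by
  have hmem {s : ℝ} (hs : 0 ≤ s) (h : U μ) := wiener_mem_gaussianSpace hW hμ hs h
  have hindep := indep_iSup_comap_of_inner_eq_zero (K := gaussianSpace hW hμ)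
    (fun Z hZ => hasLaw_of_mem_gaussianSpace hW hμ hZ)
    (x := fun i : Set.Icc (0 : ℝ) a × U μ => ⟨wiener μ P W i.1 i.2, hmem i.1.2.1 i.2⟩)
    (y := fun i : Set.Ici a × U μ => ⟨wiener μ P W i.1 i.2 - wiener μ P W a i.2,
      Submodule.sub_mem _ (hmem (ha.trans i.1.2) i.2) (hmem ha i.2)⟩)
    (fun i => ae_eq_refl _) (fun i => coeFn_wiener_sub_wiener a i.1 i.2) fun i j => by
      rw [Submodule.coe_inner, inner_sub_right, inner_wiener hW hμ i.1.2.1 (ha.trans j.1.2),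
        inner_wiener hW hμ i.1.2.1 ha, min_eq_left (i.1.2.2.trans j.1.2), min_eq_left i.1.2.2,
        sub_self]
  rw [iSup_prod, iSup_subtype] at hindep
  exact indep_sup_null hindep

variable [P.IsComplete]

lemma integral_mul_increment (hW : IsGaussianNoise Λ P W) (hμ : IsSpectralMeasure Λ μ) {a b : ℝ}
    (ha : 0 ≤ a) (hab : a ≤ b) (h : U μ) {Z : Ω → ℝ} (hZ : Measurable[sigmaField μ P W a] Z) :
    ∫ ω, Z ω * increment μ P W a b h ω ∂P = 0 := by
  rw [integral_mul_eq_of_indep (indep_sigmaField_incrementField hW hμ ha) (sigmaField_le a)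
    (incrementField_le a) hZ (measurable_incrementField hab h), integral_increment hW hμ ha hab,
    mul_zero]

lemma integral_mul_increment_mul_increment (hW : IsGaussianNoise Λ P W)
    (hμ : IsSpectralMeasure Λ μ) {a b b' : ℝ} (ha : 0 ≤ a) (hab : a ≤ b) (hab' : a ≤ b')
    (h h' : U μ) {Z : Ω → ℝ} (hZ : Measurable[sigmaField μ P W a] Z) :
    ∫ ω, Z ω * (increment μ P W a b h ω * increment μ P W a b' h' ω) ∂P =
      (∫ ω, Z ω ∂P) * ((min b b' - a) * inner ℝ h h') := by
  rw [← integral_increment_mul_increment hW hμ ha hab hab']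
  exact integral_mul_eq_of_indep (indep_sigmaField_incrementField hW hμ ha) (sigmaField_le a)
    (incrementField_le a) hZ
    ((measurable_incrementField hab h).mul (measurable_incrementField hab' h'))

/-- The length of `(a, b] ∩ (a', b']`. -/
def overlap (a b a' b' : ℝ) : ℝ := max 0 (min b b' - max a a')

lemma overlap_comm (a b a' b' : ℝ) : overlap a b a' b' = overlap a' b' a b := by
  rw [overlap, min_comm, max_comm a, overlap]

lemma integral_increment_pair_of_start_le (hW : IsGaussianNoise Λ P W)
    (hμ : IsSpectralMeasure Λ μ) {a b a' b' : ℝ} (ha : 0 ≤ a) (hab : a ≤ b) (haa : a ≤ a')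
    (hab' : a' ≤ b') (h h' : U μ) {X X' : Ω → ℝ} (hX : Measurable[sigmaField μ P W a] X)
    (hX' : Measurable[sigmaField μ P W a'] X') (hb : ∃ C : ℝ, ∀ ω, |X ω| ≤ C)
    (hb' : ∃ C : ℝ, ∀ ω, |X' ω| ≤ C) :
    ∫ ω, (X ω * increment μ P W a b h ω) * (X' ω * increment μ P W a' b' h' ω) ∂P =
      (∫ ω, X ω * X' ω ∂P) * (overlap a b a' b' * inner ℝ h h') := by
  have ha' := ha.trans haa
  have hXa' := hX.mono (sigmaField_mono haa) le_rfl
  have hdisjoint {c : ℝ} (hac : a ≤ c) (hca : c ≤ a') :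
      ∫ ω, (X ω * increment μ P W a c h ω) * (X' ω * increment μ P W a' b' h' ω) ∂P = 0 := by
    simp_rw [← mul_assoc]
    exact integral_mul_increment hW hμ ha' hab' h'
      ((hXa'.mul (measurable_increment ha hac hca h)).mul hX')
  rcases le_or_gt b a' with hba | hba
  · rw [hdisjoint hab hba, overlap, max_eq_left, zero_mul, mul_zero]
    exact sub_nonpos.2 ((min_le_left b b').trans (hba.trans (le_max_right a a')))
  · have hint (c d : ℝ) : Integrable (fun ω =>
        (X ω * increment μ P W c d h ω) * (X' ω * increment μ P W a' b' h' ω)) P :=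
      (memLp_bdd_mul (hX.mono (sigmaField_le a) le_rfl) hb (memLp_increment c d h)).integrable_mul
        (memLp_bdd_mul (hX'.mono (sigmaField_le a') le_rfl) hb' (memLp_increment a' b' h'))
    simp_rw [← increment_add_increment a a' b h, mul_add, add_mul]
    rw [integral_add (hint a a') (hint a' b), hdisjoint haa le_rfl, zero_add, overlap,
      max_eq_right haa, max_eq_right (sub_nonneg.2 (le_min hba.le hab')),
      ← integral_mul_increment_mul_increment hW hμ ha' hba.le hab' h h'
        (Z := fun ω => X ω * X' ω) (hXa'.mul hX')]
    congr 1 with ω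
    exact mul_mul_mul_comm _ _ _ _

lemma integral_increment_pair (hW : IsGaussianNoise Λ P W)
    (hμ : IsSpectralMeasure Λ μ) {a b a' b' : ℝ} (ha : 0 ≤ a) (hab : a ≤ b) (ha' : 0 ≤ a')
    (hab' : a' ≤ b') (h h' : U μ) {X X' : Ω → ℝ} (hX : Measurable[sigmaField μ P W a] X)
    (hX' : Measurable[sigmaField μ P W a'] X') (hb : ∃ C : ℝ, ∀ ω, |X ω| ≤ C)
    (hb' : ∃ C : ℝ, ∀ ω, |X' ω| ≤ C) :
    ∫ ω, (X ω * increment μ P W a b h ω) * (X' ω * increment μ P W a' b' h' ω) ∂P =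
      (∫ ω, X ω * X' ω ∂P) * (overlap a b a' b' * inner ℝ h h') := by
  rcases le_total a a' with haa | haa
  · exact integral_increment_pair_of_start_le hW hμ ha hab haa hab' h h' hX hX' hb hb'
  · have hswap := integral_increment_pair_of_start_le hW hμ ha' hab' haa hab h' h hX' hX hb' hb
    rw [real_inner_comm, overlap_comm]
    simpa only [mul_comm] using hswap

end Increments

section Lebesgue

variable {T : ℝ}

lemma lebesgue_preimage (s : Set ℝ) :
    lebesgue T (Subtype.val ⁻¹' s) = volume (s ∩ Set.Icc 0 T) := by
  rw [lebesgue, comap_subtype_coe_apply measurableSet_Icc, Subtype.image_preimage_coe,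
    Set.inter_comm]

instance instIsFiniteMeasureLebesgue : IsFiniteMeasure (lebesgue T) :=
  ⟨by rw [← Set.preimage_univ, lebesgue_preimage, Set.univ_inter]; exact measure_Icc_lt_top⟩

lemma integral_indicator_Ioc_mul_indicator_Ioc {a b a' b' : ℝ} (ha : 0 ≤ a) (hb : b ≤ T) :
    ∫ t : Time T, (Set.Ioc a b).indicator (fun _ => (1 : ℝ)) (t : ℝ) *
      (Set.Ioc a' b').indicator (fun _ => (1 : ℝ)) (t : ℝ) ∂(lebesgue T) = overlap a b a' b' := by
  have hmul (t : Time T) : (Set.Ioc a b).indicator (fun _ => (1 : ℝ)) (t : ℝ) *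
      (Set.Ioc a' b').indicator (fun _ => (1 : ℝ)) (t : ℝ) =
      (Subtype.val ⁻¹' (Set.Ioc a b ∩ Set.Ioc a' b')).indicator (fun _ : Time T => (1 : ℝ)) t := by
    rw [← Set.inter_indicator_mul]
    simp only [mul_one]
    rfl
  have hsub : Set.Ioc a b ∩ Set.Ioc a' b' ⊆ Set.Icc 0 T :=
    fun t ht => ⟨ha.trans ht.1.1.le, ht.1.2.trans hb⟩
  simp_rw [hmul]
  rw [integral_indicator_const _
      (measurable_subtype_coe (measurableSet_Ioc.inter measurableSet_Ioc)), smul_eq_mul, mul_one,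
    measureReal_def, lebesgue_preimage, Set.inter_eq_left.2 hsub, Set.Ioc_inter_Ioc,
    Real.volume_Ioc, ENNReal.toReal_ofReal', max_comm]
  rfl

end Lebesgue

section SimpleProcesses

variable {p : ℕ} [Fact p.Prime] {N : ℕ} {μ : Measure (Space p N)}
  {Ω : Type*} [MeasurableSpace Ω] {P : Measure Ω} {W : NoiseTest p N → Ω → ℝ} {T : ℝ}

namespace SimpleProcess

lemma eval_eq (S : SimpleProcess μ P W T) (q : Time T × Ω) :
    S.eval q = ∑ k, (Set.Ioc (S.a k) (S.b k)).indicator (fun _ => (1 : ℝ)) (q.1 : ℝ) *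
      S.X k q.2 :=
  Finset.sum_congr rfl fun k _ => by
    by_cases hk : (q.1 : ℝ) ∈ Set.Ioc (S.a k) (S.b k) <;> simp [hk, -Set.mem_Ioc]

variable [P.IsComplete]

lemma measurable_X (S : SimpleProcess μ P W T) (k : Fin S.n) : Measurable (S.X k) :=
  (S.meas k).mono (sigmaField_le _) le_rfl

lemma memLp_mul_increment (S : SimpleProcess μ P W T) (h : U μ) (k : Fin S.n) :
    MemLp (fun ω => S.X k ω * increment μ P W (S.a k) (S.b k) h ω) 2 P :=
  memLp_bdd_mul (S.measurable_X k) (S.bdd k) (memLp_increment _ _ h)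

lemma memLp_integral (S : SimpleProcess μ P W T) (h : U μ) : MemLp (S.integral h) 2 P :=
  memLp_finsetSum Finset.univ fun k _ => S.memLp_mul_increment h k

variable [IsProbabilityMeasure P]

lemma memLp_indicator_mul (S : SimpleProcess μ P W T) (k : Fin S.n) :
    MemLp (fun q : Time T × Ω => (Set.Ioc (S.a k) (S.b k)).indicator (fun _ => (1 : ℝ)) (q.1 : ℝ) *
      S.X k q.2) 2 ((lebesgue T).prod P) := by
  have hI : Measurable fun q : Time T × Ω =>
      (Set.Ioc (S.a k) (S.b k)).indicator (fun _ => (1 : ℝ)) (q.1 : ℝ) :=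
    (measurable_const.indicator measurableSet_Ioc).comp (measurable_subtype_coe.comp measurable_fst)
  obtain ⟨C, hC⟩ := S.bdd k
  exact memLp_bdd_mul hI
    ⟨1, fun q => by simpa using norm_indicator_le_norm_self (fun _ => (1 : ℝ)) _⟩
    (MemLp.of_bound ((S.measurable_X k).comp measurable_snd).aestronglyMeasurable C
      (.of_forall fun q => hC q.2))

lemma memLp_eval (S : SimpleProcess μ P W T) : MemLp S.eval 2 ((lebesgue T).prod P) := by
  rw [funext S.eval_eq]
  exact memLp_finsetSum Finset.univ fun k _ => S.memLp_indicator_mul k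

lemma integral_eval_mul_eval (S S' : SimpleProcess μ P W T) :
    ∫ q, S.eval q * S'.eval q ∂((lebesgue T).prod P) = ∑ k, ∑ k',
      overlap (S.a k) (S.b k) (S'.a k') (S'.b k') * ∫ ω, S.X k ω * S'.X k' ω ∂P := by
  simp_rw [S.eval_eq, S'.eval_eq]
  rw [integral_sum_mul_sum S.memLp_indicator_mul S'.memLp_indicator_mul]
  refine Finset.sum_congr rfl fun k _ => Finset.sum_congr rfl fun k' _ => ?_
  rw [← integral_indicator_Ioc_mul_indicator_Ioc (S.nonneg k) (S.le k), ← integral_prod_mul]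
  congr 1 with q
  exact mul_mul_mul_comm _ _ _ _

variable [IsFiniteMeasureOnCompacts μ] {Λ : Measure (Space p N)}

lemma integral_integral_mul_integral (hW : IsGaussianNoise Λ P W) (hμ : IsSpectralMeasure Λ μ)
    (S S' : SimpleProcess μ P W T) (h h' : U μ) :
    ∫ ω, S.integral h ω * S'.integral h' ω ∂P =
      inner ℝ h h' * ∫ q, S.eval q * S'.eval q ∂((lebesgue T).prod P) := by
  rw [S.integral_eval_mul_eval S', Finset.mul_sum]
  refine (integral_sum_mul_sum (S.memLp_mul_increment h) (S'.memLp_mul_increment h')).trans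
    (Finset.sum_congr rfl fun k _ => ?_)
  rw [Finset.mul_sum]
  refine Finset.sum_congr rfl fun k' _ => ?_
  rw [integral_increment_pair hW hμ (S.nonneg k) (S.lt k).le (S'.nonneg k') (S'.lt k').le h h'
    (S.meas k) (S'.meas k') (S.bdd k) (S'.bdd k')]
  ring

lemma inner_toLp_integral (hW : IsGaussianNoise Λ P W) (hμ : IsSpectralMeasure Λ μ)
    (S S' : SimpleProcess μ P W T) (h h' : U μ) :
    inner ℝ ((S.memLp_integral h).toLp (S.integral h))
        ((S'.memLp_integral h').toLp (S'.integral h')) =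
      inner ℝ h h' * inner ℝ (S.memLp_eval.toLp S.eval) (S'.memLp_eval.toLp S'.eval) := by
  simp_rw [inner_toLp_eq_integral_mul]
  exact S.integral_integral_mul_integral hW hμ S' _ _

end SimpleProcess

end SimpleProcesses

section Density

variable {p : ℕ} [Fact p.Prime] {N : ℕ} {μ : Measure (Space p N)}
  {Ω : Type*} [MeasurableSpace Ω] {P : Measure Ω} {W : NoiseTest p N → Ω → ℝ} {T : ℝ}

variable (μ P W T) in
/-- The rectangles `(s, t] × A` that generate the predictable `σ`-field. -/
def rectangles : Set (Set (Time T × Ω)) :=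
  {S | ∃ (s t : ℝ) (A : Set Ω), 0 ≤ s ∧ s < t ∧ t ≤ T ∧
    MeasurableSet[sigmaField μ P W s] A ∧ S = {q | s < q.1 ∧ (q.1 : ℝ) ≤ t ∧ q.2 ∈ A}}

lemma measurableSet_predictable_of_mem_rectangles {s : Set (Time T × Ω)}
    (hs : s ∈ rectangles μ P W T) : MeasurableSet[predictable μ P W T] s :=
  MeasurableSpace.measurableSet_generateFrom hs

lemma isPiSystem_rectangles : IsPiSystem (rectangles μ P W T) := by
  rintro _ ⟨s, t, A, hs, -, ht, hA, rfl⟩ _ ⟨s', t', A', -, -, -, hA', rfl⟩ ⟨q, hq, hq'⟩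
  refine ⟨max s s', min t t', A ∩ A', le_max_of_le_left hs, ?_, min_le_of_left_le ht, ?_, ?_⟩
  · exact (max_lt hq.1 hq'.1).trans_le (le_min hq.2.1 hq'.2.1)
  · exact MeasurableSet.inter (sigmaField_mono (le_max_left _ _) _ hA)
      (sigmaField_mono (le_max_right _ _) _ hA')
  · ext q
    simp only [Set.mem_inter_iff, Set.mem_ofPred_eq, max_lt_iff, le_min_iff]
    tauto

lemma predictable_le [P.IsComplete] :
    predictable μ P W T ≤ (inferInstance : MeasurableSpace (Time T × Ω)) := by
  refine MeasurableSpace.generateFrom_le ?_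
  rintro _ ⟨s, t, A, -, -, -, hA, rfl⟩
  have hrect : {q : Time T × Ω | s < q.1 ∧ (q.1 : ℝ) ≤ t ∧ q.2 ∈ A} =
      (Subtype.val ⁻¹' Set.Ioc s t) ×ˢ A := Set.ext fun _ => and_assoc.symm
  rw [hrect]
  exact (measurable_subtype_coe measurableSet_Ioc).prod (sigmaField_le s A hA)

lemma exists_rectangle_ae_eq_univ [SFinite P] (hT : 0 < T) :
    ∃ s ∈ rectangles μ P W T, s =ᵐ[(lebesgue T).prod P] Set.univ := by
  refine ⟨_, ⟨0, T, Set.univ, le_rfl, hT, le_rfl, MeasurableSet.univ, rfl⟩, ?_⟩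
  have hcompl : {q : Time T × Ω | 0 < (q.1 : ℝ) ∧ (q.1 : ℝ) ≤ T ∧ q.2 ∈ Set.univ}ᶜ =
      (Subtype.val ⁻¹' {(0 : ℝ)}) ×ˢ Set.univ := by
    ext ⟨t, ω⟩
    simp [t.2.1.ge_iff_eq', t.2.2]
  rw [ae_eq_univ, hcompl, Measure.prod_prod, lebesgue_preimage,
    measure_mono_null Set.inter_subset_left Real.volume_singleton, zero_mul]

namespace SimpleProcess

/-- The zero simple process, with no term. -/
def zero : SimpleProcess μ P W T where
  n := 0
  a := Fin.elim0
  b := Fin.elim0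
  X k := k.elim0
  nonneg k := k.elim0
  lt k := k.elim0
  le k := k.elim0
  meas k := k.elim0
  bdd k := k.elim0

lemma eval_zero : (zero : SimpleProcess μ P W T).eval = 0 := funext fun _ => Fin.sum_univ_zero _

/-- The sum of two simple processes, obtained by concatenating their terms. -/
def add (S S' : SimpleProcess μ P W T) : SimpleProcess μ P W T where
  n := S.n + S'.n
  a := Fin.append S.a S'.a
  b := Fin.append S.b S'.b
  X := Fin.append S.X S'.X
  nonneg := Fin.addCases (by simpa using S.nonneg) (by simpa using S'.nonneg)
  lt := Fin.addCases (by simpa using S.lt) (by simpa using S'.lt)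
  le := Fin.addCases (by simpa using S.le) (by simpa using S'.le)
  meas := Fin.addCases (fun i => by rw [Fin.append_left, Fin.append_left]; exact S.meas i)
    fun i => by rw [Fin.append_right, Fin.append_right]; exact S'.meas i
  bdd := Fin.addCases (by simpa using S.bdd) (by simpa using S'.bdd)

lemma eval_add (S S' : SimpleProcess μ P W T) : (S.add S').eval = S.eval + S'.eval := by
  ext q
  simp only [eval, Pi.add_apply]
  refine (Fin.sum_univ_add _).trans ?_
  simp [add]

/-- The product of a simple process by a real number. -/
def smul (c : ℝ) (S : SimpleProcess μ P W T) : SimpleProcess μ P W T where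
  n := S.n
  a := S.a
  b := S.b
  X k ω := c * S.X k ω
  nonneg := S.nonneg
  lt := S.lt
  le := S.le
  meas k := (S.meas k).const_mul c
  bdd k := bdd_mul ⟨|c|, fun _ => le_rfl⟩ (S.bdd k)

lemma eval_smul (c : ℝ) (S : SimpleProcess μ P W T) : (S.smul c).eval = c • S.eval := by
  ext q
  simp only [eval_eq, Pi.smul_apply, smul_eq_mul, Finset.mul_sum]
  exact Finset.sum_congr rfl fun k _ => mul_left_comm _ _ _

lemma exists_eval_eq_indicator {s : Set (Time T × Ω)} (hs : s ∈ rectangles μ P W T) :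
    ∃ S : SimpleProcess μ P W T, S.eval = s.indicator fun _ => (1 : ℝ) := by
  obtain ⟨a, b, A, ha, hab, hb, hA, rfl⟩ := hs
  refine ⟨⟨1, fun _ => a, fun _ => b, fun _ => A.indicator fun _ => 1, fun _ => ha, fun _ => hab,
    fun _ => hb, fun _ => measurable_const.indicator hA,
    fun _ => ⟨1, fun ω => by simpa using norm_indicator_le_norm_self (fun _ => (1 : ℝ)) ω⟩⟩, ?_⟩
  ext q
  simp only [eval, Finset.univ_unique, Finset.sum_singleton]
  by_cases h1 : a < (q.1 : ℝ) <;> by_cases h2 : (q.1 : ℝ) ≤ b <;> by_cases h3 : q.2 ∈ A <;>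
    simp [Set.indicator, h1, h2, h3]

lemma exists_eval_eq_of_mem_indicatorSpan {f : Time T × Ω → ℝ}
    (hf : f ∈ indicatorSpan (rectangles μ P W T)) : ∃ S : SimpleProcess μ P W T, S.eval = f := by
  induction hf using Submodule.span_induction with
  | mem f hf =>
    obtain ⟨s, hs, rfl⟩ := hf
    exact exists_eval_eq_indicator hs
  | zero => exact ⟨zero, eval_zero⟩
  | add f g _ _ hf hg =>
    obtain ⟨S, rfl⟩ := hf
    obtain ⟨S', rfl⟩ := hg
    exact ⟨S.add S', S.eval_add S'⟩
  | smul c f _ hf =>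
    obtain ⟨S, rfl⟩ := hf
    exact ⟨S.smul c, S.eval_smul c⟩

variable [IsProbabilityMeasure P] [P.IsComplete] {ψ : Time T × Ω → ℝ}

lemma exists_eLpNorm_eval_sub_lt (hT : 0 < T) (hψ : StronglyMeasurable[predictable μ P W T] ψ)
    (hψ2 : MemLp ψ 2 ((lebesgue T).prod P)) {ε : ℝ≥0∞} (hε : 0 < ε) :
    ∃ S : SimpleProcess μ P W T, eLpNorm (S.eval - ψ) 2 ((lebesgue T).prod P) < ε := by
  have hle : predictable μ P W T ≤ (inferInstance : MeasurableSpace (Time T × Ω)) := predictable_le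
  obtain ⟨s, hs, hsuniv⟩ := exists_rectangle_ae_eq_univ (μ := μ) (P := P) (W := W) hT
  have hsuniv_trim : s =ᵐ[((lebesgue T).prod P).trim hle] Set.univ := by
    rwa [ae_eq_univ, trim_measurableSet_eq hle
      (measurableSet_predictable_of_mem_rectangles hs).compl, ← ae_eq_univ]
  have hψ_trim : MemLp ψ 2 (((lebesgue T).prod P).trim hle) :=
    ⟨hψ.aestronglyMeasurable, by rw [eLpNorm_trim hle hψ]; exact hψ2.2⟩
  obtain ⟨g, hg, hgε⟩ := exists_mem_indicatorSpan_eLpNorm_sub_lt (m := predictable μ P W T) rfl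
    isPiSystem_rectangles ⟨s, hs, hsuniv_trim⟩ hψ_trim hε
  have hgm : StronglyMeasurable[predictable μ P W T] g := stronglyMeasurable_of_mem_indicatorSpan
    (fun _ => measurableSet_predictable_of_mem_rectangles) hg
  obtain ⟨S, rfl⟩ := exists_eval_eq_of_mem_indicatorSpan hg
  exact ⟨S, by rwa [eLpNorm_trim hle (hgm.sub hψ)] at hgε⟩

lemma exists_tendsto_eLpNorm_eval_sub (hT : 0 < T)
    (hψ : StronglyMeasurable[predictable μ P W T] ψ) (hψ2 : MemLp ψ 2 ((lebesgue T).prod P)) :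
    ∃ S : ℕ → SimpleProcess μ P W T,
      Tendsto (fun n => eLpNorm ((S n).eval - ψ) 2 ((lebesgue T).prod P)) atTop (𝓝 0) := by
  obtain ⟨ε, -, hε, hεlim⟩ := exists_seq_strictAnti_tendsto' (ENNReal.zero_lt_top)
  choose S hS using fun n => exists_eLpNorm_eval_sub_lt hT hψ hψ2 (hε n).1
  exact ⟨S, tendsto_of_tendsto_of_tendsto_of_le_of_le tendsto_const_nhds hεlim
    (fun _ => zero_le) fun n => (hS n).le⟩

end SimpleProcess

end Density

section Ito

variable {p : ℕ} [Fact p.Prime] {N : ℕ} {μ : Measure (Space p N)}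
  {Ω : Type*} [MeasurableSpace Ω] {P : Measure Ω} {W : NoiseTest p N → Ω → ℝ} {T : ℝ}
  [IsProbabilityMeasure P] [P.IsComplete]

lemma isItoIntegral_iff {h : U μ} {ψ : Time T × Ω → ℝ} (hψ : MemLp ψ 2 ((lebesgue T).prod P))
    {I : Lp ℝ 2 P} : IsItoIntegral μ P W T h ψ I ↔ ∃ S : ℕ → SimpleProcess μ P W T,
      Tendsto (fun n => (S n).memLp_eval.toLp (S n).eval) atTop (𝓝 (hψ.toLp ψ)) ∧
      Tendsto (fun n => ((S n).memLp_integral h).toLp ((S n).integral h)) atTop (𝓝 I) := by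
  refine exists_congr fun S => and_congr (Lp.tendsto_Lp_iff_tendsto_eLpNorm'' _ _ _ _).symm ?_
  rw [Lp.tendsto_Lp_iff_tendsto_eLpNorm']
  refine tendsto_congr fun n => eLpNorm_congr_ae ?_
  exact (((S n).memLp_integral h).coeFn_toLp.sub .rfl).symm

variable [IsFiniteMeasureOnCompacts μ] {Λ : Measure (Space p N)}

lemma IsItoIntegral.inner_eq (hW : IsGaussianNoise Λ P W) (hμ : IsSpectralMeasure Λ μ)
    {h h' : U μ} {ψ ψ' : Time T × Ω → ℝ} (hψ : MemLp ψ 2 ((lebesgue T).prod P))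
    (hψ' : MemLp ψ' 2 ((lebesgue T).prod P)) {I I' : Lp ℝ 2 P}
    (hI : IsItoIntegral μ P W T h ψ I) (hI' : IsItoIntegral μ P W T h' ψ' I') :
    inner ℝ I I' = inner ℝ h h' * inner ℝ (hψ.toLp ψ) (hψ'.toLp ψ') := by
  obtain ⟨S, hSψ, hSI⟩ := (isItoIntegral_iff hψ).1 hI
  obtain ⟨S', hSψ', hSI'⟩ := (isItoIntegral_iff hψ').1 hI'
  refine tendsto_nhds_unique (hSI.inner hSI') ?_
  simp_rw [SimpleProcess.inner_toLp_integral hW hμ]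
  exact (hSψ.inner hSψ').const_mul _

lemma IsItoIntegral.unique (hW : IsGaussianNoise Λ P W) (hμ : IsSpectralMeasure Λ μ)
    {h : U μ} {ψ : Time T × Ω → ℝ} (hψ : MemLp ψ 2 ((lebesgue T).prod P)) {I I' : Lp ℝ 2 P}
    (hI : IsItoIntegral μ P W T h ψ I) (hI' : IsItoIntegral μ P W T h ψ I') : I = I' := by
  have hnorm := norm_sub_eq_of_inner_eq (c := inner ℝ h h) real_inner_self_nonneg
    (hI.inner_eq hW hμ hψ hψ hI) (hI'.inner_eq hW hμ hψ hψ hI') (hI.inner_eq hW hμ hψ hψ hI')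
  rwa [sub_self, norm_zero, mul_zero, norm_eq_zero, sub_eq_zero] at hnorm

lemma exists_isItoIntegral (hW : IsGaussianNoise Λ P W) (hμ : IsSpectralMeasure Λ μ) (hT : 0 < T)
    (h : U μ) {ψ : Time T × Ω → ℝ} (hψm : StronglyMeasurable[predictable μ P W T] ψ)
    (hψ : MemLp ψ 2 ((lebesgue T).prod P)) : ∃ I : Lp ℝ 2 P, IsItoIntegral μ P W T h ψ I := by
  obtain ⟨S, hS⟩ := SimpleProcess.exists_tendsto_eLpNorm_eval_sub hT hψm hψ
  have heval : Tendsto (fun n => (S n).memLp_eval.toLp (S n).eval) atTop (𝓝 (hψ.toLp ψ)) :=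
    (Lp.tendsto_Lp_iff_tendsto_eLpNorm'' _ _ _ _).2 hS
  have hcauchy := cauchySeq_of_inner_eq (c := inner ℝ h h) real_inner_self_nonneg
    (x := fun n => ((S n).memLp_integral h).toLp ((S n).integral h))
    (fun i j => (S i).inner_toLp_integral hW hμ (S j) h h) heval.cauchySeq
  obtain ⟨I, hI⟩ := cauchySeq_tendsto_of_complete hcauchy
  exact ⟨I, (isItoIntegral_iff hψ).2 ⟨S, heval, hI⟩⟩

end Ito

section StochasticIntegral

lemma stronglyMeasurable_inner_const {α H : Type*} {m : MeasurableSpace α} [NormedAddCommGroup H]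
    [InnerProductSpace ℝ H] {g : α → H} (hg : StronglyMeasurable g) (h : H) :
    StronglyMeasurable fun q => inner ℝ (g q) h :=
  hg.inner stronglyMeasurable_const

variable {p : ℕ} [Fact p.Prime] {N : ℕ} {Λ μ : Measure (Space p N)} [IsFiniteMeasureOnCompacts μ]
  {Ω : Type*} [MeasurableSpace Ω] {P : Measure Ω} {W : NoiseTest p N → Ω → ℝ} {T : ℝ}
  [IsProbabilityMeasure P] [P.IsComplete] {g : Time T × Ω → U μ}

instance instCompleteSpaceU {μ : Measure (Space p N)} : CompleteSpace (U μ) :=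
  (Submodule.isClosed_topologicalClosure _).completeSpace_coe

lemma IsStochasticIntegral.unique (hW : IsGaussianNoise Λ P W) (hμ : IsSpectralMeasure Λ μ)
    (hg : MemLp g 2 ((lebesgue T).prod P)) {I I' : Lp ℝ 2 P}
    (hI : IsStochasticIntegral μ P W T g I) (hI' : IsStochasticIntegral μ P W T g I') :
    I = I' := by
  obtain ⟨w, e, -⟩ := exists_hilbertBasis ℝ (U μ)
  obtain ⟨J, hJ, hsum⟩ := hI _ e
  obtain ⟨J', hJ', hsum'⟩ := hI' _ e
  have hJJ' : J = J' := funext fun i =>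
    (hJ i).unique hW hμ (memLp_inner_const (H := U μ) hg (e i)) (hJ' i)
  exact hsum.unique (hJJ' ▸ hsum')

lemma exists_isStochasticIntegral (hW : IsGaussianNoise Λ P W) (hμ : IsSpectralMeasure Λ μ)
    (hT : 0 < T) (hgm : StronglyMeasurable[predictable μ P W T] g)
    (hg : MemLp g 2 ((lebesgue T).prod P)) :
    ∃ I : Lp ℝ 2 P, IsStochasticIntegral μ P W T g I ∧
      ∫⁻ ω, ‖I ω‖ₑ ^ 2 ∂P ≤ ∫⁻ q, ‖g q‖ₑ ^ 2 ∂((lebesgue T).prod P) := by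
  have hcoord (h : U μ) := memLp_inner_const (H := U μ) hg h
  choose J hJ using fun h : U μ => exists_isItoIntegral hW hμ hT h
    (stronglyMeasurable_inner_const (H := U μ) (m := predictable μ P W T) hgm h) (hcoord h)
  have hinner (h h' : U μ) : inner ℝ (J h) (J h') =
      inner ℝ h h' * inner ℝ (coordinateL (hg.toLp g) h) (coordinateL (hg.toLp g) h') := by
    rw [coordinateL_toLp, coordinateL_toLp]
    exact (hJ h).inner_eq hW hμ (hcoord h) (hcoord h') (hJ h')
  obtain ⟨I, hIC, hI⟩ := exists_hasSum_forall_hilbertBasis hinner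
    (C := ‖hg.toLp g‖ ^ 2) fun hv s => sum_norm_coordinateL_sq_le _ hv s
  refine ⟨I, fun ι e => ⟨fun i => J (e i), fun i => hJ _, hI e⟩, ?_⟩
  have hle : ‖I‖ₑ ≤ ‖hg.toLp g‖ₑ := enorm_le_iff_norm_le.2
    ((sq_le_sq₀ (norm_nonneg _) (norm_nonneg _)).1 hIC)
  rw [← eLpNorm_two_sq, ← eLpNorm_two_sq, ← Lp.enorm_def, ← Lp.enorm_toLp hg]
  gcongr

end StochasticIntegral

section Kernels

lemma lintegral_enorm_le_one_add {Ω : Type*} [MeasurableSpace Ω] (P : Measure Ω)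
    [IsProbabilityMeasure P] (X : Ω → ℝ) : ∫⁻ ω, ‖X ω‖ₑ ∂P ≤ 1 + ∫⁻ ω, ‖X ω‖ₑ ^ 2 ∂P := by
  have hle (a : ℝ≥0∞) : a ≤ 1 + a ^ 2 := by
    rcases le_total a 1 with h | h
    · exact h.trans le_self_add
    · exact (le_self_pow₀ h two_ne_zero).trans le_add_self
  calc ∫⁻ ω, ‖X ω‖ₑ ∂P ≤ ∫⁻ ω, (1 + ‖X ω‖ₑ ^ 2) ∂P := lintegral_mono fun ω => hle _
    _ = 1 + ∫⁻ ω, ‖X ω‖ₑ ^ 2 ∂P := by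
        rw [lintegral_add_left measurable_const, lintegral_one, measure_univ]

lemma lintegral_lintegral_enorm_le {Ω E : Type*} [MeasurableSpace Ω] [MeasurableSpace E]
    (P : Measure Ω) [IsProbabilityMeasure P] (ν : Measure E) [SFinite ν] {Y : E → Ω → ℝ}
    (hY : Measurable fun z : Ω × E => Y z.2 z.1) :
    ∫⁻ ω, ∫⁻ x, ‖Y x ω‖ₑ ∂ν ∂P ≤ (1 + ⨆ x, ∫⁻ ω, ‖Y x ω‖ₑ ^ 2 ∂P) * ν Set.univ := by
  rw [lintegral_lintegral_swap hY.enorm.aemeasurable, ← lintegral_const]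
  refine lintegral_mono fun x => (lintegral_enorm_le_one_add P _).trans ?_
  gcongr
  exact le_iSup (fun x => ∫⁻ ω, ‖Y x ω‖ₑ ^ 2 ∂P) x

lemma ae_integrable_kernel {α Ω E : Type*} [MeasurableSpace α] [MeasurableSpace Ω]
    [MeasurableSpace E] (ρ : Measure α) [IsFiniteMeasure ρ] (P : Measure Ω)
    [IsProbabilityMeasure P] (κ : Kernel α E) [IsFiniteKernel κ] {Y : α → E → Ω → ℝ}
    (hY : Measurable fun z : (α × Ω) × E => Y z.1.1 z.2 z.1.2)
    (hY2 : (⨆ (a) (x), ∫⁻ ω, ‖Y a x ω‖ₑ ^ 2 ∂P) < ⊤) :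
    ∀ᵐ q ∂(ρ.prod P), Integrable (fun x => Y q.1 x q.2) (κ q.1) := by
  have hm : Measurable fun q : α × Ω => ∫⁻ x, ‖Y q.1 x q.2‖ₑ ∂(κ q.1) :=
    Measurable.lintegral_kernel_prod_right (κ := κ.comap Prod.fst measurable_fst) hY.enorm
  have hle (a : α) : ∫⁻ ω, ∫⁻ x, ‖Y a x ω‖ₑ ∂(κ a) ∂P ≤
      (1 + ⨆ (a) (x), ∫⁻ ω, ‖Y a x ω‖ₑ ^ 2 ∂P) * κ.bound := by
    have hYa : Measurable fun z : Ω × E => Y a z.2 z.1 := hY.comp (by fun_prop : Measurable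
      fun z : Ω × E => ((a, z.1), z.2))
    refine (lintegral_lintegral_enorm_le P (κ a) hYa).trans ?_
    gcongr
    · exact le_iSup (fun a => ⨆ x, ∫⁻ ω, ‖Y a x ω‖ₑ ^ 2 ∂P) a
    · exact κ.measure_le_bound a _
  have hfin : ∫⁻ q, ∫⁻ x, ‖Y q.1 x q.2‖ₑ ∂(κ q.1) ∂(ρ.prod P) ≠ ⊤ := by
    rw [lintegral_prod _ hm.aemeasurable]
    refine ((lintegral_mono hle).trans_lt ?_).ne
    rw [lintegral_const]
    exact ENNReal.mul_lt_top (ENNReal.mul_lt_top (ENNReal.add_lt_top.2 ⟨ENNReal.one_lt_top, hY2⟩)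
      κ.bound_lt_top) (measure_lt_top _ _)
  filter_upwards [ae_lt_top hm hfin] with q hq
  exact ⟨(hY.comp measurable_prodMk_left).aestronglyMeasurable, hq⟩

lemma lintegral_mul_le_iSup_mul {α : Type*} [MeasurableSpace α] (ρ : Measure α) {f : α → ℝ≥0∞}
    (hf : ⨆ a, f a ≠ ⊤) (g : α → ℝ≥0∞) :
    ∫⁻ a, f a * g a ∂ρ ≤ (⨆ a, f a) * ∫⁻ a, g a ∂ρ := by
  rw [← lintegral_const_mul' _ _ hf]
  gcongr with a
  exact le_iSup f a

end Kernels

section Integrand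

variable {p : ℕ} [Fact p.Prime] {N : ℕ} {μ : Measure (Space p N)}
  {Ω : Type*} [MeasurableSpace Ω] {P : Measure Ω} {W : NoiseTest p N → Ω → ℝ} {T : ℝ}
  {Γ : ℝ → Measure (Space p N)} {Y : Time T → Space p N → Ω → ℝ}

lemma measurable_fst_predictable :
    Measurable[predictable μ P W T] (Prod.fst : Time T × Ω → Time T) := by
  let _ := predictable μ P W T
  suffices h : Measurable fun q : Time T × Ω => (q.1 : ℝ) from h.subtype_mk
  refine measurable_of_Ioi fun x => ?_
  rcases lt_or_ge x 0 with hx | hx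
  · convert MeasurableSet.univ
    exact Set.eq_univ_of_forall fun q => hx.trans_le q.1.2.1
  rcases lt_or_ge x T with hxT | hxT
  · refine MeasurableSpace.measurableSet_generateFrom
      ⟨x, T, Set.univ, hx, hxT, le_rfl, MeasurableSet.univ, ?_⟩
    ext q
    simp [q.1.2.2]
  · convert MeasurableSet.empty
    exact Set.eq_empty_of_forall_notMem fun q hq => (hq.trans_le q.1.2.2).not_ge hxT

lemma IsPredictableField.measurable [P.IsComplete] (hY : IsPredictableField μ P W T Y) :
    Measurable fun z : (Time T × Ω) × Space p N => Y z.1.1 z.2 z.1.2 :=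
  hY.mono (sup_le_sup_right (MeasurableSpace.comap_mono predictable_le) _) le_rfl

/-- The kernel `t ↦ Γ(t, dx)` on `[0, T]`. -/
def HypothesisA.kernel (hΓ : HypothesisA μ T Γ) : Kernel (Time T) (Space p N) where
  toFun t := Γ t
  measurable' := hΓ.measurable.comp
    (Measurable.subtype_mk (p := (· ∈ Set.Ici (0 : ℝ))) measurable_subtype_coe
      (h := fun t : Time T => t.2.1))

instance HypothesisA.instIsFiniteKernel (hΓ : HypothesisA μ T Γ) : IsFiniteKernel hΓ.kernel :=
  ⟨⟨_, hΓ.sup_mass_lt_top (max T 1) (by positivity), fun t =>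
    le_iSup₂ (f := fun t (_ : t ∈ Set.Icc 0 (max T 1)) => Γ t Set.univ) (t : ℝ)
      ⟨t.2.1, t.2.2.trans (le_max_left _ _)⟩⟩⟩

lemma HypothesisA.isFiniteMeasure (hΓ : HypothesisA μ T Γ) (t : Time T) :
    IsFiniteMeasure (Γ t) :=
  inferInstanceAs (IsFiniteMeasure (hΓ.kernel t))

lemma measurable_fourier_field {α β : Type*} {mα : MeasurableSpace α} [MeasurableSpace β]
    (κ : Kernel β (Space p N)) [IsFiniteKernel κ] {τ : α → β} (hτ : Measurable τ)
    {Z : α → Space p N → ℝ} (hZ : Measurable (Function.uncurry Z)) :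
    Measurable fun z : α × Space p N => fourierMeasure (Z z.1) (κ (τ z.1)) z.2 :=
  measurable_fourierMeasure (κ.comap τ hτ) hZ

lemma enorm_sq_eq_lintegral_of_ae_eq {u : U μ} {h : Space p N → ℂ}
    (hu : (u : Lp ℂ 2 μ) =ᵐ[μ] h) : ‖u‖ₑ ^ 2 = ∫⁻ ξ, ‖h ξ‖ₑ ^ 2 ∂μ := by
  have henorm : ‖u‖ₑ = eLpNorm (u : Lp ℂ 2 μ) 2 μ := Lp.enorm_def _
  rw [henorm, eLpNorm_congr_ae hu, eLpNorm_two_sq]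

variable [SFinite μ]

lemma stronglyMeasurable_integrand (hΓ : HypothesisA μ T Γ) (hY : IsPredictableField μ P W T Y) :
    StronglyMeasurable[predictable μ P W T] (integrand μ Γ Y) :=
  stronglyMeasurable_ofFourier (mα := predictable μ P W T)
    (measurable_fourier_field (mα := predictable μ P W T) hΓ.kernel measurable_fst_predictable
      (Z := fun q x => Y q.1 x q.2) hY)

variable [P.IsComplete]

lemma measurable_lintegral_fourier_field (hΓ : HypothesisA μ T Γ)
    (hY : IsPredictableField μ P W T Y) : Measurable fun q : Time T × Ω =>
      ∫⁻ ξ, ‖fourierMeasure (fun x => Y q.1 x q.2) (Γ q.1) ξ‖ₑ ^ 2 ∂μ :=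
  have hF := measurable_fourier_field hΓ.kernel measurable_fst
    (Z := fun (q : Time T × Ω) x => Y q.1 x q.2) hY.measurable
  (hF.enorm.pow_const 2).lintegral_prod_right'

variable [IsProbabilityMeasure P] [IsFiniteMeasureOnCompacts μ] {Λ : Measure (Space p N)}

lemma lintegral_fourier_field_le (hμ : IsSpectralMeasure Λ μ) (hΓ : HypothesisA μ T Γ)
    (hY : IsPredictableField μ P W T Y) :
    ∫⁻ q, ∫⁻ ξ, ‖fourierMeasure (fun x => Y q.1 x q.2) (Γ q.1) ξ‖ₑ ^ 2 ∂μ ∂((lebesgue T).prod P) ≤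
      ∫⁻ t : Time T, (⨆ x : Space p N, ∫⁻ ω, ‖Y t x ω‖ₑ ^ 2 ∂P) *
        ∫⁻ ξ, ‖fourierPos (Γ t) ξ‖ₑ ^ 2 ∂μ ∂(lebesgue T) := by
  rw [lintegral_prod _ (measurable_lintegral_fourier_field hΓ hY).aemeasurable]
  refine lintegral_mono fun t => ?_
  have := hΓ.isFiniteMeasure t
  exact lintegral_fourierMeasure_le P hμ (Y := fun ω x => Y t x ω) (hY.measurable.comp
    (by fun_prop : Measurable fun z : Ω × Space p N => ((t, z.1), z.2)))

lemma lintegral_fourier_field_lt_top (hμ : IsSpectralMeasure Λ μ) (hΓ : HypothesisA μ T Γ)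
    (hY : IsPredictableField μ P W T Y)
    (hY2 : (⨆ (t : Time T) (x : Space p N), ∫⁻ ω, ‖Y t x ω‖ₑ ^ 2 ∂P) < ⊤) :
    ∫⁻ q, ∫⁻ ξ, ‖fourierMeasure (fun x => Y q.1 x q.2) (Γ q.1) ξ‖ₑ ^ 2 ∂μ
      ∂((lebesgue T).prod P) < ⊤ :=
  (lintegral_fourier_field_le hμ hΓ hY).trans_lt <|
    (lintegral_mul_le_iSup_mul _ hY2.ne _).trans_lt (ENNReal.mul_lt_top hY2 hΓ.integral_lt_top)

lemma ae_integrand_eq (hμ : IsSpectralMeasure Λ μ) (hΓ : HypothesisA μ T Γ)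
    (hY : IsPredictableField μ P W T Y)
    (hY2 : (⨆ (t : Time T) (x : Space p N), ∫⁻ ω, ‖Y t x ω‖ₑ ^ 2 ∂P) < ⊤) :
    ∀ᵐ q ∂((lebesgue T).prod P), Integrable (fun x => Y q.1 x q.2) (Γ q.1) ∧
      (integrand μ Γ Y q : Lp ℂ 2 μ) =ᵐ[μ] fourierMeasure (fun x => Y q.1 x q.2) (Γ q.1) := by
  filter_upwards [ae_integrable_kernel _ P hΓ.kernel hY.measurable hY2,
    ae_lt_top (measurable_lintegral_fourier_field hΓ hY)
      (lintegral_fourier_field_lt_top hμ hΓ hY hY2).ne] with q hint hlt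
  have := hΓ.isFiniteMeasure q.1
  have hF : MemLp (fourierMeasure (fun x => Y q.1 x q.2) (Γ q.1)) 2 μ :=
    (memLp_two_iff_lintegral_enorm_sq_lt_top
      (measurable_fourierMeasure_right _ hint.1).aestronglyMeasurable).2 hlt
  exact ⟨hint, coeFn_ofFourier ⟨⟨_, toLp_fourierMeasure_mem hint hF⟩, hF.coeFn_toLp⟩⟩

lemma lintegral_enorm_integrand_sq (hμ : IsSpectralMeasure Λ μ) (hΓ : HypothesisA μ T Γ)
    (hY : IsPredictableField μ P W T Y)
    (hY2 : (⨆ (t : Time T) (x : Space p N), ∫⁻ ω, ‖Y t x ω‖ₑ ^ 2 ∂P) < ⊤) :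
    ∫⁻ q, ‖integrand μ Γ Y q‖ₑ ^ 2 ∂((lebesgue T).prod P) =
      ∫⁻ q, ∫⁻ ξ, ‖fourierMeasure (fun x => Y q.1 x q.2) (Γ q.1) ξ‖ₑ ^ 2 ∂μ
        ∂((lebesgue T).prod P) :=
  lintegral_congr_ae <| (ae_integrand_eq hμ hΓ hY hY2).mono fun _ hq =>
    enorm_sq_eq_lintegral_of_ae_eq hq.2

lemma memLp_integrand (hμ : IsSpectralMeasure Λ μ) (hΓ : HypothesisA μ T Γ)
    (hY : IsPredictableField μ P W T Y)
    (hY2 : (⨆ (t : Time T) (x : Space p N), ∫⁻ ω, ‖Y t x ω‖ₑ ^ 2 ∂P) < ⊤) :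
    MemLp (integrand μ Γ Y) 2 ((lebesgue T).prod P) := by
  have hG := ((stronglyMeasurable_integrand hΓ hY).mono predictable_le).aestronglyMeasurable
    (μ := (lebesgue T).prod P)
  rw [memLp_two_iff_lintegral_enorm_sq_lt_top hG, lintegral_enorm_integrand_sq hμ hΓ hY hY2]
  exact lintegral_fourier_field_lt_top hμ hΓ hY hY2

end Integrand

end PadicNoise

end

theorem mainTheorem4 (p : ℕ) [Fact p.Prime] (N : ℕ)
    {Ω : Type*} [MeasurableSpace Ω] (P : Measure Ω) [IsProbabilityMeasure P] [P.IsComplete]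
    (Λ μ : Measure (PadicNoise.Space p N)) [Λ.Regular] [μ.Regular]
    (hμ : PadicNoise.IsSpectralMeasure Λ μ)
    (W : PadicNoise.NoiseTest p N → Ω → ℝ) (hW : PadicNoise.IsGaussianNoise Λ P W)
    (T : ℝ) (hT : 0 < T)
    (Γ : ℝ → Measure (PadicNoise.Space p N)) (hΓ : PadicNoise.HypothesisA μ T Γ)
    (Y : PadicNoise.Time T → PadicNoise.Space p N → Ω → ℝ)
    (hY : PadicNoise.IsPredictableField μ P W T Y)
    (hY2 : (⨆ (t : PadicNoise.Time T) (x : PadicNoise.Space p N),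
      ∫⁻ ω, ‖Y t x ω‖ₑ ^ 2 ∂P) < ⊤) :
    -- the cylindrical Wiener process associated with `W` is well defined
    (∀ t : ℝ, 0 ≤ t → PadicNoise.IsWienerExtension μ P W t (PadicNoise.wiener μ P W t)) ∧
    -- almost everywhere, `Y(t) Γ(t)` is a finite signed measure that belongs to `U`
    (∀ᵐ q ∂((PadicNoise.lebesgue T).prod P),
      Integrable (fun x => Y q.1 x q.2) (Γ q.1) ∧
      (PadicNoise.integrand μ Γ Y q : Lp ℂ 2 μ) =ᵐ[μ]
        PadicNoise.fourierMeasure (fun x => Y q.1 x q.2) (Γ q.1)) ∧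
    -- `G` is predictable and square integrable
    StronglyMeasurable[PadicNoise.predictable μ P W T] (PadicNoise.integrand μ Γ Y) ∧
    MemLp (PadicNoise.integrand μ Γ Y) 2 ((PadicNoise.lebesgue T).prod P) ∧
    -- the norm of `G`
    ∫⁻ ω, ∫⁻ t, ‖PadicNoise.integrand μ Γ Y (t, ω)‖ₑ ^ 2 ∂(PadicNoise.lebesgue T) ∂P =
      ∫⁻ ω, ∫⁻ t : PadicNoise.Time T, ∫⁻ ξ,
        ‖PadicNoise.fourierMeasure (fun x => Y t x ω) (Γ t) ξ‖ₑ ^ 2 ∂μ ∂(PadicNoise.lebesgue T) ∂P ∧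
    ∫⁻ ω, ∫⁻ t, ‖PadicNoise.integrand μ Γ Y (t, ω)‖ₑ ^ 2 ∂(PadicNoise.lebesgue T) ∂P ≤
      (⨆ (t : PadicNoise.Time T) (x : PadicNoise.Space p N), ∫⁻ ω, ‖Y t x ω‖ₑ ^ 2 ∂P) *
        ∫⁻ t : PadicNoise.Time T, ∫⁻ ξ, ‖PadicNoise.fourierPos (Γ t) ξ‖ₑ ^ 2 ∂μ ∂(PadicNoise.lebesgue T) ∧
    -- the stochastic integral `G · W` and its second moment
    ∃ I : Lp ℝ 2 P, PadicNoise.IsStochasticIntegral μ P W T (PadicNoise.integrand μ Γ Y) I ∧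
      (∀ I', PadicNoise.IsStochasticIntegral μ P W T (PadicNoise.integrand μ Γ Y) I' →
        I' = I) ∧
      ∫⁻ ω, ‖I ω‖ₑ ^ 2 ∂P ≤
        ∫⁻ t : PadicNoise.Time T, (⨆ x : PadicNoise.Space p N, ∫⁻ ω, ‖Y t x ω‖ₑ ^ 2 ∂P) *
          ∫⁻ ξ, ‖PadicNoise.fourierPos (Γ t) ξ‖ₑ ^ 2 ∂μ ∂(PadicNoise.lebesgue T) := by
  have hpred := PadicNoise.stronglyMeasurable_integrand hΓ hY
  have hmem := PadicNoise.memLp_integrand hμ hΓ hY hY2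
  have hnorm := PadicNoise.lintegral_enorm_integrand_sq hμ hΓ hY hY2
  have hbound := hnorm.trans_le (PadicNoise.lintegral_fourier_field_le hμ hΓ hY)
  have hswap := lintegral_prod_symm _ (hmem.1.enorm.pow_const 2)
  have hswapF := lintegral_prod_symm _
    ((PadicNoise.measurable_lintegral_fourier_field hΓ hY).aemeasurable
      (μ := (PadicNoise.lebesgue T).prod P))
  obtain ⟨I, hI, hIle⟩ := PadicNoise.exists_isStochasticIntegral hW hμ hT hpred hmem
  refine ⟨fun t ht => PadicNoise.isWienerExtension_wiener hW hμ ht,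
    PadicNoise.ae_integrand_eq hμ hΓ hY hY2, hpred, hmem, ?_, ?_,
    I, hI, fun I' hI' => hI'.unique hW hμ hmem hI, hIle.trans hbound⟩
  · exact hswap.symm.trans (hnorm.trans hswapF)
  · exact hswap.symm.trans_le
      (hbound.trans (PadicNoise.lintegral_mul_le_iSup_mul _ hY2.ne _))
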